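/- **Setting.** Fix a set of base types $b$ and a set of operation symbols $\mathtt{op}$. *Effect theories.* Ground types are $\hat A ::= b \mid \hat A_1\times\dots\times\hat A_n \mid \hat A_1+\dots+\hat A_n$ ($n\ge 0$). Ground terms are $\hat V ::= x \mid \langle \hat V_1,\dots,\hat V_n\rangle \mid \pi_i\,\hat V \mid \iota_i\,\hat V$. A signature $\Sigma$ is a finite partial function that assigns to an operation symbol a pair of ground types, written $(\mathtt{op}:\hat A_{\mathtt{op}}\rightarrowtriangle\hat B_{\mathtt{op}})\in\Sigma$. Effect theory terms are $\hat M ::= \mathtt{return}\,\hat V \mid \mathtt{let}\,x=\mathtt{op}(\hat V)\,\mathtt{in}\,\hat M \mid \mathtt{case}\,\hat V\,\mathtt{of}\,\{\iota_i\,x_i\mapsto\hat M_i\}_{i=1}^n$, with the evident typing $\hat\Delta\vdash\hat M:\hat A!\Sigma$ for ground contexts $\hat\Delta$. An effect theory is a pair $\mathcal T=(\Sigma,\mathcal E)$, where $\mathcal E$ is a set of equational axioms $\hat\Delta\vdash\hat M\sim\hat N:\hat A!\Sigma$. *The calculus $\lambda_{\mathrm{eff}}^{\mathcal E}$.* Value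 types are $A ::= b\mid A\to C\mid A_1\times\dots\times A_n\mid A_1+\dots+A_n$, computation types are $C ::= A!\Sigma/\mathcal E$, and handler types are $\Sigma\Rightarrow C$. Terms are type-annotated and taken up to renaming of bound variables: $$V ::= x\mid\lambda x.M\mid\langle V_1,\dots,V_n\rangle\mid\pi_i\,V\mid\iota_i\,V,$$ $$M ::= V\,W\mid\mathtt{return}\,V\mid\mathtt{let}\,x=M\,\mathtt{in}\,N\mid\mathtt{op}(V)\mid\mathtt{case}\,V\,\mathtt{of}\,\{\iota_i\,x_i\mapsto M_i\}_i\mid\mathtt{handle}\,M\,\mathtt{with}\,H\,\mathtt{to}\,x.N,$$ and a handler $\Gamma\vdash H:\Sigma\Rightarrow C$ consists of one clause $\Gamma,x:\hat A_{\mathtt{op}},k:\hat B_{\mathtt{op}}\to C\vdash M_{\mathtt{op}}:C$ for each $\mathtt{op}\in\Sigma$. Typing and derivable equality $\Gamma\vdash M=N:C$ (likewise for values and handlers) are defined by simultaneous induction. The typing rules are the usual ones of fine-grain call-by-value with $\mathtt{op}(V):\hat B_{\mathtt{op}}!\Sigma/\mathcal E$ for $V:\hat A_{\mathtt{op}}$;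 and $\mathtt{handle}\,M\,\mathtt{with}\,H\,\mathtt{to}\,x.N:C$ is well typed if $\Gamma\vdash M:A!\Sigma/\mathcal E$, $\Gamma,x:A\vdash N:C$, and $\Gamma\vdash H:\Sigma\Rightarrow C$ *respects* $\mathcal E$, i.e. $\Gamma,\hat\Delta,k:\hat A\to C\vdash\hat M[H,k]=\hat N[H,k]:C$ is derivable for every axiom $\hat\Delta\vdash\hat M\sim\hat N:\hat A!\Sigma$ in $\mathcal E$, where $(\mathtt{return}\,\hat V)[H,k]=k\,\hat V$, $(\mathtt{let}\,x=\mathtt{op}(\hat V)\,\mathtt{in}\,\hat N)[H,k]=M_{\mathtt{op}}[\hat V/x,\lambda x.\hat N[H,k]/k']$ for the clause $\mathtt{op}(x,k')\mapsto M_{\mathtt{op}}$ of $H$, and $[H,k]$ commutes with $\mathtt{case}$. Derivable equality is the least congruence on well-typed terms (clausewise on handlers) that contains the $\beta$- and $\eta$-laws for functions, products and sums, namely for sums $\mathtt{case}\,\iota_i V\,\mathtt{of}\,\{\iota_j x_j\mapsto M_j\}_j=M_i[V/x_i]$ and $\mathtt{case}\,V\,\mathtt{of}\,\{\iota_i y\mapsto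 M[\iota_i y/x]\}_i=M[V/x]$; the three monad laws for $\mathtt{return}$ and $\mathtt{let}$; the laws $$\mathtt{handle}\,(\mathtt{return}\,V)\,\mathtt{with}\,H\,\mathtt{to}\,x.N=N[V/x],$$ $$\mathtt{handle}\,(\mathtt{let}\,x=L\,\mathtt{in}\,M)\,\mathtt{with}\,H\,\mathtt{to}\,y.N=\mathtt{handle}\,L\,\mathtt{with}\,H\,\mathtt{to}\,x.(\mathtt{handle}\,M\,\mathtt{with}\,H\,\mathtt{to}\,y.N),$$ $$\mathtt{handle}\,\mathtt{op}(V)\,\mathtt{with}\,H\,\mathtt{to}\,x.N=M_{\mathtt{op}}[V/x,\lambda x.N/k];$$ and, for each axiom $\hat\Delta\vdash\hat M\sim\hat N:\hat A!\Sigma$ in $\mathcal E$ and each substitution $\sigma:\Gamma\to\hat\Delta$ of well-typed values, the equation $\Gamma\vdash\hat M[\sigma]=\hat N[\sigma]:\hat A!\Sigma/\mathcal E$. *Models.* A $\lambda_{\mathrm{eff}}^{\mathcal E}$-model consists of the following. (1) A category $\mathbb C$ with (chosen) finite products, an object $[\![b]\!]$ for each base type, and a strong monad $T_{\mathcal T}$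 on $\mathbb C$ for each effect theory $\mathcal T$. (2) Kleisli exponentials $Y\Rightarrow_{\mathcal T}Z$, i.e. bijections $\Lambda:\mathbb C(X\times Y,T_{\mathcal T}Z)\cong\mathbb C(X,Y\Rightarrow_{\mathcal T}Z)$ natural in $X$, with $\mathrm{ev}=\Lambda^{-1}(\mathrm{id})$. (3) Joint distributive Kleisli coproducts: for each finite family $(X_i)_i$ an object $\sum_iX_i$ with morphisms $\iota_i:X_i\to\sum_iX_i$ such that for all $\mathcal T,Z,Y$ and $f_i:Z\times X_i\to T_{\mathcal T}Y$ there is a unique $[f_i]_i:Z\times\sum_iX_i\to T_{\mathcal T}Y$ with $[f_i]_i\circ(\mathrm{id}\times\iota_i)=f_i$ for all $i$. These data interpret value types, with $[\![A\to B!\mathcal T]\!]=[\![A]\!]\Rightarrow_{\mathcal T}[\![B]\!]$, as well as contexts and ground terms. Put $$\mathrm{Alg}^{\mathcal T'}_\Sigma(X)=\prod_{\mathtt{op}\in\Sigma}\bigl([\![\hat A_{\mathtt{op}}]\!]\times([\![\hat B_{\mathtt{op}}]\!]\Rightarrow_{\mathcal T'}X)\bigr)\Rightarrow_{\mathcal T'}X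 .$$ For $\hat\Delta\vdash\hat M:\hat A!\Sigma$ define $(\!|\hat M|\!):\mathrm{Alg}^{\mathcal T'}_\Sigma(X)\to([\![\hat\Delta]\!]\times([\![\hat A]\!]\Rightarrow_{\mathcal T'}X))\Rightarrow_{\mathcal T'}X$ by recursion; in elements $(h,(d,k))$ its transpose $\Lambda^{-1}(\!|\hat M|\!)$ is $\mathrm{ev}(k,[\![\hat V]\!](d))$ for $\mathtt{return}\,\hat V$; $\mathrm{ev}\bigl(\pi_{\mathtt{op}}h,([\![\hat V]\!](d),\Lambda(y\mapsto\Lambda^{-1}(\!|\hat N|\!)(h,((d,y),k))))\bigr)$ for $\mathtt{let}\,x=\mathtt{op}(\hat V)\,\mathtt{in}\,\hat N$; and the Kleisli copairing of the $y\mapsto\Lambda^{-1}(\!|\hat M_i|\!)(h,((d,y),k))$ applied to $[\![\hat V]\!](d)$ for $\mathtt{case}$. A morphism $h:Z\to\mathrm{Alg}^{\mathcal T'}_\Sigma(X)$ *satisfies* $\mathcal E$ if $(\!|\hat M|\!)\circ h=(\!|\hat N|\!)\circ h$ for all axioms $\hat M\sim\hat N$ in $\mathcal E$; such $h$ form a subpresheaf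 $H_{\mathcal T}$ of $\mathbb C(-,\mathrm{Alg}^{\mathcal T'}_\Sigma(X))$. (4) For each $\mathcal T=(\Sigma,\mathcal E)$ and $\mathtt{op}\in\Sigma$ a morphism $[\![\mathtt{op}]\!]_{\mathcal T}:[\![\hat A_{\mathtt{op}}]\!]\to T_{\mathcal T}[\![\hat B_{\mathtt{op}}]\!]$ such that $[\![\hat M]\!]=[\![\hat N]\!]$ for all axioms in $\mathcal E$, where $[\![\mathtt{return}\,\hat V]\!]=\eta\circ[\![\hat V]\!]$, $[\![\mathtt{let}\,x=\mathtt{op}(\hat V)\,\mathtt{in}\,\hat M]\!]=\mu\circ T[\![\hat M]\!]\circ\mathrm{st}\circ\langle\mathrm{id},[\![\mathtt{op}]\!]\circ[\![\hat V]\!]\rangle$, and $[\![\mathtt{case}\,\hat V\,\mathtt{of}\,\{\iota_i x_i\mapsto\hat M_i\}]\!]=[[\![\hat M_i]\!]]_i\circ\langle\mathrm{id},[\![\hat V]\!]\rangle$. (5) For all $\mathcal T,\mathcal T'$ and $X\in\mathbb C$ a natural transformation $\mathbf{handle}:H_{\mathcal T}\times\mathbb C(-,T_{\mathcal T}T_{\mathcal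 T'}X)\to\mathbb C(-,T_{\mathcal T'}X)$ such that for $h\in H_{\mathcal T}(Z)$ and all $f$ of suitable type $$\mathbf{handle}(h,\eta\circ f)=f,$$ $$\mathbf{handle}(h,\mu\circ f)=\mathbf{handle}(h,T_{\mathcal T}(\mathbf{handle}(h\circ\pi_1,\pi_2))\circ\mathrm{st}\circ\langle\mathrm{id},f\rangle),$$ $$\mathbf{handle}(h,T_{\mathcal T}\mathrm{ev}\circ\mathrm{st}\circ\mathrm{swap}\circ([\![\mathtt{op}]\!]_{\mathcal T}\times\mathrm{id})\circ f)=\mathrm{ev}\circ\langle\pi_{\mathtt{op}}\circ h,f\rangle .$$ *Interpretation.* In a model, typed terms are interpreted by partially defined morphisms $[\![V]\!]:[\![\Gamma]\!]\to[\![A]\!]$, $[\![M]\!]:[\![\Gamma]\!]\to T_{\mathcal T}[\![A]\!]$ and $[\![H]\!]=\langle\Lambda([\![M_{\mathtt{op}}]\!]\circ\alpha^{-1})\rangle_{\mathtt{op}\in\Sigma}:[\![\Gamma]\!]\to\mathrm{Alg}^{\mathcal T'}_\Sigma([\![B]\!])$ for $H:\Sigma\Rightarrow B!\mathcal T'$,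 where $\alpha$ is the associativity isomorphism of products. The clauses are the standard ones of fine-grain call-by-value, $[\![\mathtt{op}(V)]\!]=[\![\mathtt{op}]\!]_{\mathcal T}\circ[\![V]\!]$, and $$[\![\mathtt{handle}\,M\,\mathtt{with}\,H\,\mathtt{to}\,x.N]\!]=\mathbf{handle}([\![H]\!],T_{\mathcal T}[\![N]\!]\circ\mathrm{st}\circ\langle\mathrm{id},[\![M]\!]\rangle)$$ if $[\![H]\!]\in H_{\mathcal T}([\![\Gamma]\!])$, and undefined otherwise. **Theorem (completeness).** Let $\Gamma\vdash M:A!\Sigma/\mathcal E$ and $\Gamma\vdash N:A!\Sigma/\mathcal E$ be well-typed computation terms of $\lambda_{\mathrm{eff}}^{\mathcal E}$. If $[\![M]\!]=[\![N]\!]$ in every $\lambda_{\mathrm{eff}}^{\mathcal E}$-model, then $\Gamma\vdash M=N:A!\Sigma/\mathcal E$ is derivable. The same holds for well-typed value terms $\Gamma\vdash V,W:A$ and for well-typed handlers $\Gamma\vdash H,H':\Sigma\Rightarrow C$. -/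

import Mathlib

open CategoryTheory MonoidalCategory CartesianMonoidalCategory

universe u v w

-- so that `X ⟶ Y` always elaborates to the hom-sets of the category structure itself
attribute [-instance] CategoryTheory.catToReflQuiver

namespace EffCalc

/-! ## Ground types, signatures, effect theory terms, effect theories -/

/-- Ground types: base types, finite products and finite sums. -/
inductive GTy (Base : Type u) : Type u
  | base (b : Base) : GTy Base
  | prod {n : ℕ} (A : Fin n → GTy Base) : GTy Base
  | sum {n : ℕ} (A : Fin n → GTy Base) : GTy Base

/-- Operation signatures: a finite set of operation symbols, each with an argument type and a
result type, both ground. -/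
structure Sig (Base Op : Type u) : Type u where
  ops : Finset Op
  arg : {o : Op // o ∈ ops} → GTy Base
  res : {o : Op // o ∈ ops} → GTy Base

/-- The operation symbols of a signature. -/
abbrev Sig.Idx {Base Op : Type u} (S : Sig Base Op) : Type u := {o : Op // o ∈ S.ops}

/-- Typed de Bruijn variables. A context is a list whose head is the most recent variable. -/
inductive Var {α : Type u} : List α → α → Type u
  | zero {Γ : List α} {a : α} : Var (a :: Γ) a
  | succ {Γ : List α} {a b : α} (x : Var Γ a) : Var (b :: Γ) a

/-- Ground terms `Δ ⊢ V : A`. -/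
inductive GTm {Base : Type u} : List (GTy Base) → GTy Base → Type u
  | var {Δ : List (GTy Base)} {A : GTy Base} (x : Var Δ A) : GTm Δ A
  | tuple {Δ : List (GTy Base)} {n : ℕ} {A : Fin n → GTy Base}
      (V : ∀ i, GTm Δ (A i)) : GTm Δ (.prod A)
  | proj {Δ : List (GTy Base)} {n : ℕ} {A : Fin n → GTy Base}
      (i : Fin n) (V : GTm Δ (.prod A)) : GTm Δ (A i)
  | inj {Δ : List (GTy Base)} {n : ℕ} {A : Fin n → GTy Base}
      (i : Fin n) (V : GTm Δ (A i)) : GTm Δ (.sum A)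

/-- Effect theory terms `Δ ⊢ M : A ! S`; `letop o V M` is `let x = o(V) in M`. -/
inductive ETm {Base Op : Type u} (S : Sig Base Op) : List (GTy Base) → GTy Base → Type u
  | ret {Δ : List (GTy Base)} {A : GTy Base} (V : GTm Δ A) : ETm S Δ A
  | letop {Δ : List (GTy Base)} {A : GTy Base} (o : S.Idx) (V : GTm Δ (S.arg o))
      (M : ETm S (S.res o :: Δ) A) : ETm S Δ A
  | case {Δ : List (GTy Base)} {A : GTy Base} {n : ℕ} {B : Fin n → GTy Base}
      (V : GTm Δ (.sum B)) (M : ∀ i, ETm S (B i :: Δ) A) : ETm S Δ A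

/-- Equational axioms `Δ ⊢ lhs ∼ rhs : A ! S`. -/
structure EqAx {Base Op : Type u} (S : Sig Base Op) : Type u where
  ctx : List (GTy Base)
  ty : GTy Base
  lhs : ETm S ctx ty
  rhs : ETm S ctx ty

/-- Effect theories `(Σ, ℰ)`. -/
structure Theory (Base Op : Type u) : Type u where
  sig : Sig Base Op
  ax : Set (EqAx sig)

/-! ## Types and terms of the calculus -/

/-- Value types; `fn A B 𝒯` is the function type `A → B ! 𝒯`. -/
inductive Ty (Base Op : Type u) : Type u
  | base (b : Base) : Ty Base Op
  | fn (A B : Ty Base Op) (𝒯 : Theory Base Op) : Ty Base Op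
  | prod {n : ℕ} (A : Fin n → Ty Base Op) : Ty Base Op
  | sum {n : ℕ} (A : Fin n → Ty Base Op) : Ty Base Op

/-- Ground types as value types. -/
def GTy.toTy {Base : Type u} (Op : Type u) : GTy Base → Ty Base Op
  | .base b => .base b
  | .prod A => .prod fun i => (A i).toTy Op
  | .sum A => .sum fun i => (A i).toTy Op

/-- The argument type of an operation, as a value type. -/
abbrev Sig.argTy {Base Op : Type u} (S : Sig Base Op) (o : S.Idx) : Ty Base Op :=
  (S.arg o).toTy Op

/-- The result type of an operation, as a value type. -/
abbrev Sig.resTy {Base Op : Type u} (S : Sig Base Op) (o : S.Idx) : Ty Base Op :=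
  (S.res o).toTy Op

/-- What a term is classified by: a value type `A`, or a computation type `A ! 𝒯`. -/
inductive Kind (Base Op : Type u) : Type u
  | val (A : Ty Base Op) : Kind Base Op
  | cmp (A : Ty Base Op) (𝒯 : Theory Base Op) : Kind Base Op

abbrev Ctx (Base Op : Type u) : Type u := List (Ty Base Op)

/-- Type-annotated terms in context, up to renaming of bound variables. They obey all typing rules
except the side condition that a handler used in `handle` has to respect the axioms of the handled
theory; that condition is imposed by `Tm.Wf`, which is defined together with the equational
theory. In `handle M H N`, the clause `H o` lives in the context `Γ, x : A_o, k : B_o → C`. -/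
inductive Tm {Base Op : Type u} : Ctx Base Op → Kind Base Op → Type u
  | var {Γ : Ctx Base Op} {A : Ty Base Op} (x : Var Γ A) : Tm Γ (.val A)
  | lam {Γ : Ctx Base Op} {A B : Ty Base Op} {𝒯 : Theory Base Op}
      (M : Tm (A :: Γ) (.cmp B 𝒯)) : Tm Γ (.val (.fn A B 𝒯))
  | tuple {Γ : Ctx Base Op} {n : ℕ} {A : Fin n → Ty Base Op}
      (V : ∀ i, Tm Γ (.val (A i))) : Tm Γ (.val (.prod A))
  | proj {Γ : Ctx Base Op} {n : ℕ} {A : Fin n → Ty Base Op}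
      (i : Fin n) (V : Tm Γ (.val (.prod A))) : Tm Γ (.val (A i))
  | inj {Γ : Ctx Base Op} {n : ℕ} {A : Fin n → Ty Base Op}
      (i : Fin n) (V : Tm Γ (.val (A i))) : Tm Γ (.val (.sum A))
  | app {Γ : Ctx Base Op} {A B : Ty Base Op} {𝒯 : Theory Base Op}
      (V : Tm Γ (.val (.fn A B 𝒯))) (W : Tm Γ (.val A)) : Tm Γ (.cmp B 𝒯)
  | ret {Γ : Ctx Base Op} {A : Ty Base Op} {𝒯 : Theory Base Op}
      (V : Tm Γ (.val A)) : Tm Γ (.cmp A 𝒯)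
  | letin {Γ : Ctx Base Op} {A B : Ty Base Op} {𝒯 : Theory Base Op}
      (M : Tm Γ (.cmp A 𝒯)) (N : Tm (A :: Γ) (.cmp B 𝒯)) : Tm Γ (.cmp B 𝒯)
  | op {Γ : Ctx Base Op} {𝒯 : Theory Base Op} (o : 𝒯.sig.Idx)
      (V : Tm Γ (.val (𝒯.sig.argTy o))) : Tm Γ (.cmp (𝒯.sig.resTy o) 𝒯)
  | case {Γ : Ctx Base Op} {n : ℕ} {A : Fin n → Ty Base Op} {B : Ty Base Op}
      {𝒯 : Theory Base Op} (V : Tm Γ (.val (.sum A)))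
      (M : ∀ i, Tm (A i :: Γ) (.cmp B 𝒯)) : Tm Γ (.cmp B 𝒯)
  | handle {Γ : Ctx Base Op} {A B : Ty Base Op} {𝒯 𝒯' : Theory Base Op}
      (M : Tm Γ (.cmp A 𝒯))
      (H : ∀ o : 𝒯.sig.Idx,
        Tm (.fn (𝒯.sig.resTy o) B 𝒯' :: 𝒯.sig.argTy o :: Γ) (.cmp B 𝒯'))
      (N : Tm (A :: Γ) (.cmp B 𝒯')) : Tm Γ (.cmp B 𝒯')

/-- Value terms. -/
abbrev Val {Base Op : Type u} (Γ : Ctx Base Op) (A : Ty Base Op) : Type u := Tm Γ (.val A)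

/-- Computation terms of type `A ! 𝒯`. -/
abbrev Cmp {Base Op : Type u} (Γ : Ctx Base Op) (A : Ty Base Op) (𝒯 : Theory Base Op) : Type u :=
  Tm Γ (.cmp A 𝒯)

/-- Handlers of type `S ⇒ B ! 𝒯'`: one operation clause for each operation of `S`. -/
abbrev Hdl {Base Op : Type u} (Γ : Ctx Base Op) (S : Sig Base Op) (B : Ty Base Op)
    (𝒯' : Theory Base Op) : Type u :=
  ∀ o : S.Idx, Cmp (.fn (S.resTy o) B 𝒯' :: S.argTy o :: Γ) B 𝒯'

section Substitution

variable {Base Op : Type u}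

/-- Renamings of variables. -/
abbrev Ren (Γ Δ : Ctx Base Op) : Type u := ∀ ⦃A : Ty Base Op⦄, Var Γ A → Var Δ A

/-- The extension of a renaming under a binder. -/
def Ren.up {Γ Δ : Ctx Base Op} (ρ : Ren Γ Δ) {B : Ty Base Op} : Ren (B :: Γ) (B :: Δ)
  | _, .zero => .zero
  | _, .succ x => .succ (ρ x)

/-- The action of a renaming on terms. -/
def Tm.rename : ∀ {Γ : Ctx Base Op} {s : Kind Base Op}, Tm Γ s →
    ∀ {Δ : Ctx Base Op}, Ren Γ Δ → Tm Δ s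
  | _, _, .var x, _, ρ => .var (ρ x)
  | _, _, .lam M, _, ρ => .lam (M.rename ρ.up)
  | _, _, .tuple V, _, ρ => .tuple fun i => (V i).rename ρ
  | _, _, .proj i V, _, ρ => .proj i (V.rename ρ)
  | _, _, .inj i V, _, ρ => .inj i (V.rename ρ)
  | _, _, .app V W, _, ρ => .app (V.rename ρ) (W.rename ρ)
  | _, _, .ret V, _, ρ => .ret (V.rename ρ)
  | _, _, .letin M N, _, ρ => .letin (M.rename ρ) (N.rename ρ.up)
  | _, _, .op o V, _, ρ => .op o (V.rename ρ)
  | _, _, .case V M, _, ρ => .case (V.rename ρ) fun i => (M i).rename ρ.up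
  | _, _, .handle M H N, _, ρ =>
      .handle (M.rename ρ) (fun o => (H o).rename ρ.up.up) (N.rename ρ.up)

/-- Weakening by one variable. -/
abbrev Tm.wk {Γ : Ctx Base Op} {s : Kind Base Op} (M : Tm Γ s) {B : Ty Base Op} :
    Tm (B :: Γ) s :=
  M.rename fun _ x => .succ x

/-- The action of a renaming on handlers. -/
def Hdl.rename {Γ Δ : Ctx Base Op} {S : Sig Base Op} {B : Ty Base Op} {𝒯' : Theory Base Op}
    (H : Hdl Γ S B 𝒯') (ρ : Ren Γ Δ) : Hdl Δ S B 𝒯' :=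
  fun o => (H o).rename ρ.up.up

/-- Substitutions: a value term over `Δ` for each variable of `Γ`. -/
abbrev Sub (Γ Δ : Ctx Base Op) : Type u := ∀ ⦃A : Ty Base Op⦄, Var Γ A → Val Δ A

/-- The extension of a substitution under a binder. -/
def Sub.up {Γ Δ : Ctx Base Op} (σ : Sub Γ Δ) {B : Ty Base Op} : Sub (B :: Γ) (B :: Δ)
  | _, .zero => .var .zero
  | _, .succ x => (σ x).wk

/-- The substitution `σ` extended by a value for the most recent variable. -/
def Sub.cons {Γ Δ : Ctx Base Op} (σ : Sub Γ Δ) {B : Ty Base Op} (V : Val Δ B) : Sub (B :: Γ) Δ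
  | _, .zero => V
  | _, .succ x => σ x

/-- The identity substitution. -/
def Sub.ids (Γ : Ctx Base Op) : Sub Γ Γ := fun _ x => .var x

/-- Capture-avoiding simultaneous substitution. -/
def Tm.subst : ∀ {Γ : Ctx Base Op} {s : Kind Base Op}, Tm Γ s →
    ∀ {Δ : Ctx Base Op}, Sub Γ Δ → Tm Δ s
  | _, _, .var x, _, σ => σ x
  | _, _, .lam M, _, σ => .lam (M.subst σ.up)
  | _, _, .tuple V, _, σ => .tuple fun i => (V i).subst σ
  | _, _, .proj i V, _, σ => .proj i (V.subst σ)
  | _, _, .inj i V, _, σ => .inj i (V.subst σ)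
  | _, _, .app V W, _, σ => .app (V.subst σ) (W.subst σ)
  | _, _, .ret V, _, σ => .ret (V.subst σ)
  | _, _, .letin M N, _, σ => .letin (M.subst σ) (N.subst σ.up)
  | _, _, .op o V, _, σ => .op o (V.subst σ)
  | _, _, .case V M, _, σ => .case (V.subst σ) fun i => (M i).subst σ.up
  | _, _, .handle M H N, _, σ =>
      .handle (M.subst σ) (fun o => (H o).subst σ.up.up) (N.subst σ.up)

/-- `M[V/x]` for the most recent variable `x`. -/
abbrev Tm.inst {Γ : Ctx Base Op} {s : Kind Base Op} {A : Ty Base Op} (M : Tm (A :: Γ) s)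
    (V : Val Γ A) : Tm Γ s :=
  M.subst ((Sub.ids Γ).cons V)

/-- `M[V/x, K/k]` for the two most recent variables `x` and then `k`. -/
abbrev Tm.inst₂ {Γ : Ctx Base Op} {s : Kind Base Op} {A B : Ty Base Op} (M : Tm (B :: A :: Γ) s)
    (V : Val Γ A) (K : Val Γ B) : Tm Γ s :=
  M.subst (((Sub.ids Γ).cons V).cons K)

/-! ## Effect theory terms in the calculus -/

/-- Substitutions `Γ → Δ` where `Δ` is a ground context. -/
abbrev GSub (Δ : List (GTy Base)) (Γ : Ctx Base Op) : Type u :=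
  ∀ ⦃A : GTy Base⦄, Var Δ A → Val Γ (A.toTy Op)

/-- The extension of a substitution under a binder of ground type. -/
def GSub.up {Δ : List (GTy Base)} {Γ : Ctx Base Op} (σ : GSub Δ Γ) {B : GTy Base} :
    GSub (B :: Δ) (B.toTy Op :: Γ)
  | _, .zero => .var .zero
  | _, .succ x => (σ x).wk

/-- `V[σ]` for a ground term `V`. -/
def GTm.inst {Γ : Ctx Base Op} {Δ : List (GTy Base)} (σ : GSub Δ Γ) :
    ∀ {A : GTy Base}, GTm Δ A → Val Γ (A.toTy Op)
  | _, .var x => σ x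
  | _, .tuple V => .tuple fun i => (V i).inst σ
  | _, .proj (A := A) i V => .proj (A := fun i => (A i).toTy Op) i (V.inst σ)
  | _, .inj (A := A) i V => .inj (A := fun i => (A i).toTy Op) i (V.inst σ)

/-- `M[σ]` for an effect theory term `M`. -/
def ETm.inst {𝒯 : Theory Base Op} : ∀ {Δ : List (GTy Base)} {A : GTy Base}, ETm 𝒯.sig Δ A →
    ∀ {Γ : Ctx Base Op}, GSub Δ Γ → Cmp Γ (A.toTy Op) 𝒯
  | _, _, .ret V, _, σ => .ret (V.inst σ)
  | _, _, .letop o V M, _, σ => .letin (.op o (V.inst σ)) (M.inst σ.up)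
  | _, _, .case (B := B) V M, _, σ =>
      .case (A := fun i => (B i).toTy Op) (V.inst σ) fun i => (M i).inst σ.up

/-- The translation of an effect theory term by a handler `H` and a continuation `k`, in a
context `Γ` into which its ground context is mapped by `σ`. -/
def ETm.handleWith {S : Sig Base Op} {B : Ty Base Op} {𝒯' : Theory Base Op} :
    ∀ {Δ : List (GTy Base)} {A : GTy Base}, ETm S Δ A →
    ∀ {Γ : Ctx Base Op}, Hdl Γ S B 𝒯' → GSub Δ Γ → Val Γ (.fn (A.toTy Op) B 𝒯') → Cmp Γ B 𝒯'
  | _, _, .ret V, _, _, σ, k => .app k (V.inst σ)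
  | _, _, .letop o V M, _, H, σ, k =>
      (H o).inst₂ (V.inst σ)
        (.lam (M.handleWith (H.rename fun _ x => .succ x) σ.up k.wk))
  | _, _, .case (B := B) V M, _, H, σ, k =>
      .case (A := fun i => (B i).toTy Op) (V.inst σ)
        fun i => (M i).handleWith (H.rename fun _ x => .succ x) σ.up k.wk

/-- The variables of `Δ` inside `Γ, Δ`. -/
def Var.ofGround (Γ : Ctx Base Op) : ∀ {Δ : List (GTy Base)} {A : GTy Base}, Var Δ A →
    Var (Δ.map (GTy.toTy Op) ++ Γ) (A.toTy Op)
  | _, _, .zero => .zero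
  | _, _, .succ x => .succ (x.ofGround Γ)

/-- The variables of `Γ` inside `Γ, Δ`. -/
def Ren.append (Γ : Ctx Base Op) : ∀ Δ : Ctx Base Op, Ren Γ (Δ ++ Γ)
  | [], _, x => x
  | _ :: Δ, _, x => .succ (Ren.append Γ Δ x)

/-- The context `Γ, Δ, k : A → B ! 𝒯'`. -/
abbrev axCtx (Γ : Ctx Base Op) (Δ : List (GTy Base)) (A : GTy Base) (B : Ty Base Op)
    (𝒯' : Theory Base Op) : Ctx Base Op :=
  .fn (A.toTy Op) B 𝒯' :: (Δ.map (GTy.toTy Op) ++ Γ)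

/-- The term `M[H, k]` in context `Γ, Δ, k : A → B ! 𝒯'`. -/
def ETm.translate {S : Sig Base Op} {Γ : Ctx Base Op} {B : Ty Base Op} {𝒯' : Theory Base Op}
    {Δ : List (GTy Base)} {A : GTy Base} (M : ETm S Δ A) (H : Hdl Γ S B 𝒯') :
    Cmp (axCtx Γ Δ A B 𝒯') B 𝒯' :=
  M.handleWith (H.rename fun _ x => .succ (Ren.append Γ (Δ.map (GTy.toTy Op)) x))
    (fun _ x => .var (.succ (x.ofGround Γ))) (.var .zero)

end Substitution

/-! ## Typing and equational theory, by simultaneous induction -/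

mutual

/-- Well-typedness: every handler that occurs in a `handle` respects the axioms of the handled
theory. -/
inductive Tm.Wf {Base Op : Type u} : ∀ {Γ : Ctx Base Op} {s : Kind Base Op}, Tm Γ s → Prop
  | var {Γ : Ctx Base Op} {A : Ty Base Op} (x : Var Γ A) : Tm.Wf (.var x)
  | lam {Γ : Ctx Base Op} {A B : Ty Base Op} {𝒯 : Theory Base Op} {M : Cmp (A :: Γ) B 𝒯} :
      M.Wf → Tm.Wf (.lam M)
  | tuple {Γ : Ctx Base Op} {n : ℕ} {A : Fin n → Ty Base Op} {V : ∀ i, Val Γ (A i)} :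
      (∀ i, (V i).Wf) → Tm.Wf (.tuple V)
  | proj {Γ : Ctx Base Op} {n : ℕ} {A : Fin n → Ty Base Op} (i : Fin n) {V : Val Γ (.prod A)} :
      V.Wf → Tm.Wf (.proj i V)
  | inj {Γ : Ctx Base Op} {n : ℕ} {A : Fin n → Ty Base Op} (i : Fin n) {V : Val Γ (A i)} :
      V.Wf → Tm.Wf (.inj (A := A) i V)
  | app {Γ : Ctx Base Op} {A B : Ty Base Op} {𝒯 : Theory Base Op} {V : Val Γ (.fn A B 𝒯)}
      {W : Val Γ A} : V.Wf → W.Wf → Tm.Wf (.app V W)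
  | ret {Γ : Ctx Base Op} {A : Ty Base Op} {𝒯 : Theory Base Op} {V : Val Γ A} :
      V.Wf → Tm.Wf (.ret (𝒯 := 𝒯) V)
  | letin {Γ : Ctx Base Op} {A B : Ty Base Op} {𝒯 : Theory Base Op} {M : Cmp Γ A 𝒯}
      {N : Cmp (A :: Γ) B 𝒯} : M.Wf → N.Wf → Tm.Wf (.letin M N)
  | op {Γ : Ctx Base Op} {𝒯 : Theory Base Op} (o : 𝒯.sig.Idx) {V : Val Γ (𝒯.sig.argTy o)} :
      V.Wf → Tm.Wf (.op o V)
  | case {Γ : Ctx Base Op} {n : ℕ} {A : Fin n → Ty Base Op} {B : Ty Base Op}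
      {𝒯 : Theory Base Op} {V : Val Γ (.sum A)} {M : ∀ i, Cmp (A i :: Γ) B 𝒯} :
      V.Wf → (∀ i, (M i).Wf) → Tm.Wf (.case V M)
  | handle {Γ : Ctx Base Op} {A B : Ty Base Op} {𝒯 𝒯' : Theory Base Op} {M : Cmp Γ A 𝒯}
      {H : Hdl Γ 𝒯.sig B 𝒯'} {N : Cmp (A :: Γ) B 𝒯'} :
      M.Wf → (∀ o, (H o).Wf) →
      (∀ e ∈ 𝒯.ax, Tm.Equ (e.lhs.translate H) (e.rhs.translate H)) →
      N.Wf → Tm.Wf (.handle M H N)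

/-- Derivable equality `Γ ⊢ M = N` of terms of the same type. -/
inductive Tm.Equ {Base Op : Type u} :
    ∀ {Γ : Ctx Base Op} {s : Kind Base Op}, Tm Γ s → Tm Γ s → Prop
  -- equivalence relation
  | refl {Γ : Ctx Base Op} {s : Kind Base Op} {M : Tm Γ s} : M.Wf → Tm.Equ M M
  | symm {Γ : Ctx Base Op} {s : Kind Base Op} {M N : Tm Γ s} : Tm.Equ M N → Tm.Equ N M
  | trans {Γ : Ctx Base Op} {s : Kind Base Op} {L M N : Tm Γ s} :
      Tm.Equ L M → Tm.Equ M N → Tm.Equ L N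
  -- congruence
  | lam {Γ : Ctx Base Op} {A B : Ty Base Op} {𝒯 : Theory Base Op} {M M' : Cmp (A :: Γ) B 𝒯} :
      Tm.Equ M M' → Tm.Equ (.lam M) (.lam M')
  | tuple {Γ : Ctx Base Op} {n : ℕ} {A : Fin n → Ty Base Op} {V V' : ∀ i, Val Γ (A i)} :
      (∀ i, Tm.Equ (V i) (V' i)) → Tm.Equ (.tuple V) (.tuple V')
  | proj {Γ : Ctx Base Op} {n : ℕ} {A : Fin n → Ty Base Op} (i : Fin n)
      {V V' : Val Γ (.prod A)} : Tm.Equ V V' → Tm.Equ (.proj i V) (.proj i V')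
  | inj {Γ : Ctx Base Op} {n : ℕ} {A : Fin n → Ty Base Op} (i : Fin n) {V V' : Val Γ (A i)} :
      Tm.Equ V V' → Tm.Equ (.inj (A := A) i V) (.inj i V')
  | app {Γ : Ctx Base Op} {A B : Ty Base Op} {𝒯 : Theory Base Op} {V V' : Val Γ (.fn A B 𝒯)}
      {W W' : Val Γ A} : Tm.Equ V V' → Tm.Equ W W' → Tm.Equ (.app V W) (.app V' W')
  | ret {Γ : Ctx Base Op} {A : Ty Base Op} {𝒯 : Theory Base Op} {V V' : Val Γ A} :
      Tm.Equ V V' → Tm.Equ (.ret (𝒯 := 𝒯) V) (.ret V')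
  | letin {Γ : Ctx Base Op} {A B : Ty Base Op} {𝒯 : Theory Base Op} {M M' : Cmp Γ A 𝒯}
      {N N' : Cmp (A :: Γ) B 𝒯} :
      Tm.Equ M M' → Tm.Equ N N' → Tm.Equ (.letin M N) (.letin M' N')
  | op {Γ : Ctx Base Op} {𝒯 : Theory Base Op} (o : 𝒯.sig.Idx)
      {V V' : Val Γ (𝒯.sig.argTy o)} : Tm.Equ V V' → Tm.Equ (.op o V) (.op o V')
  | case {Γ : Ctx Base Op} {n : ℕ} {A : Fin n → Ty Base Op} {B : Ty Base Op}
      {𝒯 : Theory Base Op} {V V' : Val Γ (.sum A)} {M M' : ∀ i, Cmp (A i :: Γ) B 𝒯} :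
      Tm.Equ V V' → (∀ i, Tm.Equ (M i) (M' i)) → Tm.Equ (.case V M) (.case V' M')
  | handle {Γ : Ctx Base Op} {A B : Ty Base Op} {𝒯 𝒯' : Theory Base Op} {M M' : Cmp Γ A 𝒯}
      {H H' : Hdl Γ 𝒯.sig B 𝒯'} {N N' : Cmp (A :: Γ) B 𝒯'} :
      Tm.Equ M M' → (∀ o, Tm.Equ (H o) (H' o)) →
      (∀ e ∈ 𝒯.ax, Tm.Equ (e.lhs.translate H) (e.rhs.translate H)) →
      (∀ e ∈ 𝒯.ax, Tm.Equ (e.lhs.translate H') (e.rhs.translate H')) →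
      Tm.Equ N N' → Tm.Equ (.handle M H N) (.handle M' H' N')
  -- beta and eta laws
  | fn_beta {Γ : Ctx Base Op} {A B : Ty Base Op} {𝒯 : Theory Base Op} {M : Cmp (A :: Γ) B 𝒯}
      {V : Val Γ A} : M.Wf → V.Wf → Tm.Equ (.app (.lam M) V) (M.inst V)
  | fn_eta {Γ : Ctx Base Op} {A B : Ty Base Op} {𝒯 : Theory Base Op} {V : Val Γ (.fn A B 𝒯)} :
      V.Wf → Tm.Equ V (.lam (.app V.wk (.var .zero)))
  | prod_beta {Γ : Ctx Base Op} {n : ℕ} {A : Fin n → Ty Base Op} {V : ∀ i, Val Γ (A i)}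
      (i : Fin n) : (∀ j, (V j).Wf) → Tm.Equ (.proj i (.tuple V)) (V i)
  | prod_eta {Γ : Ctx Base Op} {n : ℕ} {A : Fin n → Ty Base Op} {V : Val Γ (.prod A)} :
      V.Wf → Tm.Equ V (.tuple fun i => .proj i V)
  | sum_beta {Γ : Ctx Base Op} {n : ℕ} {A : Fin n → Ty Base Op} {B : Ty Base Op}
      {𝒯 : Theory Base Op} {M : ∀ i, Cmp (A i :: Γ) B 𝒯} (i : Fin n) {V : Val Γ (A i)} :
      V.Wf → (∀ j, (M j).Wf) → Tm.Equ (.case (.inj i V) M) ((M i).inst V)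
  | sum_eta {Γ : Ctx Base Op} {n : ℕ} {A : Fin n → Ty Base Op} {B : Ty Base Op}
      {𝒯 : Theory Base Op} {M : Cmp (.sum A :: Γ) B 𝒯} {V : Val Γ (.sum A)} :
      V.Wf → M.Wf →
      Tm.Equ
        (.case V fun i => M.subst (Sub.cons (fun _ x => .var (.succ x)) (.inj i (.var .zero))))
        (M.inst V)
  -- monad laws
  | ret_let {Γ : Ctx Base Op} {A B : Ty Base Op} {𝒯 : Theory Base Op} {V : Val Γ A}
      {M : Cmp (A :: Γ) B 𝒯} : V.Wf → M.Wf → Tm.Equ (.letin (.ret V) M) (M.inst V)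
  | let_ret {Γ : Ctx Base Op} {A : Ty Base Op} {𝒯 : Theory Base Op} {M : Cmp Γ A 𝒯} :
      M.Wf → Tm.Equ (.letin M (.ret (.var .zero))) M
  | let_let {Γ : Ctx Base Op} {A₁ A₂ A₃ : Ty Base Op} {𝒯 : Theory Base Op} {M : Cmp Γ A₁ 𝒯}
      {N : Cmp (A₁ :: Γ) A₂ 𝒯} {L : Cmp (A₂ :: Γ) A₃ 𝒯} : M.Wf → N.Wf → L.Wf →
      Tm.Equ (.letin (.letin M N) L)
        (.letin M (.letin N (L.rename (Ren.up fun _ x => .succ x))))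
  -- effect handlers
  | handle_ret {Γ : Ctx Base Op} {A B : Ty Base Op} {𝒯 𝒯' : Theory Base Op} {V : Val Γ A}
      {H : Hdl Γ 𝒯.sig B 𝒯'} {N : Cmp (A :: Γ) B 𝒯'} :
      V.Wf → (∀ o, (H o).Wf) →
      (∀ e ∈ 𝒯.ax, Tm.Equ (e.lhs.translate H) (e.rhs.translate H)) →
      N.Wf → Tm.Equ (.handle (.ret (𝒯 := 𝒯) V) H N) (N.inst V)
  | handle_let {Γ : Ctx Base Op} {A₁ A₂ B : Ty Base Op} {𝒯 𝒯' : Theory Base Op}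
      {L : Cmp Γ A₁ 𝒯} {M : Cmp (A₁ :: Γ) A₂ 𝒯} {H : Hdl Γ 𝒯.sig B 𝒯'}
      {N : Cmp (A₂ :: Γ) B 𝒯'} :
      L.Wf → M.Wf → (∀ o, (H o).Wf) →
      (∀ e ∈ 𝒯.ax, Tm.Equ (e.lhs.translate H) (e.rhs.translate H)) →
      N.Wf →
      Tm.Equ (.handle (.letin L M) H N)
        (.handle L H
          (.handle M (Hdl.rename H fun _ x => .succ x) (N.rename (Ren.up fun _ x => .succ x))))
  | handle_op {Γ : Ctx Base Op} {B : Ty Base Op} {𝒯 𝒯' : Theory Base Op} (o : 𝒯.sig.Idx)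
      {V : Val Γ (𝒯.sig.argTy o)} {H : Hdl Γ 𝒯.sig B 𝒯'}
      {N : Cmp (𝒯.sig.resTy o :: Γ) B 𝒯'} :
      V.Wf → (∀ o, (H o).Wf) →
      (∀ e ∈ 𝒯.ax, Tm.Equ (e.lhs.translate H) (e.rhs.translate H)) →
      N.Wf → Tm.Equ (.handle (.op o V) H N) ((H o).inst₂ V (.lam N))
  -- instantiation of the axioms of an effect theory
  | inst_ax {Γ : Ctx Base Op} {𝒯 : Theory Base Op} {e : EqAx 𝒯.sig} {σ : GSub e.ctx Γ} :
      e ∈ 𝒯.ax → (∀ (A : GTy Base) (x : Var e.ctx A), (σ x).Wf) →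
      Tm.Equ (e.lhs.inst σ) (e.rhs.inst σ)

end

/-- `Γ ⊢ H : S ⇒ B ! 𝒯'`. -/
def Hdl.Wf {Base Op : Type u} {Γ : Ctx Base Op} {S : Sig Base Op} {B : Ty Base Op}
    {𝒯' : Theory Base Op} (H : Hdl Γ S B 𝒯') : Prop :=
  ∀ o, (H o).Wf

/-- Derivable equality of handlers, which is clausewise. -/
def Hdl.Equ {Base Op : Type u} {Γ : Ctx Base Op} {S : Sig Base Op} {B : Ty Base Op}
    {𝒯' : Theory Base Op} (H H' : Hdl Γ S B 𝒯') : Prop :=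
  ∀ o, Tm.Equ (H o) (H' o)

/-! ## Models -/

/-- Strong monads on a cartesian category. -/
structure StrongMonad (C : Type u) [Category.{v} C] [CartesianMonoidalCategory C]
    extends CategoryTheory.Monad C where
  str (X Y : C) : X ⊗ obj Y ⟶ obj (X ⊗ Y)
  str_natural {X X' Y Y' : C} (f : X ⟶ X') (g : Y ⟶ Y') :
    (f ⊗ₘ map g) ≫ str X' Y' = str X Y ≫ map (f ⊗ₘ g)
  str_leftUnitor (Y : C) : str (𝟙_ C) Y ≫ map (λ_ Y).hom = (λ_ (obj Y)).hom
  str_associator (X Y Z : C) :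
    str (X ⊗ Y) Z ≫ map (α_ X Y Z).hom = (α_ X Y (obj Z)).hom ≫ X ◁ str Y Z ≫ str X (Y ⊗ Z)
  str_unit (X Y : C) : X ◁ η.app Y ≫ str X Y = η.app (X ⊗ Y)
  str_mul (X Y : C) :
    X ◁ μ.app Y ≫ str X Y = str X (obj Y) ≫ map (str X Y) ≫ μ.app (X ⊗ Y)

/-- The part of a model that interprets types: a cartesian category with chosen finite products,
an interpretation of the base types, a strong monad `T 𝒯` for each effect theory, chosen Kleisli
exponentials for each of these monads, and chosen joint distributive Kleisli coproducts. -/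
structure TypeModel (Base Op : Type u) (C : Type w) [Category.{v} C]
    [CartesianMonoidalCategory C] where
  -- finite products
  pr {n : ℕ} (X : Fin n → C) : C
  prProj {n : ℕ} (X : Fin n → C) (i : Fin n) : pr X ⟶ X i
  prLift {n : ℕ} {X : Fin n → C} {Z : C} (f : ∀ i, Z ⟶ X i) : Z ⟶ pr X
  prLift_proj {n : ℕ} {X : Fin n → C} {Z : C} (f : ∀ i, Z ⟶ X i) (i : Fin n) :
    prLift f ≫ prProj X i = f i
  pr_ext {n : ℕ} {X : Fin n → C} {Z : C} {f g : Z ⟶ pr X} :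
    (∀ i, f ≫ prProj X i = g ≫ prProj X i) → f = g
  -- base types
  base (b : Base) : C
  -- strong monads
  T (𝒯 : Theory Base Op) : StrongMonad C
  -- Kleisli exponentials
  kexp (𝒯 : Theory Base Op) (Y Z : C) : C
  curry {𝒯 : Theory Base Op} {X Y Z : C} : (X ⊗ Y ⟶ (T 𝒯).obj Z) ≃ (X ⟶ kexp 𝒯 Y Z)
  curry_natural {𝒯 : Theory Base Op} {X X' Y Z : C} (g : X' ⟶ X) (f : X ⊗ Y ⟶ (T 𝒯).obj Z) :
    curry (g ▷ Y ≫ f) = g ≫ curry f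
  -- joint distributive Kleisli coproducts
  sm {n : ℕ} (X : Fin n → C) : C
  smInj {n : ℕ} (X : Fin n → C) (i : Fin n) : X i ⟶ sm X
  smCase {𝒯 : Theory Base Op} {n : ℕ} {X : Fin n → C} {Z Y : C}
    (f : ∀ i, Z ⊗ X i ⟶ (T 𝒯).obj Y) : Z ⊗ sm X ⟶ (T 𝒯).obj Y
  smInj_case {𝒯 : Theory Base Op} {n : ℕ} {X : Fin n → C} {Z Y : C}
    (f : ∀ i, Z ⊗ X i ⟶ (T 𝒯).obj Y) (i : Fin n) : Z ◁ smInj X i ≫ smCase f = f i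
  sm_ext {𝒯 : Theory Base Op} {n : ℕ} {X : Fin n → C} {Z Y : C}
    {f g : Z ⊗ sm X ⟶ (T 𝒯).obj Y} :
    (∀ i, Z ◁ smInj X i ≫ f = Z ◁ smInj X i ≫ g) → f = g

namespace TypeModel

variable {Base Op : Type u} {C : Type w} [Category.{v} C] [CartesianMonoidalCategory C]
  (𝓜 : TypeModel Base Op C)

/-- Evaluation `(Y ⇒ Z) × Y → T Z`. -/
def ev (𝒯 : Theory Base Op) (Y Z : C) : 𝓜.kexp 𝒯 Y Z ⊗ Y ⟶ (𝓜.T 𝒯).obj Z :=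
  𝓜.curry.symm (𝟙 _)

/-- Interpretation of value types. -/
def ty : Ty Base Op → C
  | .base b => 𝓜.base b
  | .fn A B 𝒯 => 𝓜.kexp 𝒯 (ty A) (ty B)
  | .prod A => 𝓜.pr fun i => ty (A i)
  | .sum A => 𝓜.sm fun i => ty (A i)

/-- Interpretation of ground types. -/
abbrev gty (A : GTy Base) : C := 𝓜.ty (A.toTy Op)

/-- The object that terms of the given kind are interpreted in. -/
abbrev kind : Kind Base Op → C
  | .val A => 𝓜.ty A
  | .cmp A 𝒯 => (𝓜.T 𝒯).obj (𝓜.ty A)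

end TypeModel

section

variable {C : Type w} [Category.{v} C] [CartesianMonoidalCategory C]

/-- Interpretation of contexts, for a given interpretation of types. -/
def ctxObj {α : Type u} (F : α → C) : List α → C
  | [] => 𝟙_ C
  | a :: Γ => ctxObj F Γ ⊗ F a

/-- Interpretation of variables. -/
def varHom {α : Type u} (F : α → C) : ∀ {Γ : List α} {a : α}, Var Γ a → (ctxObj F Γ ⟶ F a)
  | _ :: Γ, a, .zero => snd (ctxObj F Γ) (F a)
  | b :: Γ, _, .succ x => fst (ctxObj F Γ) (F b) ≫ varHom F x

end

namespace TypeModel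

variable {Base Op : Type u} {C : Type w} [Category.{v} C] [CartesianMonoidalCategory C]
  (𝓜 : TypeModel Base Op C)

/-- Interpretation of contexts. -/
abbrev ctx (Γ : Ctx Base Op) : C := ctxObj 𝓜.ty Γ

/-- Interpretation of ground contexts. -/
abbrev gctx (Δ : List (GTy Base)) : C := ctxObj 𝓜.gty Δ

/-- Interpretation of ground terms. -/
def gtm {Δ : List (GTy Base)} : ∀ {A : GTy Base}, GTm Δ A → (𝓜.gctx Δ ⟶ 𝓜.gty A)
  | _, .var x => varHom 𝓜.gty x
  | _, .tuple (A := A) V => 𝓜.prLift (X := fun i => 𝓜.gty (A i)) fun i => gtm (V i)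
  | _, .proj (A := A) i V => gtm V ≫ 𝓜.prProj (fun i => 𝓜.gty (A i)) i
  | _, .inj (A := A) i V => gtm V ≫ 𝓜.smInj (fun i => 𝓜.gty (A i)) i

/-- `μ ∘ T g ∘ st ∘ ⟨id, f⟩`. -/
def bind {𝒯 : Theory Base Op} {Z X Y : C} (f : Z ⟶ (𝓜.T 𝒯).obj X)
    (g : Z ⊗ X ⟶ (𝓜.T 𝒯).obj Y) : Z ⟶ (𝓜.T 𝒯).obj Y :=
  lift (𝟙 Z) f ≫ (𝓜.T 𝒯).str Z X ≫ (𝓜.T 𝒯).map g ≫ (𝓜.T 𝒯).μ.app Y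

/-- Interpretation of effect theory terms by generic effects `I o : A_o → T B_o`. -/
def etm {𝒯 : Theory Base Op}
    (I : ∀ o : 𝒯.sig.Idx, 𝓜.gty (𝒯.sig.arg o) ⟶ (𝓜.T 𝒯).obj (𝓜.gty (𝒯.sig.res o))) :
    ∀ {Δ : List (GTy Base)} {A : GTy Base}, ETm 𝒯.sig Δ A →
      (𝓜.gctx Δ ⟶ (𝓜.T 𝒯).obj (𝓜.gty A))
  | _, _, .ret V => 𝓜.gtm V ≫ (𝓜.T 𝒯).η.app _
  | _, _, .letop o V M => 𝓜.bind (𝓜.gtm V ≫ I o) (etm I M)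
  | _, _, .case (B := B) V M =>
      lift (𝟙 _) (𝓜.gtm V) ≫ 𝓜.smCase (X := fun i => 𝓜.gty (B i)) fun i => etm I (M i)

/-- The object of `S`-algebra structures on `X` in the Kleisli category of `T 𝒯'`: the product
over all operations `o` of `S` of the Kleisli exponentials `A_o × (B_o ⇒ X) ⇒ X`. -/
noncomputable abbrev hb (S : Sig Base Op) (𝒯' : Theory Base Op) (X : C) : C :=
  𝓜.pr fun i : Fin S.ops.card =>
    𝓜.kexp 𝒯' (𝓜.gty (S.arg (S.ops.equivFin.symm i)) ⊗
      𝓜.kexp 𝒯' (𝓜.gty (S.res (S.ops.equivFin.symm i))) X) X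

/-- The projection from `hb` to the component of `o`. -/
noncomputable def hbProj (S : Sig Base Op) (𝒯' : Theory Base Op) (X : C) (o : S.Idx) :
    𝓜.hb S 𝒯' X ⟶ 𝓜.kexp 𝒯' (𝓜.gty (S.arg o) ⊗ 𝓜.kexp 𝒯' (𝓜.gty (S.res o)) X) X :=
  𝓜.prProj _ (S.ops.equivFin o) ≫ eqToHom (by rw [Equiv.symm_apply_apply])

/-- Tupling into `hb`. -/
noncomputable def hbLift (S : Sig Base Op) (𝒯' : Theory Base Op) (X : C) {Z : C}
    (f : ∀ o : S.Idx,
      Z ⟶ 𝓜.kexp 𝒯' (𝓜.gty (S.arg o) ⊗ 𝓜.kexp 𝒯' (𝓜.gty (S.res o)) X) X) :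
    Z ⟶ 𝓜.hb S 𝒯' X :=
  𝓜.prLift fun i => f (S.ops.equivFin.symm i)

/-- The canonical map `(H × (D × K)) × A → H × ((D × A) × K)`. -/
def shuffle (H D K A : C) : (H ⊗ (D ⊗ K)) ⊗ A ⟶ H ⊗ ((D ⊗ A) ⊗ K) :=
  lift (fst _ _ ≫ fst _ _)
    (lift (lift (fst _ _ ≫ snd _ _ ≫ fst _ _) (snd _ _)) (fst _ _ ≫ snd _ _ ≫ snd _ _))

/-- The uncurried interpretation of effect theory terms by algebra structures on `X`. -/
noncomputable def algUncurried {S : Sig Base Op} (𝒯' : Theory Base Op) (X : C) :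
    ∀ {Δ : List (GTy Base)} {A : GTy Base}, ETm S Δ A →
      (𝓜.hb S 𝒯' X ⊗ (𝓜.gctx Δ ⊗ 𝓜.kexp 𝒯' (𝓜.gty A) X) ⟶ (𝓜.T 𝒯').obj X)
  | _, _, .ret V => snd _ _ ≫ lift (snd _ _) (fst _ _ ≫ 𝓜.gtm V) ≫ 𝓜.ev 𝒯' _ X
  | _, _, .letop o V M =>
      lift (fst _ _ ≫ 𝓜.hbProj S 𝒯' X o)
        (lift (snd _ _ ≫ fst _ _ ≫ 𝓜.gtm V)
          (𝓜.curry (shuffle _ _ _ _ ≫ algUncurried 𝒯' X M))) ≫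
      𝓜.ev 𝒯' _ X
  | _, _, .case (B := B) V M =>
      lift (𝟙 _) (snd _ _ ≫ fst _ _ ≫ 𝓜.gtm V) ≫
        𝓜.smCase (X := fun i => 𝓜.gty (B i))
          fun i => shuffle _ _ _ _ ≫ algUncurried 𝒯' X (M i)

/-- The interpretation of effect theory terms by algebra structures on `X`. -/
noncomputable def alg {S : Sig Base Op} (𝒯' : Theory Base Op) (X : C) {Δ : List (GTy Base)}
    {A : GTy Base} (M : ETm S Δ A) :
    𝓜.hb S 𝒯' X ⟶ 𝓜.kexp 𝒯' (𝓜.gctx Δ ⊗ 𝓜.kexp 𝒯' (𝓜.gty A) X) X :=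
  𝓜.curry (𝓜.algUncurried 𝒯' X M)

/-- A generalized element of the object of algebra structures satisfies the axioms of `𝒯`. -/
def Sat (𝒯 𝒯' : Theory Base Op) (X : C) {Z : C} (h : Z ⟶ 𝓜.hb 𝒯.sig 𝒯' X) : Prop :=
  ∀ e ∈ 𝒯.ax, h ≫ 𝓜.alg 𝒯' X e.lhs = h ≫ 𝓜.alg 𝒯' X e.rhs

theorem Sat.comp {𝓜 : TypeModel Base Op C} {𝒯 𝒯' : Theory Base Op} {X Z Z' : C}
    {h : Z ⟶ 𝓜.hb 𝒯.sig 𝒯' X} (hh : 𝓜.Sat 𝒯 𝒯' X h) (g : Z' ⟶ Z) :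
    𝓜.Sat 𝒯 𝒯' X (g ≫ h) := fun e he => by
  rw [Category.assoc, Category.assoc, hh e he]

/-- The morphism `T ev ∘ st ∘ swap ∘ (a × id) : A × (B ⇒ X) → T T' X` for `a : A → T B`, where
`⇒` is the Kleisli exponential of `T'`. -/
def mixed {𝒯 : Theory Base Op} (𝒯' : Theory Base Op) (X : C) {A B : C}
    (a : A ⟶ (𝓜.T 𝒯).obj B) :
    A ⊗ 𝓜.kexp 𝒯' B X ⟶ (𝓜.T 𝒯).obj ((𝓜.T 𝒯').obj X) :=
  a ▷ _ ≫ lift (snd _ _) (fst _ _) ≫ (𝓜.T 𝒯).str _ _ ≫ (𝓜.T 𝒯).map (𝓜.ev 𝒯' B X)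

end TypeModel

/-- Models of the calculus. The field `handle` with `handle_natural` is a natural transformation
from `H × C(-, T T' X)` to `C(-, T' X)`, where `H` is the subpresheaf of `C(-, hb Σ 𝒯' X)` that
consists of the elements satisfying the axioms of the handled theory. -/
structure Model (Base Op : Type u) (C : Type w) [Category.{v} C] [CartesianMonoidalCategory C]
    extends TypeModel Base Op C where
  op (𝒯 : Theory Base Op) (o : 𝒯.sig.Idx) :
    toTypeModel.gty (𝒯.sig.arg o) ⟶ (T 𝒯).obj (toTypeModel.gty (𝒯.sig.res o))
  op_sat (𝒯 : Theory Base Op) :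
    ∀ e ∈ 𝒯.ax, toTypeModel.etm (op 𝒯) e.lhs = toTypeModel.etm (op 𝒯) e.rhs
  handle (𝒯 𝒯' : Theory Base Op) (X : C) {Z : C} (h : Z ⟶ toTypeModel.hb 𝒯.sig 𝒯' X)
    (hh : toTypeModel.Sat 𝒯 𝒯' X h) (f : Z ⟶ (T 𝒯).obj ((T 𝒯').obj X)) : Z ⟶ (T 𝒯').obj X
  handle_natural (𝒯 𝒯' : Theory Base Op) (X : C) {Z Z' : C}
    (h : Z ⟶ toTypeModel.hb 𝒯.sig 𝒯' X) (hh : toTypeModel.Sat 𝒯 𝒯' X h)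
    (f : Z ⟶ (T 𝒯).obj ((T 𝒯').obj X)) (g : Z' ⟶ Z) :
    g ≫ handle 𝒯 𝒯' X h hh f = handle 𝒯 𝒯' X (g ≫ h) (hh.comp g) (g ≫ f)
  handle_unit (𝒯 𝒯' : Theory Base Op) (X : C) {Z : C}
    (h : Z ⟶ toTypeModel.hb 𝒯.sig 𝒯' X) (hh : toTypeModel.Sat 𝒯 𝒯' X h)
    (f : Z ⟶ (T 𝒯').obj X) :
    handle 𝒯 𝒯' X h hh (f ≫ (T 𝒯).η.app _) = f
  handle_mul (𝒯 𝒯' : Theory Base Op) (X : C) {Z : C}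
    (h : Z ⟶ toTypeModel.hb 𝒯.sig 𝒯' X) (hh : toTypeModel.Sat 𝒯 𝒯' X h)
    (f : Z ⟶ (T 𝒯).obj ((T 𝒯).obj ((T 𝒯').obj X))) :
    handle 𝒯 𝒯' X h hh (f ≫ (T 𝒯).μ.app _) =
      handle 𝒯 𝒯' X h hh
        (lift (𝟙 Z) f ≫ (T 𝒯).str _ _ ≫
          (T 𝒯).map (handle 𝒯 𝒯' X (fst Z _ ≫ h) (hh.comp (fst Z _)) (snd _ _)))
  handle_op (𝒯 𝒯' : Theory Base Op) (X : C) {Z : C}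
    (h : Z ⟶ toTypeModel.hb 𝒯.sig 𝒯' X) (hh : toTypeModel.Sat 𝒯 𝒯' X h) (o : 𝒯.sig.Idx)
    (f : Z ⟶ toTypeModel.gty (𝒯.sig.arg o) ⊗
      kexp 𝒯' (toTypeModel.gty (𝒯.sig.res o)) X) :
    handle 𝒯 𝒯' X h hh (f ≫ toTypeModel.mixed 𝒯' X (op 𝒯 o)) =
      lift (h ≫ toTypeModel.hbProj 𝒯.sig 𝒯' X o) f ≫ toTypeModel.ev 𝒯' _ X

/-! ## Interpretation of terms -/

/-- A family of partial elements as a partial family. -/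
def partPi {ι : Type u} {β : ι → Type v} (f : ∀ i, Part (β i)) : Part (∀ i, β i) :=
  ⟨∀ i, (f i).Dom, fun h i => (f i).get (h i)⟩

namespace Model

variable {Base Op : Type u} {C : Type w} [Category.{v} C] [CartesianMonoidalCategory C]
  (𝓜 : Model Base Op C)

/-- The partial tupling `⟨Λ (f_o ∘ α⁻¹)⟩_o` of interpretations of operation clauses. -/
noncomputable def clauses {Z : C} {S : Sig Base Op} {B : Ty Base Op} {𝒯' : Theory Base Op}
    (f : ∀ o : S.Idx, Part
      ((Z ⊗ 𝓜.ty (S.argTy o)) ⊗ 𝓜.ty (.fn (S.resTy o) B 𝒯') ⟶ (𝓜.T 𝒯').obj (𝓜.ty B))) :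
    Part (Z ⟶ 𝓜.hb S 𝒯' (𝓜.ty B)) :=
  (partPi f).map fun m => 𝓜.hbLift S 𝒯' (𝓜.ty B) fun o => 𝓜.curry ((α_ _ _ _).inv ≫ m o)

/-- The partial interpretation of terms. It is undefined where a handler is used whose
interpretation does not satisfy the axioms of the handled theory. -/
noncomputable def interp : ∀ {Γ : Ctx Base Op} {s : Kind Base Op}, Tm Γ s →
    Part (𝓜.ctx Γ ⟶ 𝓜.kind s)
  | _, _, .var x => Part.some (varHom 𝓜.ty x)
  | _, _, .lam M => (interp M).map fun m => 𝓜.curry m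
  | _, _, .tuple (A := A) V =>
      (partPi fun i => interp (V i)).map fun v => 𝓜.prLift (X := fun i => 𝓜.ty (A i)) v
  | _, _, .proj (A := A) i V => (interp V).map fun v => v ≫ 𝓜.prProj (fun i => 𝓜.ty (A i)) i
  | _, _, .inj (A := A) i V => (interp V).map fun v => v ≫ 𝓜.smInj (fun i => 𝓜.ty (A i)) i
  | _, _, .app (A := A) (B := B) (𝒯 := 𝒯) V W =>
      (interp V).bind fun v => (interp W).map fun w =>
        lift v w ≫ 𝓜.ev 𝒯 (𝓜.ty A) (𝓜.ty B)
  | _, _, .ret (𝒯 := 𝒯) V => (interp V).map fun v => v ≫ (𝓜.T 𝒯).η.app _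
  | _, _, .letin M N => (interp M).bind fun m => (interp N).map fun n => 𝓜.bind m n
  | _, _, .op (𝒯 := 𝒯) o V => (interp V).map fun v => v ≫ 𝓜.op 𝒯 o
  | _, _, .case (A := A) V M =>
      (interp V).bind fun v => (partPi fun i => interp (M i)).map fun m =>
        lift (𝟙 _) v ≫ 𝓜.smCase (X := fun i => 𝓜.ty (A i)) m
  | Γ, _, .handle (B := B) (𝒯 := 𝒯) (𝒯' := 𝒯') M H N =>
      (interp M).bind fun m => (interp N).bind fun n =>
        (𝓜.clauses (Z := 𝓜.ctx Γ) fun o => interp (H o)).bind fun h =>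
          Part.assert (𝓜.Sat 𝒯 𝒯' (𝓜.ty B) h) fun hh =>
            Part.some (𝓜.handle 𝒯 𝒯' (𝓜.ty B) h hh
              (lift (𝟙 _) m ≫ (𝓜.T 𝒯).str _ _ ≫ (𝓜.T 𝒯).map n))

/-- The partial interpretation of handlers. -/
noncomputable def interpHdl {Γ : Ctx Base Op} {S : Sig Base Op} {B : Ty Base Op}
    {𝒯' : Theory Base Op} (H : Hdl Γ S B 𝒯') : Part (𝓜.ctx Γ ⟶ 𝓜.hb S 𝒯' (𝓜.ty B)) :=
  𝓜.clauses fun o => 𝓜.interp (H o)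

end Model

end EffCalc

/-!
Completeness holds because the syntax is itself a model. Objects are types, a morphism `X ⟶ Y` is
a value of type `Y` in one variable of type `X` up to derivable equality, and the monad of a theory
`𝒯` sends `X` to the type `1 → X` of thunks with effects in `𝒯`. Functions, products and sums
interpret themselves through the `β`- and `η`-laws, and the axioms required of `handle` are
the equations of the calculus for `handle`. In this model a term denotes its own class, as one sees
by letting the denotations act on substitutions of values for the context, so that terms with equal
denotations are derivably equal.

The delicate point is that `handle` is only well formed for a handler that respects the axioms. The
translations of the two sides of an axiom by a handler `H` are the interpretations of the two sides
at `H`, up to uncurrying. Hence the denotation of a handler satisfies a theory exactly when the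
handler respects it, and every well-typed term has a denotation.
-/

namespace EffCalc

/-! ## Substitution calculus -/

section Substitution

variable {Base Op : Type u} {Γ Δ Ξ : Ctx Base Op} {s : Kind Base Op}

lemma Ren.up_comp (ρ : Ren Γ Δ) (ρ' : Ren Δ Ξ) (B : Ty Base Op) :
    (fun _ x => ρ'.up (ρ.up x) : Ren (B :: Γ) (B :: Ξ)) = Ren.up fun _ x => ρ' (ρ x) := by
  funext A x; cases x <;> rfl

theorem Tm.rename_rename (M : Tm Γ s) (ρ : Ren Γ Δ) (ρ' : Ren Δ Ξ) :
    (M.rename ρ).rename ρ' = M.rename fun _ x => ρ' (ρ x) := by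
  induction M generalizing Δ Ξ <;> simp only [Tm.rename, Ren.up_comp, *]

lemma Sub.up_var (ρ : Ren Γ Δ) (B : Ty Base Op) :
    (Sub.up fun _ x => .var (ρ x) : Sub (B :: Γ) (B :: Δ)) = fun _ x => .var (ρ.up x) := by
  funext A x; cases x <;> rfl

theorem Tm.rename_eq_subst (M : Tm Γ s) (ρ : Ren Γ Δ) :
    M.rename ρ = M.subst fun _ x => .var (ρ x) := by
  induction M generalizing Δ <;> simp only [Tm.rename, Tm.subst, Sub.up_var, *]

lemma Sub.ren_comp_up (ρ : Ren Γ Δ) (σ : Sub Δ Ξ) (B : Ty Base Op) :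
    (fun _ x => σ.up (ρ.up x) : Sub (B :: Γ) (B :: Ξ)) = Sub.up fun _ x => σ (ρ x) := by
  funext A x; cases x <;> rfl

theorem Tm.rename_subst (M : Tm Γ s) (ρ : Ren Γ Δ) (σ : Sub Δ Ξ) :
    (M.rename ρ).subst σ = M.subst fun _ x => σ (ρ x) := by
  induction M generalizing Δ Ξ <;> simp only [Tm.rename, Tm.subst, Sub.ren_comp_up, *]

lemma Sub.up_comp_ren (σ : Sub Γ Δ) (ρ : Ren Δ Ξ) (B : Ty Base Op) :
    (fun _ x => (σ.up x).rename ρ.up : Sub (B :: Γ) (B :: Ξ)) =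
      Sub.up fun _ x => (σ x).rename ρ := by
  funext A x
  cases x with
  | zero => rfl
  | succ x => simp only [Sub.up, Tm.wk, Tm.rename_rename]; rfl

theorem Tm.subst_rename (M : Tm Γ s) (σ : Sub Γ Δ) (ρ : Ren Δ Ξ) :
    (M.subst σ).rename ρ = M.subst fun _ x => (σ x).rename ρ := by
  induction M generalizing Δ Ξ <;> simp only [Tm.rename, Tm.subst, Sub.up_comp_ren, *]

lemma Tm.wk_subst_up {B : Ty Base Op} (M : Tm Γ s) (σ : Sub Γ Δ) :
    (M.wk (B := B)).subst σ.up = (M.subst σ).wk := by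
  simp only [Tm.wk, Tm.rename_subst, Tm.subst_rename, Sub.up]

lemma Sub.up_comp (σ : Sub Γ Δ) (τ : Sub Δ Ξ) (B : Ty Base Op) :
    (fun _ x => (σ.up x).subst τ.up : Sub (B :: Γ) (B :: Ξ)) =
      Sub.up fun _ x => (σ x).subst τ := by
  funext A x
  cases x with
  | zero => rfl
  | succ x => exact Tm.wk_subst_up _ _

theorem Tm.subst_subst (M : Tm Γ s) (σ : Sub Γ Δ) (τ : Sub Δ Ξ) :
    (M.subst σ).subst τ = M.subst fun _ x => (σ x).subst τ := by
  induction M generalizing Δ Ξ <;> simp only [Tm.subst, Sub.up_comp, *]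

lemma Sub.up_ids (Γ : Ctx Base Op) (B : Ty Base Op) :
    ((Sub.ids Γ).up : Sub (B :: Γ) (B :: Γ)) = Sub.ids (B :: Γ) := by
  funext A x; cases x <;> rfl

theorem Tm.subst_ids (M : Tm Γ s) : M.subst (Sub.ids Γ) = M := by
  induction M <;> simp only [Tm.subst, Sub.up_ids, *]
  rfl

lemma Tm.wk_subst_cons {B : Ty Base Op} (M : Tm Γ s) (σ : Sub Γ Δ) (V : Val Δ B) :
    M.wk.subst (σ.cons V) = M.subst σ :=
  M.rename_subst _ _

lemma Tm.inst_subst {A : Ty Base Op} (M : Tm (A :: Γ) s) (V : Val Γ A) (σ : Sub Γ Δ) :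
    (M.inst V).subst σ = (M.subst σ.up).inst (V.subst σ) := by
  simp only [Tm.inst, Tm.subst_subst]
  congr 1; funext A x
  cases x with
  | zero => rfl
  | succ x => simp only [Sub.cons, Sub.up, Tm.wk_subst_cons, Tm.subst_ids]; rfl

lemma Tm.inst₂_subst {A B : Ty Base Op} (M : Tm (B :: A :: Γ) s) (V : Val Γ A) (K : Val Γ B)
    (σ : Sub Γ Δ) :
    (M.inst₂ V K).subst σ = (M.subst σ.up.up).inst₂ (V.subst σ) (K.subst σ) := by
  simp only [Tm.inst₂, Tm.subst_subst]
  congr 1; funext A x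
  match x with
  | .zero => rfl
  | .succ .zero => rfl
  | .succ (.succ x) => simp only [Sub.cons, Sub.up, Tm.wk_subst_cons, Tm.subst_ids]; rfl

lemma Tm.rename_up_succ_subst {A B : Ty Base Op} (L : Tm (A :: Γ) s) (σ : Sub Γ Δ) :
    (L.rename (Ren.up fun _ x => .succ x)).subst (σ.up (B := B)).up =
      (L.subst σ.up).rename (Ren.up fun _ x => .succ x) := by
  rw [Tm.rename_subst, Tm.subst_rename, Sub.ren_comp_up, Sub.up_comp_ren]
  rfl

lemma Tm.subst_succ_cons_inj_subst {n : ℕ} {A : Fin n → Ty Base Op} (M : Tm (.sum A :: Γ) s)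
    (i : Fin n) (σ : Sub Γ Δ) :
    (M.subst (Sub.cons (fun _ x => .var (.succ x)) (.inj i (.var .zero)))).subst σ.up =
      (M.subst σ.up).subst (Sub.cons (fun _ x => .var (.succ x)) (.inj i (.var .zero))) := by
  simp only [Tm.subst_subst]
  congr 1; funext B x
  cases x with
  | zero => rfl
  | succ x => exact (Tm.rename_eq_subst _ _).trans (Tm.wk_subst_cons _ _ _).symm

section Handlers

variable {S : Sig Base Op} {B : Ty Base Op} {𝒯' : Theory Base Op}

/-- The action of a substitution on handlers. -/
def Hdl.subst (H : Hdl Γ S B 𝒯') (σ : Sub Γ Δ) : Hdl Δ S B 𝒯' :=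
  fun o => (H o).subst σ.up.up

lemma Hdl.rename_eq_subst (H : Hdl Γ S B 𝒯') (ρ : Ren Γ Δ) :
    H.rename ρ = H.subst fun _ x => .var (ρ x) := by
  funext o
  simp only [Hdl.rename, Hdl.subst, Tm.rename_eq_subst, Sub.up_var]

lemma Hdl.subst_subst (H : Hdl Γ S B 𝒯') (σ : Sub Γ Δ) (τ : Sub Δ Ξ) :
    (H.subst σ).subst τ = H.subst fun _ x => (σ x).subst τ := by
  funext o
  simp only [Hdl.subst, Tm.subst_subst, Sub.up_comp]

lemma Hdl.rename_succ_subst {A : Ty Base Op} (H : Hdl Γ S B 𝒯') (σ : Sub Γ Δ) :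
    (H.rename fun _ x => Var.succ (b := A) x).subst σ.up =
      (H.subst σ).rename fun _ x => .succ x := by
  simp only [Hdl.rename_eq_subst, Hdl.subst_subst]
  congr 1; funext C x
  exact Tm.rename_eq_subst _ _

end Handlers

section GroundTerms

variable {G : List (GTy Base)} {A : GTy Base}

lemma GSub.up_subst (σ : GSub G Γ) (τ : Sub Γ Δ) (B : GTy Base) :
    (fun _ x => (σ.up x).subst τ.up : GSub (B :: G) (B.toTy Op :: Δ)) =
      GSub.up fun _ x => (σ x).subst τ := by
  funext A x
  cases x with
  | zero => rfl
  | succ x => exact Tm.wk_subst_up _ _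

lemma GTm.inst_subst (V : GTm G A) (σ : GSub G Γ) (τ : Sub Γ Δ) :
    (V.inst σ).subst τ = V.inst fun _ x => (σ x).subst τ := by
  induction V with
  | var x => rfl
  | tuple V ih => exact congrArg Tm.tuple (funext ih)
  | proj i V ih => exact congrArg (Tm.proj (A := fun i => GTy.toTy Op _) i) ih
  | inj i V ih => exact congrArg (Tm.inj (A := fun i => GTy.toTy Op _) i) ih

lemma ETm.inst_subst {𝒯 : Theory Base Op} (M : ETm 𝒯.sig G A) (σ : GSub G Γ) (τ : Sub Γ Δ) :
    (M.inst σ).subst τ = M.inst fun _ x => (σ x).subst τ := by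
  induction M generalizing Γ Δ with
  | ret V => simp only [ETm.inst, Tm.subst, GTm.inst_subst]
  | letop o V M ih => simp only [ETm.inst, Tm.subst, GTm.inst_subst, ih, GSub.up_subst]
  | case V M ih =>
    simp only [ETm.inst, Tm.subst, ih, GSub.up_subst]
    exact congrArg (Tm.case · _) (GTm.inst_subst V σ τ)

variable {S : Sig Base Op} {B : Ty Base Op} {𝒯' : Theory Base Op}

lemma ETm.handleWith_subst (M : ETm S G A) (H : Hdl Γ S B 𝒯') (σ : GSub G Γ)
    (k : Val Γ (.fn (A.toTy Op) B 𝒯')) (τ : Sub Γ Δ) :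
    (M.handleWith H σ k).subst τ =
      M.handleWith (H.subst τ) (fun _ x => (σ x).subst τ) (k.subst τ) := by
  induction M generalizing Γ Δ with
  | ret V => simp only [ETm.handleWith, Tm.subst, GTm.inst_subst]
  | letop o V M ih =>
    simp only [ETm.handleWith, Tm.inst₂_subst, Tm.subst, GTm.inst_subst, ih, GSub.up_subst,
      Hdl.rename_succ_subst, Tm.wk_subst_up]
    rfl
  | case V M ih =>
    simp only [ETm.handleWith, Tm.subst, ih, GSub.up_subst, Hdl.rename_succ_subst,
      Tm.wk_subst_up]
    exact congrArg (Tm.case · _) (GTm.inst_subst V σ τ)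

/-- The extension of a substitution under several binders. -/
def Sub.ups (σ : Sub Γ Δ) : ∀ Ξ : Ctx Base Op, Sub (Ξ ++ Γ) (Ξ ++ Δ)
  | [] => σ
  | _ :: Ξ => (σ.ups Ξ).up

lemma Sub.ups_ofGround (σ : Sub Γ Δ) (x : Var G A) :
    σ.ups (G.map (GTy.toTy Op)) (x.ofGround Γ) = .var (x.ofGround Δ) := by
  induction x with
  | zero => rfl
  | succ x ih => exact congrArg (Tm.wk (B := GTy.toTy Op _)) ih

lemma Sub.ups_append (σ : Sub Γ Δ) (Ξ : Ctx Base Op) (x : Var Γ B) :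
    σ.ups Ξ (Ren.append Γ Ξ x) = (σ x).rename (Ren.append Δ Ξ) := by
  induction Ξ with
  | nil => exact ((Tm.rename_eq_subst _ _).trans (Tm.subst_ids _)).symm
  | cons C Ξ ih => exact (congrArg (Tm.wk (B := C)) ih).trans (Tm.rename_rename _ _ _)

theorem ETm.translate_subst (M : ETm S G A) (H : Hdl Γ S B 𝒯') (σ : Sub Γ Δ) :
    (M.translate H).subst (σ.ups (G.map (GTy.toTy Op))).up = M.translate (H.subst σ) := by
  simp only [ETm.translate, ETm.handleWith_subst, Hdl.rename_eq_subst, Hdl.subst_subst]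
  congr 1
  · congr 1; funext C x
    simp only [Tm.subst, Sub.up, Sub.ups_append, Tm.wk, Tm.rename_rename]
    exact Tm.rename_eq_subst _ _
  · funext C x
    simp only [Tm.subst, Sub.up, Sub.ups_ofGround, Tm.wk, Tm.rename]

end GroundTerms

end Substitution

/-! ## Stability of typing and equality under substitution -/

section Stability

variable {Base Op : Type u} {Γ Δ Ξ : Ctx Base Op} {s : Kind Base Op}

/-- A class of substitutions by well-typed values that is closed under extension by a variable.
Extending a substitution weakens its values, so stability has to be known for renamings before it
can be proved for all substitutions by well-typed values; this notion lets one induction serve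
both. -/
structure SubClass (Base Op : Type u) : Type u where
  mem : ∀ {Γ Δ : Ctx Base Op}, Sub Γ Δ → Prop
  up : ∀ {Γ Δ : Ctx Base Op} {σ : Sub Γ Δ} (_ : mem σ) (B : Ty Base Op), mem (σ.up (B := B))
  wf : ∀ {Γ Δ : Ctx Base Op} {σ : Sub Γ Δ} (_ : mem σ) {A : Ty Base Op} (x : Var Γ A), (σ x).Wf

lemma SubClass.ups (P : SubClass Base Op) {σ : Sub Γ Δ} (h : P.mem σ) (Ξ : Ctx Base Op) :
    P.mem (σ.ups Ξ) := by
  induction Ξ with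
  | nil => exact h
  | cons B Ξ ih => exact P.up ih B

/-- The handler `H` respects the axioms of `𝒯`. -/
def Hdl.Respects {𝒯 𝒯' : Theory Base Op} {B : Ty Base Op} (H : Hdl Γ 𝒯.sig B 𝒯') : Prop :=
  ∀ e ∈ 𝒯.ax, Tm.Equ (e.lhs.translate H) (e.rhs.translate H)

lemma Hdl.respects_subst {𝒯 𝒯' : Theory Base Op} {B : Ty Base Op} {H : Hdl Γ 𝒯.sig B 𝒯'}
    {σ : Sub Γ Δ}
    (h : ∀ e ∈ 𝒯.ax,
      ((e.lhs.translate H).subst (σ.ups _).up).Equ ((e.rhs.translate H).subst (σ.ups _).up)) :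
    (H.subst σ).Respects := fun e he => by
  simpa only [ETm.translate_subst] using h e he

mutual

theorem SubClass.wf_subst (P : SubClass Base Op) {Γ : Ctx Base Op} {s : Kind Base Op}
    {M : Tm Γ s} (hM : M.Wf) {Δ : Ctx Base Op} {σ : Sub Γ Δ} (hσ : P.mem σ) :
    (M.subst σ).Wf := by
  match hM with
  | .var x => exact P.wf hσ x
  | .lam h => exact .lam (P.wf_subst h (P.up hσ _))
  | .tuple h => exact .tuple fun i => P.wf_subst (h i) hσ
  | .proj i h => exact .proj i (P.wf_subst h hσ)
  | .inj i h => exact .inj i (P.wf_subst h hσ)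
  | .app h h' => exact .app (P.wf_subst h hσ) (P.wf_subst h' hσ)
  | .ret h => exact .ret (P.wf_subst h hσ)
  | .letin h h' => exact .letin (P.wf_subst h hσ) (P.wf_subst h' (P.up hσ _))
  | .op o h => exact .op o (P.wf_subst h hσ)
  | .case h h' => exact .case (P.wf_subst h hσ) fun i => P.wf_subst (h' i) (P.up hσ _)
  | .handle h hH hr h' =>
    exact .handle (P.wf_subst h hσ) (fun o => P.wf_subst (hH o) (P.up (P.up hσ _) _))
      (Hdl.respects_subst fun e he => P.equ_subst (hr e he) (P.up (P.ups hσ _) _))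
      (P.wf_subst h' (P.up hσ _))

theorem SubClass.equ_subst (P : SubClass Base Op) {Γ : Ctx Base Op} {s : Kind Base Op}
    {M N : Tm Γ s} (hM : M.Equ N) {Δ : Ctx Base Op} {σ : Sub Γ Δ} (hσ : P.mem σ) :
    (M.subst σ).Equ (N.subst σ) := by
  match hM with
  | .refl h => exact .refl (P.wf_subst h hσ)
  | .symm h => exact .symm (P.equ_subst h hσ)
  | .trans h h' => exact .trans (P.equ_subst h hσ) (P.equ_subst h' hσ)
  | .lam h => exact .lam (P.equ_subst h (P.up hσ _))
  | .tuple h => exact .tuple fun i => P.equ_subst (h i) hσ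
  | .proj i h => exact .proj i (P.equ_subst h hσ)
  | .inj i h => exact .inj i (P.equ_subst h hσ)
  | .app h h' => exact .app (P.equ_subst h hσ) (P.equ_subst h' hσ)
  | .ret h => exact .ret (P.equ_subst h hσ)
  | .letin h h' => exact .letin (P.equ_subst h hσ) (P.equ_subst h' (P.up hσ _))
  | .op o h => exact .op o (P.equ_subst h hσ)
  | .case h h' => exact .case (P.equ_subst h hσ) fun i => P.equ_subst (h' i) (P.up hσ _)
  | .handle h hH hr hr' h' =>
    exact .handle (P.equ_subst h hσ) (fun o => P.equ_subst (hH o) (P.up (P.up hσ _) _))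
      (Hdl.respects_subst fun e he => P.equ_subst (hr e he) (P.up (P.ups hσ _) _))
      (Hdl.respects_subst fun e he => P.equ_subst (hr' e he) (P.up (P.ups hσ _) _))
      (P.equ_subst h' (P.up hσ _))
  | .fn_beta h h' =>
    exact Tm.inst_subst _ _ σ ▸ .fn_beta (P.wf_subst h (P.up hσ _)) (P.wf_subst h' hσ)
  | .fn_eta h =>
    simp only [Tm.subst, Tm.wk_subst_up]
    exact .fn_eta (P.wf_subst h hσ)
  | .prod_beta (V := V) i h => exact .prod_beta i fun j => P.wf_subst (h j) hσ
  | .prod_eta h => exact .prod_eta (P.wf_subst h hσ)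
  | .sum_beta i h h' =>
    exact Tm.inst_subst _ _ σ ▸
      .sum_beta i (P.wf_subst h hσ) fun j => P.wf_subst (h' j) (P.up hσ _)
  | .sum_eta h h' =>
    simpa only [Tm.subst, Tm.inst_subst, Tm.subst_succ_cons_inj_subst] using
      Tm.Equ.sum_eta (P.wf_subst h hσ) (P.wf_subst h' (P.up hσ _))
  | .ret_let h h' =>
    exact Tm.inst_subst _ _ σ ▸ .ret_let (P.wf_subst h hσ) (P.wf_subst h' (P.up hσ _))
  | .let_ret h => exact .let_ret (P.wf_subst h hσ)
  | .let_let h h' h'' =>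
    simp only [Tm.subst, Tm.rename_up_succ_subst]
    exact .let_let (P.wf_subst h hσ) (P.wf_subst h' (P.up hσ _)) (P.wf_subst h'' (P.up hσ _))
  | .handle_ret h hH hr h' =>
    exact Tm.inst_subst _ _ σ ▸
      .handle_ret (P.wf_subst h hσ) (fun o => P.wf_subst (hH o) (P.up (P.up hσ _) _))
        (Hdl.respects_subst fun e he => P.equ_subst (hr e he) (P.up (P.ups hσ _) _))
        (P.wf_subst h' (P.up hσ _))
  | .handle_let (H := H) h h' hH hr h'' =>
    have substituted := Tm.Equ.handle_let (H := H.subst σ) (P.wf_subst h hσ)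
      (P.wf_subst h' (P.up hσ _)) (fun o => P.wf_subst (hH o) (P.up (P.up hσ _) _))
      (Hdl.respects_subst fun e he => P.equ_subst (hr e he) (P.up (P.ups hσ _) _))
      (P.wf_subst h'' (P.up hσ _))
    rwa [← Hdl.rename_succ_subst, ← Tm.rename_up_succ_subst] at substituted
  | .handle_op o h hH hr h' =>
    exact Tm.inst₂_subst _ _ _ σ ▸
      .handle_op o (P.wf_subst h hσ) (fun o => P.wf_subst (hH o) (P.up (P.up hσ _) _))
        (Hdl.respects_subst fun e he => P.equ_subst (hr e he) (P.up (P.ups hσ _) _))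
        (P.wf_subst h' (P.up hσ _))
  | .inst_ax he h =>
    rw [ETm.inst_subst, ETm.inst_subst]
    exact .inst_ax he fun A x => P.wf_subst (h A x) hσ

end

/-- Renamings, as a class of substitutions. -/
def SubClass.ren (Base Op : Type u) : SubClass Base Op where
  mem {Γ Δ} σ := ∃ ρ : Ren Γ Δ, σ = fun _ x => .var (ρ x)
  up := by
    rintro _ _ _ ⟨ρ, rfl⟩ B
    exact ⟨ρ.up, Sub.up_var ρ B⟩
  wf := by
    rintro _ _ _ ⟨ρ, rfl⟩ A x
    exact .var _

lemma Tm.Wf.rename {M : Tm Γ s} (h : M.Wf) (ρ : Ren Γ Δ) : (M.rename ρ).Wf := by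
  rw [Tm.rename_eq_subst]
  exact (SubClass.ren Base Op).wf_subst h ⟨ρ, rfl⟩

lemma Tm.Equ.rename {M N : Tm Γ s} (h : M.Equ N) (ρ : Ren Γ Δ) :
    (M.rename ρ).Equ (N.rename ρ) := by
  rw [Tm.rename_eq_subst, Tm.rename_eq_subst]
  exact (SubClass.ren Base Op).equ_subst h ⟨ρ, rfl⟩

/-- Substitutions by well-typed values. -/
def Sub.Wf (σ : Sub Γ Δ) : Prop := ∀ ⦃A : Ty Base Op⦄ (x : Var Γ A), (σ x).Wf

lemma Sub.Wf.up {σ : Sub Γ Δ} (h : σ.Wf) (B : Ty Base Op) : (σ.up (B := B)).Wf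
  | _, .zero => .var _
  | _, .succ x => (h x).rename _

lemma Sub.Wf.cons {σ : Sub Γ Δ} (h : σ.Wf) {B : Ty Base Op} {V : Val Δ B} (hV : V.Wf) :
    (σ.cons V).Wf
  | _, .zero => hV
  | _, .succ x => h x

lemma Sub.ren_wf (ρ : Ren Γ Δ) : Sub.Wf fun _ x => .var (ρ x) := fun _ x => .var (ρ x)

lemma Sub.ids_wf : (Sub.ids Γ).Wf := Sub.ren_wf _

/-- Substitutions by well-typed values, as a class of substitutions. -/
def SubClass.wfs (Base Op : Type u) : SubClass Base Op where
  mem σ := σ.Wf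
  up h B := h.up B
  wf h _ x := h x

theorem Tm.Wf.subst {M : Tm Γ s} (h : M.Wf) {σ : Sub Γ Δ} (hσ : σ.Wf) : (M.subst σ).Wf :=
  (SubClass.wfs Base Op).wf_subst h hσ

theorem Tm.Equ.subst {M N : Tm Γ s} (h : M.Equ N) {σ : Sub Γ Δ} (hσ : σ.Wf) :
    (M.subst σ).Equ (N.subst σ) :=
  (SubClass.wfs Base Op).equ_subst h hσ

lemma Sub.Wf.comp {σ : Sub Γ Δ} (hσ : σ.Wf) {τ : Sub Δ Ξ} (hτ : τ.Wf) :
    Sub.Wf fun _ x => (σ x).subst τ :=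
  fun _ x => (hσ x).subst hτ

lemma Tm.Wf.inst {A : Ty Base Op} {M : Tm (A :: Γ) s} {V : Val Γ A} (h : M.Wf) (hV : V.Wf) :
    (M.inst V).Wf :=
  h.subst (Sub.ids_wf.cons hV)

lemma Tm.Wf.inst₂ {A B : Ty Base Op} {M : Tm (B :: A :: Γ) s} {V : Val Γ A} {K : Val Γ B}
    (h : M.Wf) (hV : V.Wf) (hK : K.Wf) : (M.inst₂ V K).Wf :=
  h.subst ((Sub.ids_wf.cons hV).cons hK)

lemma Hdl.Wf.rename {S : Sig Base Op} {B : Ty Base Op} {𝒯' : Theory Base Op}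
    {H : Hdl Γ S B 𝒯'} (h : H.Wf) (ρ : Ren Γ Δ) : (H.rename ρ).Wf :=
  fun o => Tm.Wf.rename (h o) _

lemma Hdl.Wf.subst {S : Sig Base Op} {B : Ty Base Op} {𝒯' : Theory Base Op}
    {H : Hdl Γ S B 𝒯'} (h : H.Wf) {σ : Sub Γ Δ} (hσ : σ.Wf) : (H.subst σ).Wf :=
  fun o => (h o).subst ((hσ.up _).up _)

theorem Hdl.Respects.subst {𝒯 𝒯' : Theory Base Op} {B : Ty Base Op} {H : Hdl Γ 𝒯.sig B 𝒯'}
    (h : H.Respects) {σ : Sub Γ Δ} (hσ : σ.Wf) : (H.subst σ).Respects :=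
  Hdl.respects_subst fun e he => (h e he).subst (((SubClass.wfs Base Op).ups hσ _).up _)

theorem Hdl.Respects.rename {𝒯 𝒯' : Theory Base Op} {B : Ty Base Op} {H : Hdl Γ 𝒯.sig B 𝒯'}
    (h : H.Respects) (ρ : Ren Γ Δ) : (H.rename ρ).Respects :=
  Hdl.rename_eq_subst H ρ ▸ h.subst (Sub.ren_wf ρ)

/-- Substitutions of well-typed values for a ground context. -/
def GSub.Wf {G : List (GTy Base)} (σ : GSub G Γ) : Prop :=
  ∀ (A : GTy Base) (x : Var G A), (σ x).Wf

lemma GSub.Wf.up {G : List (GTy Base)} {σ : GSub G Γ} (hσ : σ.Wf) (B : GTy Base) :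
    (σ.up (B := B)).Wf
  | _, .zero => .var _
  | _, .succ x => (hσ _ x).rename _

lemma GTm.inst_wf {G : List (GTy Base)} {A : GTy Base} (V : GTm G A) {σ : GSub G Γ}
    (hσ : σ.Wf) : (V.inst σ).Wf := by
  induction V with
  | var x => exact hσ _ x
  | tuple V ih => exact .tuple ih
  | proj i V ih => exact .proj (A := fun i => GTy.toTy Op _) i ih
  | inj i V ih => exact .inj (A := fun i => GTy.toTy Op _) i ih

lemma ETm.inst_wf {𝒯 : Theory Base Op} {G : List (GTy Base)} {A : GTy Base}
    (M : ETm 𝒯.sig G A) {σ : GSub G Γ} (hσ : σ.Wf) : (M.inst σ).Wf := by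
  induction M generalizing Γ with
  | ret V => exact .ret (V.inst_wf hσ)
  | letop o V M ih => exact .letin (.op o (V.inst_wf hσ)) (ih (hσ.up _))
  | case V M ih => exact .case (V.inst_wf hσ) fun i => ih i (hσ.up _)

lemma ETm.handleWith_wf {S : Sig Base Op} {B : Ty Base Op} {𝒯' : Theory Base Op}
    {G : List (GTy Base)} {A : GTy Base} (M : ETm S G A) {H : Hdl Γ S B 𝒯'} {σ : GSub G Γ}
    {k : Val Γ (.fn (A.toTy Op) B 𝒯')} (hH : H.Wf) (hσ : σ.Wf) (hk : k.Wf) :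
    (M.handleWith H σ k).Wf := by
  induction M generalizing Γ with
  | ret V => exact .app hk (V.inst_wf hσ)
  | letop o V M ih =>
    exact (hH o).inst₂ (V.inst_wf hσ) (.lam (ih (hH.rename _) (hσ.up _) (hk.rename _)))
  | case V M ih =>
    exact .case (V.inst_wf hσ) fun i => ih i (hH.rename _) (hσ.up _) (hk.rename _)

lemma ETm.translate_wf {S : Sig Base Op} {B : Ty Base Op} {𝒯' : Theory Base Op}
    {G : List (GTy Base)} {A : GTy Base} (M : ETm S G A) {H : Hdl Γ S B 𝒯'} (hH : H.Wf) :
    (M.translate H).Wf :=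
  M.handleWith_wf (hH.rename _) (fun _ _ => .var _) (.var _)

theorem Tm.Equ.wf {Γ : Ctx Base Op} {s : Kind Base Op} {M N : Tm Γ s} (h : M.Equ N) :
    M.Wf ∧ N.Wf := by
  match h with
  | .refl h => exact ⟨h, h⟩
  | .symm h => exact h.wf.symm
  | .trans h h' => exact ⟨h.wf.1, h'.wf.2⟩
  | .lam h => exact ⟨.lam h.wf.1, .lam h.wf.2⟩
  | .tuple h => exact ⟨.tuple fun i => (h i).wf.1, .tuple fun i => (h i).wf.2⟩
  | .proj i h => exact ⟨.proj i h.wf.1, .proj i h.wf.2⟩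
  | .inj i h => exact ⟨.inj i h.wf.1, .inj i h.wf.2⟩
  | .app h h' => exact ⟨.app h.wf.1 h'.wf.1, .app h.wf.2 h'.wf.2⟩
  | .ret h => exact ⟨.ret h.wf.1, .ret h.wf.2⟩
  | .letin h h' => exact ⟨.letin h.wf.1 h'.wf.1, .letin h.wf.2 h'.wf.2⟩
  | .op o h => exact ⟨.op o h.wf.1, .op o h.wf.2⟩
  | .case h h' =>
    exact ⟨.case h.wf.1 fun i => (h' i).wf.1, .case h.wf.2 fun i => (h' i).wf.2⟩
  | .handle h hH hr hr' h' =>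
    exact ⟨.handle h.wf.1 (fun o => (hH o).wf.1) hr h'.wf.1,
      .handle h.wf.2 (fun o => (hH o).wf.2) hr' h'.wf.2⟩
  | .fn_beta h h' => exact ⟨.app (.lam h) h', h.inst h'⟩
  | .fn_eta h => exact ⟨h, .lam (.app (h.rename _) (.var _))⟩
  | .prod_beta (V := V) i h => exact ⟨.proj i (.tuple h), h i⟩
  | .prod_eta h => exact ⟨h, .tuple fun i => .proj i h⟩
  | .sum_beta i h h' => exact ⟨.case (.inj i h) h', (h' i).inst h⟩
  | .sum_eta h h' =>
    exact ⟨.case h fun i => h'.subst ((Sub.ren_wf _).cons (.inj i (.var _))), h'.inst h⟩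
  | .ret_let h h' => exact ⟨.letin (.ret h) h', h'.inst h⟩
  | .let_ret h => exact ⟨.letin h (.ret (.var _)), h⟩
  | .let_let h h' h'' =>
    exact ⟨.letin (.letin h h') h'', .letin h (.letin h' (h''.rename _))⟩
  | .handle_ret h hH hr h' => exact ⟨.handle (.ret h) hH hr h', h'.inst h⟩
  | .handle_let h h' hH hr h'' =>
    exact ⟨.handle (.letin h h') hH hr h'', .handle h hH hr
      (.handle h' (fun o => (hH o).rename _) (Hdl.Respects.rename hr _) (h''.rename _))⟩
  | .handle_op o h hH hr h' => exact ⟨.handle (.op o h) hH hr h', (hH o).inst₂ h (.lam h')⟩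
  | .inst_ax he h => exact ⟨ETm.inst_wf _ h, ETm.inst_wf _ h⟩

lemma Sub.up_equ {σ τ : Sub Γ Δ} (h : ∀ ⦃A : Ty Base Op⦄ (x : Var Γ A), (σ x).Equ (τ x))
    {B : Ty Base Op} : ∀ ⦃A : Ty Base Op⦄ (x : Var (B :: Γ) A), (σ.up x).Equ (τ.up x)
  | _, .zero => .refl (.var _)
  | _, .succ x => (h x).rename _

theorem Tm.Wf.subst_congr {Γ : Ctx Base Op} {s : Kind Base Op} {M : Tm Γ s} (hM : M.Wf)
    {Δ : Ctx Base Op} {σ τ : Sub Γ Δ}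
    (h : ∀ ⦃A : Ty Base Op⦄ (x : Var Γ A), (σ x).Equ (τ x)) :
    (M.subst σ).Equ (M.subst τ) := by
  match hM with
  | .var x => exact h x
  | .lam hM => exact .lam (hM.subst_congr (Sub.up_equ h))
  | .tuple hV => exact .tuple fun i => (hV i).subst_congr h
  | .proj i hV => exact .proj i (hV.subst_congr h)
  | .inj i hV => exact .inj i (hV.subst_congr h)
  | .app hV hW => exact .app (hV.subst_congr h) (hW.subst_congr h)
  | .ret hV => exact .ret (hV.subst_congr h)
  | .letin hM hN => exact .letin (hM.subst_congr h) (hN.subst_congr (Sub.up_equ h))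
  | .op o hV => exact .op o (hV.subst_congr h)
  | .case hV hM => exact .case (hV.subst_congr h) fun i => (hM i).subst_congr (Sub.up_equ h)
  | .handle hM hH hr hN =>
    exact .handle (hM.subst_congr h) (fun o => (hH o).subst_congr (Sub.up_equ (Sub.up_equ h)))
      (Hdl.Respects.subst hr fun _ x => (h x).wf.1)
      (Hdl.Respects.subst hr fun _ x => (h x).wf.2) (hN.subst_congr (Sub.up_equ h))

end Stability

/-! ## Terms up to derivable equality -/

section Classes

variable {Base Op : Type u}

/-- Derivable equality as an equivalence relation on well-typed terms. -/
def tmSetoid (Γ : Ctx Base Op) (s : Kind Base Op) : Setoid {M : Tm Γ s // M.Wf} where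
  r M N := M.1.Equ N.1
  iseqv := ⟨fun M => .refl M.2, .symm, .trans⟩

/-- Well-typed terms up to derivable equality. -/
def Cl (Γ : Ctx Base Op) (s : Kind Base Op) : Type u := Quotient (tmSetoid Γ s)

/-- Substitutions by classes of values. -/
abbrev CSub (Γ Δ : Ctx Base Op) : Type u := ∀ ⦃A : Ty Base Op⦄, Var Γ A → Cl Δ (.val A)

/-- Handlers up to derivable equality. -/
abbrev CHdl (Γ : Ctx Base Op) (S : Sig Base Op) (B : Ty Base Op) (𝒯' : Theory Base Op) : Type u :=
  ∀ o : S.Idx, Cl (.fn (S.resTy o) B 𝒯' :: S.argTy o :: Γ) (.cmp B 𝒯')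

/-- Substitutions by classes of values for a ground context. -/
abbrev CGSub (G : List (GTy Base)) (Γ : Ctx Base Op) : Type u :=
  ∀ ⦃A : GTy Base⦄, Var G A → Cl Γ (.val (A.toTy Op))

namespace Cl

variable {Γ Δ Ξ : Ctx Base Op} {s : Kind Base Op} {A B : Ty Base Op} {𝒯 𝒯' : Theory Base Op}

/-- The class of a well-typed term. -/
def mk (M : Tm Γ s) (h : M.Wf) : Cl Γ s := Quotient.mk (tmSetoid Γ s) ⟨M, h⟩

lemma mk_eq_mk {M N : Tm Γ s} {hM : M.Wf} {hN : N.Wf} : mk M hM = mk N hN ↔ M.Equ N :=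
  ⟨fun h => Quotient.exact (s := tmSetoid Γ s) h,
    fun h => Quotient.sound (s := tmSetoid Γ s) h⟩

lemma mk_congr {M N : Tm Γ s} (h : M = N) (hM : M.Wf) : mk M hM = mk N (h ▸ hM) := by
  subst h; rfl

/-- A representative of a class. -/
noncomputable def rep (m : Cl Γ s) : Tm Γ s := (Quotient.out (s := tmSetoid Γ s) m).1

lemma rep_wf (m : Cl Γ s) : m.rep.Wf := (Quotient.out (s := tmSetoid Γ s) m).2

lemma mk_rep (m : Cl Γ s) : mk m.rep m.rep_wf = m := Quotient.out_eq (s := tmSetoid Γ s) m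

lemma rep_mk {M : Tm Γ s} (h : M.Wf) : (mk M h).rep.Equ M := mk_eq_mk.1 (mk_rep (mk M h))

lemma exists_mk (m : Cl Γ s) : ∃ M h, m = mk M h := ⟨_, _, m.mk_rep.symm⟩

lemma exists_mk_pi {ι : Type v} {Γ : ι → Ctx Base Op} {s : ι → Kind Base Op}
    (m : ∀ i, Cl (Γ i) (s i)) : ∃ (M : ∀ i, Tm (Γ i) (s i)) (h : ∀ i, (M i).Wf),
      m = fun i => mk (M i) (h i) :=
  ⟨fun i => (m i).rep, fun i => (m i).rep_wf, funext fun i => (m i).mk_rep.symm⟩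

/-- The class of a substitution. -/
def ofSub (σ : Sub Γ Δ) (h : σ.Wf) : CSub Γ Δ := fun _ x => mk (σ x) (h x)

lemma exists_ofSub (σ : CSub Γ Δ) : ∃ σ' h, σ = ofSub σ' h :=
  ⟨fun _ x => (σ x).rep, fun _ x => (σ x).rep_wf,
    funext fun _ => funext fun x => (σ x).mk_rep.symm⟩

noncomputable section

/-- A variable, as a class. -/
def var (x : Var Γ A) : Cl Γ (.val A) := mk (.var x) (.var x)

/-- `λ x. m` on classes. -/
def lam (m : Cl (A :: Γ) (.cmp B 𝒯)) : Cl Γ (.val (.fn A B 𝒯)) := mk (.lam m.rep) (.lam m.rep_wf)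

/-- `⟨v₁, …, vₙ⟩` on classes. -/
def tuple {n : ℕ} {A : Fin n → Ty Base Op} (v : ∀ i, Cl Γ (.val (A i))) :
    Cl Γ (.val (.prod A)) :=
  mk (.tuple fun i => (v i).rep) (.tuple fun i => (v i).rep_wf)

/-- `πᵢ v` on classes. -/
def proj {n : ℕ} {A : Fin n → Ty Base Op} (i : Fin n) (v : Cl Γ (.val (.prod A))) :
    Cl Γ (.val (A i)) :=
  mk (.proj i v.rep) (.proj i v.rep_wf)

/-- `ιᵢ v` on classes. -/
def inj {n : ℕ} {A : Fin n → Ty Base Op} (i : Fin n) (v : Cl Γ (.val (A i))) :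
    Cl Γ (.val (.sum A)) :=
  mk (.inj i v.rep) (.inj i v.rep_wf)

/-- `v w` on classes. -/
def app (v : Cl Γ (.val (.fn A B 𝒯))) (w : Cl Γ (.val A)) : Cl Γ (.cmp B 𝒯) :=
  mk (.app v.rep w.rep) (.app v.rep_wf w.rep_wf)

/-- `return v` on classes. -/
def ret (v : Cl Γ (.val A)) : Cl Γ (.cmp A 𝒯) := mk (.ret v.rep) (.ret v.rep_wf)

/-- `let x = m in n` on classes. -/
def letin (m : Cl Γ (.cmp A 𝒯)) (n : Cl (A :: Γ) (.cmp B 𝒯)) : Cl Γ (.cmp B 𝒯) :=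
  mk (.letin m.rep n.rep) (.letin m.rep_wf n.rep_wf)

/-- `op(v)` on classes. -/
def op (o : 𝒯.sig.Idx) (v : Cl Γ (.val (𝒯.sig.argTy o))) : Cl Γ (.cmp (𝒯.sig.resTy o) 𝒯) :=
  mk (.op o v.rep) (.op o v.rep_wf)

/-- `case v of {ιᵢ xᵢ ↦ mᵢ}` on classes. -/
def case {n : ℕ} {A : Fin n → Ty Base Op} (v : Cl Γ (.val (.sum A)))
    (m : ∀ i, Cl (A i :: Γ) (.cmp B 𝒯)) : Cl Γ (.cmp B 𝒯) :=
  mk (.case v.rep fun i => (m i).rep) (.case v.rep_wf fun i => (m i).rep_wf)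

/-- Simultaneous substitution of classes of values. -/
def subst (m : Cl Γ s) (σ : CSub Γ Δ) : Cl Δ s :=
  mk (m.rep.subst fun _ x => (σ x).rep) (m.rep_wf.subst fun _ x => (σ x).rep_wf)

end

lemma lam_mk {M : Cmp (A :: Γ) B 𝒯} (h : M.Wf) : lam (mk M h) = mk (.lam M) (.lam h) :=
  mk_eq_mk.2 (.lam (rep_mk h))

lemma tuple_mk {n : ℕ} {A : Fin n → Ty Base Op} {V : ∀ i, Val Γ (A i)} (h : ∀ i, (V i).Wf) :
    tuple (fun i => mk (V i) (h i)) = mk (.tuple V) (.tuple h) :=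
  mk_eq_mk.2 (.tuple fun i => rep_mk (h i))

lemma proj_mk {n : ℕ} {A : Fin n → Ty Base Op} (i : Fin n) {V : Val Γ (.prod A)} (h : V.Wf) :
    proj i (mk V h) = mk (.proj i V) (.proj i h) :=
  mk_eq_mk.2 (.proj i (rep_mk h))

lemma inj_mk {n : ℕ} {A : Fin n → Ty Base Op} (i : Fin n) {V : Val Γ (A i)} (h : V.Wf) :
    inj i (mk V h) = mk (.inj i V) (.inj (A := A) i h) :=
  mk_eq_mk.2 (.inj i (rep_mk h))

lemma app_mk {V : Val Γ (.fn A B 𝒯)} {W : Val Γ A} (h : V.Wf) (h' : W.Wf) :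
    app (mk V h) (mk W h') = mk (.app V W) (.app h h') :=
  mk_eq_mk.2 (.app (rep_mk h) (rep_mk h'))

lemma ret_mk {V : Val Γ A} (h : V.Wf) : ret (𝒯 := 𝒯) (mk V h) = mk (.ret V) (.ret h) :=
  mk_eq_mk.2 (.ret (rep_mk h))

lemma letin_mk {M : Cmp Γ A 𝒯} {N : Cmp (A :: Γ) B 𝒯} (h : M.Wf) (h' : N.Wf) :
    letin (mk M h) (mk N h') = mk (.letin M N) (.letin h h') :=
  mk_eq_mk.2 (.letin (rep_mk h) (rep_mk h'))

lemma op_mk (o : 𝒯.sig.Idx) {V : Val Γ (𝒯.sig.argTy o)} (h : V.Wf) :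
    op o (mk V h) = mk (.op o V) (.op o h) :=
  mk_eq_mk.2 (.op o (rep_mk h))

lemma case_mk {n : ℕ} {A : Fin n → Ty Base Op} {V : Val Γ (.sum A)}
    {M : ∀ i, Cmp (A i :: Γ) B 𝒯} (h : V.Wf) (h' : ∀ i, (M i).Wf) :
    case (mk V h) (fun i => mk (M i) (h' i)) = mk (.case V M) (.case h h') :=
  mk_eq_mk.2 (.case (rep_mk h) fun i => rep_mk (h' i))

lemma subst_mk {M : Tm Γ s} (h : M.Wf) {σ : Sub Γ Δ} (hσ : σ.Wf) :
    (mk M h).subst (ofSub σ hσ) = mk (M.subst σ) (h.subst hσ) :=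
  mk_eq_mk.2 (.trans ((rep_wf _).subst_congr fun _ x => rep_mk (hσ x)) ((rep_mk h).subst hσ))

end Cl

namespace CSub

variable {Γ Δ Ξ Θ : Ctx Base Op} {s : Kind Base Op} {A B : Ty Base Op}

/-- The identity substitution. -/
def ids (Γ : Ctx Base Op) : CSub Γ Γ := fun _ x => .var x

/-- The weakening substitution. -/
def shift (Γ : Ctx Base Op) (B : Ty Base Op) : CSub Γ (B :: Γ) := fun _ x => .var (.succ x)

/-- The composite of two substitutions. -/
noncomputable def comp (σ : CSub Γ Δ) (τ : CSub Δ Ξ) : CSub Γ Ξ := fun _ x => (σ x).subst τ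

/-- The extension of a substitution by a value. -/
def cons (σ : CSub Γ Δ) (v : Cl Δ (.val B)) : CSub (B :: Γ) Δ
  | _, .zero => v
  | _, .succ x => σ x

/-- The extension of a substitution under a binder. -/
@[simp] noncomputable def up (σ : CSub Γ Δ) {B : Ty Base Op} : CSub (B :: Γ) (B :: Δ) :=
  cons (comp σ (shift Δ B)) (.var .zero)

@[simp] lemma cons_zero (σ : CSub Γ Δ) (v : Cl Δ (.val B)) : cons σ v .zero = v := rfl

@[simp] lemma cons_succ (σ : CSub Γ Δ) (v : Cl Δ (.val B)) (x : Var Γ A) :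
    cons σ v (.succ x) = σ x := rfl

@[simp] lemma shift_apply (x : Var Γ A) : shift Γ B x = .var (.succ x) := rfl

lemma comp_apply (σ : CSub Γ Δ) (τ : CSub Δ Ξ) (x : Var Γ A) :
    comp σ τ x = (σ x).subst τ := rfl

lemma ext_cons {σ τ : CSub (B :: Γ) Δ} (h₀ : σ .zero = τ .zero)
    (h : ∀ ⦃A : Ty Base Op⦄ (x : Var Γ A), σ (.succ x) = τ (.succ x)) : σ = τ := by
  funext A x
  cases x with
  | zero => exact h₀
  | succ x => exact h x

end CSub

open CSub

namespace Cl

variable {Γ Δ Ξ : Ctx Base Op} {s : Kind Base Op} {A B : Ty Base Op} {𝒯 𝒯' : Theory Base Op}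

lemma ofSub_ids : ofSub (Sub.ids Γ) Sub.ids_wf = ids Γ := rfl

lemma ofSub_shift : ofSub (fun _ x => .var (.succ x)) (Sub.ren_wf fun _ x => .succ x) =
    shift Γ B := rfl

lemma ofSub_cons {σ : Sub Γ Δ} (hσ : σ.Wf) {V : Val Δ B} (hV : V.Wf) :
    ofSub (σ.cons V) (hσ.cons hV) = cons (ofSub σ hσ) (mk V hV) :=
  ext_cons rfl fun _ _ => rfl

lemma subst_shift_mk {M : Tm Γ s} (h : M.Wf) :
    (mk M h).subst (shift Γ B) = mk M.wk (h.rename _) := by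
  rw [← ofSub_shift, subst_mk]
  exact mk_congr (Tm.rename_eq_subst _ _).symm _

lemma ofSub_up {σ : Sub Γ Δ} (hσ : σ.Wf) :
    ofSub (σ.up (B := B)) (hσ.up B) = up (ofSub σ hσ) :=
  ext_cons rfl fun _ x => (subst_shift_mk (hσ x)).symm

@[simp] lemma subst_var (x : Var Γ A) (σ : CSub Γ Δ) : (var x).subst σ = σ x := by
  obtain ⟨σ, hσ, rfl⟩ := exists_ofSub σ
  exact subst_mk (.var x) hσ

@[simp] lemma subst_lam (m : Cl (A :: Γ) (.cmp B 𝒯)) (σ : CSub Γ Δ) :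
    (lam m).subst σ = lam (m.subst σ.up) := by
  obtain ⟨σ, hσ, rfl⟩ := exists_ofSub σ
  obtain ⟨M, hM, rfl⟩ := exists_mk m
  simp only [← ofSub_up, subst_mk, lam_mk]; rfl

@[simp] lemma subst_tuple {n : ℕ} {A : Fin n → Ty Base Op} (v : ∀ i, Cl Γ (.val (A i)))
    (σ : CSub Γ Δ) : (tuple v).subst σ = tuple fun i => (v i).subst σ := by
  obtain ⟨σ, hσ, rfl⟩ := exists_ofSub σ
  obtain ⟨V, hV, rfl⟩ := exists_mk_pi v
  simp only [subst_mk, tuple_mk]; rfl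

@[simp] lemma subst_proj {n : ℕ} {A : Fin n → Ty Base Op} (i : Fin n)
    (v : Cl Γ (.val (.prod A))) (σ : CSub Γ Δ) : (proj i v).subst σ = proj i (v.subst σ) := by
  obtain ⟨σ, hσ, rfl⟩ := exists_ofSub σ
  obtain ⟨V, hV, rfl⟩ := exists_mk v
  simp only [subst_mk, proj_mk]; rfl

@[simp] lemma subst_inj {n : ℕ} {A : Fin n → Ty Base Op} (i : Fin n)
    (v : Cl Γ (.val (A i))) (σ : CSub Γ Δ) :
    (inj (A := A) i v).subst σ = inj i (v.subst σ) := by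
  obtain ⟨σ, hσ, rfl⟩ := exists_ofSub σ
  obtain ⟨V, hV, rfl⟩ := exists_mk v
  simp only [subst_mk, inj_mk]; rfl

@[simp] lemma subst_app (v : Cl Γ (.val (.fn A B 𝒯))) (w : Cl Γ (.val A)) (σ : CSub Γ Δ) :
    (app v w).subst σ = app (v.subst σ) (w.subst σ) := by
  obtain ⟨σ, hσ, rfl⟩ := exists_ofSub σ
  obtain ⟨V, hV, rfl⟩ := exists_mk v
  obtain ⟨W, hW, rfl⟩ := exists_mk w
  simp only [subst_mk, app_mk]; rfl

@[simp] lemma subst_ret (v : Cl Γ (.val A)) (σ : CSub Γ Δ) :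
    (ret (𝒯 := 𝒯) v).subst σ = ret (v.subst σ) := by
  obtain ⟨σ, hσ, rfl⟩ := exists_ofSub σ
  obtain ⟨V, hV, rfl⟩ := exists_mk v
  simp only [subst_mk, ret_mk]; rfl

@[simp] lemma subst_letin (m : Cl Γ (.cmp A 𝒯)) (n : Cl (A :: Γ) (.cmp B 𝒯)) (σ : CSub Γ Δ) :
    (letin m n).subst σ = letin (m.subst σ) (n.subst σ.up) := by
  obtain ⟨σ, hσ, rfl⟩ := exists_ofSub σ
  obtain ⟨M, hM, rfl⟩ := exists_mk m
  obtain ⟨N, hN, rfl⟩ := exists_mk n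
  simp only [← ofSub_up, subst_mk, letin_mk]; rfl

@[simp] lemma subst_op (o : 𝒯.sig.Idx) (v : Cl Γ (.val (𝒯.sig.argTy o))) (σ : CSub Γ Δ) :
    (op o v).subst σ = op o (v.subst σ) := by
  obtain ⟨σ, hσ, rfl⟩ := exists_ofSub σ
  obtain ⟨V, hV, rfl⟩ := exists_mk v
  simp only [subst_mk, op_mk]; rfl

@[simp] lemma subst_case {n : ℕ} {A : Fin n → Ty Base Op} (v : Cl Γ (.val (.sum A)))
    (m : ∀ i, Cl (A i :: Γ) (.cmp B 𝒯)) (σ : CSub Γ Δ) :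
    (case v m).subst σ = case (v.subst σ) fun i => (m i).subst σ.up := by
  obtain ⟨σ, hσ, rfl⟩ := exists_ofSub σ
  obtain ⟨V, hV, rfl⟩ := exists_mk v
  obtain ⟨M, hM, rfl⟩ := exists_mk_pi m
  simp only [← ofSub_up, subst_mk, case_mk]; rfl

lemma ofSub_comp {σ : Sub Γ Δ} (hσ : σ.Wf) {τ : Sub Δ Ξ} (hτ : τ.Wf) :
    comp (ofSub σ hσ) (ofSub τ hτ) = ofSub (fun _ x => (σ x).subst τ) (hσ.comp hτ) :=
  funext fun _ => funext fun x => subst_mk (hσ x) hτ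

@[simp] lemma subst_subst (m : Cl Γ s) (σ : CSub Γ Δ) (τ : CSub Δ Ξ) :
    (m.subst σ).subst τ = m.subst (comp σ τ) := by
  obtain ⟨σ, hσ, rfl⟩ := exists_ofSub σ
  obtain ⟨τ, hτ, rfl⟩ := exists_ofSub τ
  obtain ⟨M, hM, rfl⟩ := exists_mk m
  simp only [ofSub_comp, subst_mk]
  exact mk_congr (Tm.subst_subst _ _ _) _

@[simp] lemma subst_ids (m : Cl Γ s) : m.subst (ids Γ) = m := by
  obtain ⟨M, hM, rfl⟩ := exists_mk m
  rw [← ofSub_ids, subst_mk]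
  exact mk_congr (Tm.subst_ids _) _

end Cl

namespace CSub

variable {Γ Δ Ξ Θ : Ctx Base Op} {s : Kind Base Op} {A B : Ty Base Op}

@[simp] lemma comp_cons (σ : CSub Γ Δ) (v : Cl Δ (.val B)) (τ : CSub Δ Ξ) :
    comp (cons σ v) τ = cons (comp σ τ) (v.subst τ) :=
  ext_cons rfl fun _ _ => rfl

@[simp] lemma comp_ids (σ : CSub Γ Δ) : comp σ (ids Δ) = σ :=
  funext fun _ => funext fun _ => Cl.subst_ids _

@[simp] lemma ids_comp (σ : CSub Γ Δ) : comp (ids Γ) σ = σ :=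
  funext fun _ => funext fun _ => Cl.subst_var _ _

@[simp] lemma comp_assoc (σ : CSub Γ Δ) (τ : CSub Δ Ξ) (υ : CSub Ξ Θ) :
    comp (comp σ τ) υ = comp σ (comp τ υ) :=
  funext fun _ => funext fun _ => Cl.subst_subst _ _ _

@[simp] lemma shift_comp (σ : CSub Γ Δ) (v : Cl Δ (.val B)) :
    comp (shift Γ B) (cons σ v) = σ :=
  funext fun _ => funext fun _ => Cl.subst_var _ _

@[simp] lemma cons_shift : cons (shift Γ B) (.var .zero) = ids (B :: Γ) :=
  ext_cons rfl fun _ _ => rfl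

@[simp] lemma cons_shift_shift :
    cons (comp (shift Γ A) (shift (A :: Γ) B)) (.var (.succ .zero)) = shift (A :: Γ) B :=
  ext_cons rfl fun _ _ => Cl.subst_var _ _

end CSub

namespace CHdl

variable {Γ Δ Ξ : Ctx Base Op} {S : Sig Base Op} {B : Ty Base Op} {𝒯 𝒯' : Theory Base Op}

/-- The action of a substitution on handlers. -/
noncomputable def subst (h : CHdl Γ S B 𝒯') (σ : CSub Γ Δ) : CHdl Δ S B 𝒯' :=
  fun o => (h o).subst σ.up.up

lemma subst_apply (h : CHdl Γ S B 𝒯') (σ : CSub Γ Δ) (o : S.Idx) :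
    subst h σ o = (h o).subst σ.up.up := rfl

@[simp] lemma subst_subst (h : CHdl Γ S B 𝒯') (σ : CSub Γ Δ) (τ : CSub Δ Ξ) :
    subst (subst h σ) τ = subst h (comp σ τ) := by
  funext o; simp [subst]

@[simp] lemma subst_ids (h : CHdl Γ S B 𝒯') : subst h (ids Γ) = h := by
  funext o; simp [subst]

/-- The class of a handler. -/
def ofHdl (H : Hdl Γ S B 𝒯') (h : H.Wf) : CHdl Γ S B 𝒯' := fun o => .mk (H o) (h o)

lemma ofHdl_congr {H H' : Hdl Γ S B 𝒯'} (e : H = H') (h : H.Wf) :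
    ofHdl H h = ofHdl H' (e ▸ h) := by
  subst e; rfl

lemma ofHdl_subst (H : Hdl Γ S B 𝒯') (h : H.Wf) {σ : Sub Γ Δ} (hσ : σ.Wf) :
    subst (ofHdl H h) (Cl.ofSub σ hσ) =
      ofHdl (H.subst σ) (h.subst hσ) := by
  funext o
  simp only [subst, ofHdl, ← Cl.ofSub_up, Cl.subst_mk]; rfl

lemma ofHdl_subst_shift (H : Hdl Γ S B 𝒯') (h : H.Wf) (C : Ty Base Op) :
    subst (ofHdl H h) (shift Γ C) = ofHdl (H.rename fun _ x => .succ x) (h.rename _) := by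
  rw [← Cl.ofSub_shift, ofHdl_subst]
  exact ofHdl_congr (Hdl.rename_eq_subst _ _).symm _

end CHdl

/-! ### Effect theory terms up to derivable equality -/

section Ground

variable {Γ Δ Ξ : Ctx Base Op} {S : Sig Base Op} {B : Ty Base Op} {𝒯 𝒯' : Theory Base Op}
  {G : List (GTy Base)} {A : GTy Base}

/-- The extension of a ground substitution by a value. -/
def CGSub.cons (σ : CGSub G Γ) {B : GTy Base} (v : Cl Γ (.val (B.toTy Op))) : CGSub (B :: G) Γ
  | _, .zero => v
  | _, .succ x => σ x

/-- The composite of a ground substitution with a substitution. -/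
noncomputable def CGSub.comp (σ : CGSub G Γ) (τ : CSub Γ Δ) : CGSub G Δ :=
  fun _ x => (σ x).subst τ

lemma CGSub.ext_cons {B : GTy Base} {σ τ : CGSub (B :: G) Γ} (h₀ : σ .zero = τ .zero)
    (h : ∀ ⦃A : GTy Base⦄ (x : Var G A), σ (.succ x) = τ (.succ x)) : σ = τ := by
  funext A x
  cases x with
  | zero => exact h₀
  | succ x => exact h x

lemma CGSub.comp_apply (σ : CGSub G Γ) (τ : CSub Γ Δ) (x : Var G A) :
    σ.comp τ x = (σ x).subst τ := rfl

@[simp] lemma CGSub.comp_cons (σ : CGSub G Γ) {B : GTy Base} (v : Cl Γ (.val (B.toTy Op)))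
    (τ : CSub Γ Δ) : (σ.cons v).comp τ = (σ.comp τ).cons (v.subst τ) :=
  ext_cons rfl fun _ _ => rfl

@[simp] lemma CGSub.comp_comp (σ : CGSub G Γ) (τ : CSub Γ Δ) (υ : CSub Δ Ξ) :
    (σ.comp τ).comp υ = σ.comp (CSub.comp τ υ) :=
  funext fun _ => funext fun _ => Cl.subst_subst _ _ _

/-- The extension of a ground substitution under a binder. -/
@[simp] noncomputable def CGSub.up (σ : CGSub G Γ) {B : GTy Base} :
    CGSub (B :: G) (B.toTy Op :: Γ) :=
  (σ.comp (shift Γ _)).cons (.var .zero)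

/-- The class of a ground substitution. -/
def CGSub.ofGSub (σ : GSub G Γ) (h : σ.Wf) : CGSub G Γ :=
  fun _ x => .mk (σ x) (h _ x)

lemma CGSub.exists_ofGSub (σ : CGSub G Γ) : ∃ σ' h, σ = ofGSub σ' h :=
  ⟨fun _ x => (σ x).rep, fun _ x => (σ x).rep_wf,
    funext fun _ => funext fun x => (σ x).mk_rep.symm⟩

lemma CGSub.ofGSub_up {σ : GSub G Γ} (h : σ.Wf)
    (B : GTy Base) : ofGSub (σ.up (B := B)) (h.up B) = up (ofGSub σ h) :=
  ext_cons rfl fun _ x => (Cl.subst_shift_mk (h _ x)).symm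

/-- `V[σ]` up to derivable equality. -/
noncomputable def GTm.clInst (σ : CGSub G Γ) : ∀ {A : GTy Base}, GTm G A → Cl Γ (.val (A.toTy Op))
  | _, .var x => σ x
  | _, .tuple V => .tuple fun i => (V i).clInst σ
  | _, .proj (A := A) i V => .proj (A := fun i => (A i).toTy Op) i (V.clInst σ)
  | _, .inj (A := A) i V => .inj (A := fun i => (A i).toTy Op) i (V.clInst σ)

lemma GTm.clInst_ofGSub (V : GTm G A) {σ : GSub G Γ}
    (h : σ.Wf) :
    V.clInst (.ofGSub σ h) = .mk (V.inst σ) (V.inst_wf h) := by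
  induction V with
  | var x => rfl
  | tuple V ih => exact (congrArg Cl.tuple (funext ih)).trans (Cl.tuple_mk _)
  | proj i V ih =>
    exact (congrArg (Cl.proj (A := fun i => GTy.toTy Op _) i) ih).trans (Cl.proj_mk _ _)
  | inj i V ih =>
    exact (congrArg (Cl.inj (A := fun i => GTy.toTy Op _) i) ih).trans (Cl.inj_mk _ _)

@[simp] lemma GTm.clInst_subst (V : GTm G A) (σ : CGSub G Γ) (τ : CSub Γ Δ) :
    (V.clInst σ).subst τ = V.clInst (σ.comp τ) := by
  induction V with
  | var x => rfl
  | tuple V ih => exact (Cl.subst_tuple _ _).trans (congrArg Cl.tuple (funext ih))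
  | proj i V ih =>
    exact (Cl.subst_proj _ _ _).trans (congrArg (Cl.proj (A := fun i => GTy.toTy Op _) i) ih)
  | inj i V ih =>
    exact (Cl.subst_inj _ _ _).trans (congrArg (Cl.inj (A := fun i => GTy.toTy Op _) i) ih)

/-- `M[σ]` up to derivable equality. -/
noncomputable def ETm.clInst : ∀ {G : List (GTy Base)} {A : GTy Base}, ETm 𝒯.sig G A →
    ∀ {Γ : Ctx Base Op}, CGSub G Γ → Cl Γ (.cmp (A.toTy Op) 𝒯)
  | _, _, .ret V, _, σ => .ret (V.clInst σ)
  | _, _, .letop o V M, _, σ => .letin (.op o (V.clInst σ)) (M.clInst σ.up)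
  | _, _, .case (B := B) V M, _, σ =>
      .case (A := fun i => (B i).toTy Op) (V.clInst σ) fun i => (M i).clInst σ.up

lemma ETm.clInst_ofGSub (M : ETm 𝒯.sig G A) {σ : GSub G Γ}
    (h : σ.Wf) :
    M.clInst (.ofGSub σ h) = .mk (M.inst σ) (M.inst_wf h) := by
  induction M generalizing Γ with
  | ret V => simp only [ETm.clInst, GTm.clInst_ofGSub, Cl.ret_mk]; rfl
  | letop o V M ih =>
    simp only [ETm.clInst, GTm.clInst_ofGSub, ← CGSub.ofGSub_up, ih, Cl.op_mk, Cl.letin_mk]; rfl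
  | case V M ih =>
    simp only [ETm.clInst, ← CGSub.ofGSub_up, ih]
    exact (congrArg (Cl.case (A := fun i => GTy.toTy Op _) · _) (V.clInst_ofGSub h)).trans
      (Cl.case_mk _ _)

lemma ETm.clInst_subst (M : ETm 𝒯.sig G A) (σ : CGSub G Γ) (τ : CSub Γ Δ) :
    (M.clInst σ).subst τ = M.clInst (σ.comp τ) := by
  induction M generalizing Γ Δ with
  | ret V => simp [ETm.clInst]
  | letop o V M ih => simp [ETm.clInst, ih]
  | case V M ih =>
    refine (Cl.subst_case (A := fun i => GTy.toTy Op _) _ _ _).trans ?_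
    refine congr (congrArg (Cl.case (A := fun i => GTy.toTy Op _)) (V.clInst_subst σ τ))
      (funext fun i => ?_)
    simp [ih]

/-- The translation of an effect theory term by a handler and a continuation, up to derivable
equality. -/
noncomputable def ETm.clHandleWith : ∀ {G : List (GTy Base)} {A : GTy Base}, ETm S G A →
    ∀ {Γ : Ctx Base Op}, CHdl Γ S B 𝒯' → CGSub G Γ → Cl Γ (.val (.fn (A.toTy Op) B 𝒯')) →
      Cl Γ (.cmp B 𝒯')
  | _, _, .ret V, _, _, σ, k => .app k (V.clInst σ)
  | _, _, .letop o V M, Γ, h, σ, k =>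
      (h o).subst (((ids Γ).cons (V.clInst σ)).cons
        (.lam (M.clHandleWith (h.subst (shift Γ _)) σ.up (k.subst (shift Γ _)))))
  | _, _, .case (B := B) V M, Γ, h, σ, k =>
      .case (A := fun i => (B i).toTy Op) (V.clInst σ)
        fun i => (M i).clHandleWith (h.subst (shift Γ _)) σ.up (k.subst (shift Γ _))

lemma ETm.clHandleWith_mk (M : ETm S G A) {H : Hdl Γ S B 𝒯'} (hH : H.Wf) {σ : GSub G Γ}
    (hσ : σ.Wf) {k : Val Γ (.fn (A.toTy Op) B 𝒯')}
    (hk : k.Wf) :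
    M.clHandleWith (.ofHdl H hH) (.ofGSub σ hσ) (.mk k hk) =
      .mk (M.handleWith H σ k) (M.handleWith_wf hH hσ hk) := by
  induction M generalizing Γ with
  | ret V => simp only [ETm.clHandleWith, GTm.clInst_ofGSub, Cl.app_mk]; rfl
  | letop o V M ih =>
    simp only [ETm.clHandleWith, GTm.clInst_ofGSub, ← CGSub.ofGSub_up, CHdl.ofHdl_subst_shift,
      Cl.subst_shift_mk, ih, Cl.lam_mk]
    rw [← Cl.ofSub_ids, ← Cl.ofSub_cons, ← Cl.ofSub_cons]
    exact Cl.subst_mk _ _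
  | case V M ih =>
    simp only [ETm.clHandleWith, ← CGSub.ofGSub_up, CHdl.ofHdl_subst_shift, Cl.subst_shift_mk, ih]
    exact (congrArg (Cl.case (A := fun i => GTy.toTy Op _) · _) (V.clInst_ofGSub hσ)).trans
      (Cl.case_mk _ _)

lemma ETm.clHandleWith_subst (M : ETm S G A) (h : CHdl Γ S B 𝒯') (σ : CGSub G Γ)
    (k : Cl Γ (.val (.fn (A.toTy Op) B 𝒯'))) (τ : CSub Γ Δ) :
    (M.clHandleWith h σ k).subst τ = M.clHandleWith (h.subst τ) (σ.comp τ) (k.subst τ) := by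
  induction M generalizing Γ Δ with
  | ret V => simp [ETm.clHandleWith]
  | letop o V M ih => simp [ETm.clHandleWith, ih, CHdl.subst_apply]
  | case V M ih =>
    refine (Cl.subst_case (A := fun i => GTy.toTy Op _) _ _ _).trans ?_
    refine congr (congrArg (Cl.case (A := fun i => GTy.toTy Op _)) (V.clInst_subst σ τ))
      (funext fun i => ?_)
    simp [ih]

/-- The handler `h` respects the axioms of `𝒯`: both sides of each axiom have the same translation,
for all values of their ground variables and all continuations, over any context to which `h` can
be moved. -/
def CHdl.Respects (h : CHdl Γ 𝒯.sig B 𝒯') : Prop :=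
  ∀ e ∈ 𝒯.ax, ∀ {Δ : Ctx Base Op} (τ : CSub Γ Δ) (σ : CGSub e.ctx Δ)
    (k : Cl Δ (.val (.fn (e.ty.toTy Op) B 𝒯'))),
    e.lhs.clHandleWith (h.subst τ) σ k = e.rhs.clHandleWith (h.subst τ) σ k

lemma CHdl.Respects.subst {h : CHdl Γ 𝒯.sig B 𝒯'} (hr : h.Respects) (τ : CSub Γ Δ) :
    (h.subst τ).Respects := fun e he Ξ υ σ k => by
  simpa only [CHdl.subst_subst] using hr e he (CSub.comp τ υ) σ k

/-- The substitution of `τ` for `Γ` and of `σ` for `G` in the context `Γ, G`. -/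
def CSub.append (τ : CSub Γ Δ) : ∀ {G : List (GTy Base)}, CGSub G Δ →
    CSub (G.map (GTy.toTy Op) ++ Γ) Δ
  | [], _ => τ
  | _ :: _, σ => CSub.cons (CSub.append τ fun _ x => σ (.succ x)) (σ .zero)

lemma CSub.append_ofGround (τ : CSub Γ Δ) (σ : CGSub G Δ) (x : Var G A) :
    CSub.append τ σ (x.ofGround Γ) = σ x := by
  induction x with
  | zero => rfl
  | succ _ ih => exact ih fun _ x => σ (.succ x)

lemma CSub.append_append (τ : CSub Γ Δ) (σ : CGSub G Δ) {A : Ty Base Op} (x : Var Γ A) :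
    CSub.append τ σ (Ren.append Γ _ x) = τ x := by
  induction G with
  | nil => rfl
  | cons B G ih => exact ih fun _ x => σ (.succ x)

lemma ETm.mk_translate (M : ETm S G A) {H : Hdl Γ S B 𝒯'} (hH : H.Wf) :
    Cl.mk (M.translate H) (M.translate_wf hH) =
      M.clHandleWith (CHdl.subst (.ofHdl H hH)
        fun _ x => .var (.succ (Ren.append Γ (G.map (GTy.toTy Op)) x)))
        (fun _ x => .var (.succ (x.ofGround Γ))) (.var .zero) := by
  have := M.clHandleWith_mk (H := H.rename fun _ x => .succ (Ren.append Γ (G.map (GTy.toTy Op)) x))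
    (hH.rename _) (σ := fun _ x => .var (.succ (x.ofGround Γ))) (fun _ _ => .var _)
    (k := .var .zero) (.var _)
  refine this.symm.trans ?_
  congr 1
  refine Eq.trans ?_ (CHdl.ofHdl_subst H hH (Sub.ren_wf _)).symm
  exact CHdl.ofHdl_congr (Hdl.rename_eq_subst _ _) _

lemma CHdl.respects_ofHdl {H : Hdl Γ 𝒯.sig B 𝒯'} (hH : H.Wf) :
    (CHdl.ofHdl H hH).Respects ↔ H.Respects := by
  constructor
  · intro h e he
    refine Cl.mk_eq_mk.1 (?_ : Cl.mk _ (e.lhs.translate_wf hH) = Cl.mk _ (e.rhs.translate_wf hH))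
    rw [ETm.mk_translate, ETm.mk_translate]
    exact h e he _ _ _
  · intro h e he Δ τ σ k
    have key := congrArg (fun m => Cl.subst m (CSub.cons (CSub.append τ σ) k))
      (Cl.mk_eq_mk (hM := e.lhs.translate_wf hH) (hN := e.rhs.translate_wf hH) |>.2 (h e he))
    have hτ : CSub.comp (fun _ x => .var (.succ (Ren.append Γ (e.ctx.map (GTy.toTy Op)) x)))
        (CSub.cons (CSub.append τ σ) k) = τ := by
      funext A x
      simp only [CSub.comp_apply, Cl.subst_var, CSub.cons_succ, CSub.append_append]
    have hσ : CGSub.comp (fun _ x => .var (.succ (x.ofGround Γ)))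
        (CSub.cons (CSub.append τ σ) k) = σ := by
      funext A x
      simp only [CGSub.comp_apply, Cl.subst_var, CSub.cons_succ, CSub.append_ofGround]
    rw [ETm.mk_translate, ETm.mk_translate] at key
    simpa only [ETm.clHandleWith_subst, CHdl.subst_subst, hτ, hσ, Cl.subst_var, CSub.cons_zero]
      using key

lemma CHdl.exists_ofHdl (h : CHdl Γ S B 𝒯') : ∃ H hH, h = ofHdl H hH :=
  ⟨fun o => (h o).rep, fun o => (h o).rep_wf, funext fun o => (h o).mk_rep.symm⟩

lemma CHdl.respects_rep {h : CHdl Γ 𝒯.sig B 𝒯'} (hr : h.Respects) :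
    Hdl.Respects (𝒯 := 𝒯) fun o => (h o).rep := by
  refine (CHdl.respects_ofHdl fun o => (h o).rep_wf).1 ?_
  rwa [show CHdl.ofHdl (fun o => (h o).rep) (fun o => (h o).rep_wf) = h from
    funext fun o => (h o).mk_rep]

end Ground

namespace Cl

variable {Γ Δ Ξ : Ctx Base Op} {s : Kind Base Op} {A B C : Ty Base Op} {𝒯 𝒯' : Theory Base Op}

/-- `handle m with h to x. n` on classes; `handle` is only formed with a handler that respects the
axioms. -/
noncomputable def handle (m : Cl Γ (.cmp A 𝒯)) (h : CHdl Γ 𝒯.sig B 𝒯') (hr : h.Respects)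
    (n : Cl (A :: Γ) (.cmp B 𝒯')) : Cl Γ (.cmp B 𝒯') :=
  mk (.handle m.rep (fun o => (h o).rep) n.rep)
    (.handle m.rep_wf (fun o => (h o).rep_wf) (CHdl.respects_rep hr) n.rep_wf)

lemma handle_mk {M : Cmp Γ A 𝒯} {H : Hdl Γ 𝒯.sig B 𝒯'} {N : Cmp (A :: Γ) B 𝒯'}
    (hM : M.Wf) (hH : H.Wf) (hr : (CHdl.ofHdl H hH).Respects) (hN : N.Wf) :
    handle (mk M hM) (CHdl.ofHdl H hH) hr (mk N hN) =
      mk (.handle M H N) (.handle hM hH ((CHdl.respects_ofHdl hH).1 hr) hN) :=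
  mk_eq_mk.2 (.handle (rep_mk hM) (fun o => rep_mk (hH o)) (CHdl.respects_rep hr)
    ((CHdl.respects_ofHdl hH).1 hr) (rep_mk hN))

@[simp] lemma subst_handle (m : Cl Γ (.cmp A 𝒯)) (h : CHdl Γ 𝒯.sig B 𝒯') (hr : h.Respects)
    (n : Cl (A :: Γ) (.cmp B 𝒯')) (σ : CSub Γ Δ) :
    (handle m h hr n).subst σ =
      handle (m.subst σ) (h.subst σ) (hr.subst σ) (n.subst σ.up) := by
  obtain ⟨σ, hσ, rfl⟩ := exists_ofSub σ
  obtain ⟨M, hM, rfl⟩ := exists_mk m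
  obtain ⟨N, hN, rfl⟩ := exists_mk n
  obtain ⟨H, hH, rfl⟩ := CHdl.exists_ofHdl h
  simp only [← ofSub_up, subst_mk, handle_mk, CHdl.ofHdl_subst]; rfl

@[simp] lemma app_lam (m : Cl (A :: Γ) (.cmp B 𝒯)) (v : Cl Γ (.val A)) :
    app (lam m) v = m.subst ((ids Γ).cons v) := by
  obtain ⟨M, hM, rfl⟩ := exists_mk m
  obtain ⟨V, hV, rfl⟩ := exists_mk v
  rw [← ofSub_ids, ← ofSub_cons, subst_mk, lam_mk, app_mk]
  exact mk_eq_mk.2 (.fn_beta hM hV)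

lemma lam_app (v : Cl Γ (.val (.fn A B 𝒯))) :
    lam (app (v.subst (shift Γ A)) (var .zero)) = v := by
  obtain ⟨V, hV, rfl⟩ := exists_mk v
  rw [subst_shift_mk, var, app_mk, lam_mk]
  exact mk_eq_mk.2 (.symm (.fn_eta hV))

@[simp] lemma proj_tuple {n : ℕ} {A : Fin n → Ty Base Op} (i : Fin n)
    (v : ∀ i, Cl Γ (.val (A i))) : proj i (tuple v) = v i := by
  obtain ⟨V, hV, rfl⟩ := exists_mk_pi v
  rw [tuple_mk, proj_mk]
  exact mk_eq_mk.2 (.prod_beta i hV)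

@[simp] lemma tuple_proj {n : ℕ} {A : Fin n → Ty Base Op} (v : Cl Γ (.val (.prod A))) :
    tuple (fun i => proj i v) = v := by
  obtain ⟨V, hV, rfl⟩ := exists_mk v
  simp only [proj_mk, tuple_mk]
  exact mk_eq_mk.2 (.symm (.prod_eta hV))

@[simp] lemma case_inj {n : ℕ} {A : Fin n → Ty Base Op} (i : Fin n) (v : Cl Γ (.val (A i)))
    (m : ∀ i, Cl (A i :: Γ) (.cmp B 𝒯)) :
    case (inj i v) m = (m i).subst ((ids Γ).cons v) := by
  obtain ⟨M, hM, rfl⟩ := exists_mk_pi m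
  obtain ⟨V, hV, rfl⟩ := exists_mk v
  rw [← ofSub_ids, ← ofSub_cons, subst_mk, inj_mk, case_mk]
  exact mk_eq_mk.2 (.sum_beta i hV hM)

lemma case_eta {n : ℕ} {A : Fin n → Ty Base Op} (v : Cl Γ (.val (.sum A)))
    (m : Cl (.sum A :: Γ) (.cmp B 𝒯)) :
    case v (fun i => m.subst ((shift Γ (A i)).cons (inj i (var .zero)))) =
      m.subst ((ids Γ).cons v) := by
  obtain ⟨M, hM, rfl⟩ := exists_mk m
  obtain ⟨V, hV, rfl⟩ := exists_mk v
  simp only [← ofSub_ids, ← ofSub_cons, subst_mk, var, inj_mk, ← ofSub_shift, case_mk]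
  exact mk_eq_mk.2 (.sum_eta hV hM)

@[simp] lemma letin_ret (v : Cl Γ (.val A)) (m : Cl (A :: Γ) (.cmp B 𝒯)) :
    letin (ret v) m = m.subst ((ids Γ).cons v) := by
  obtain ⟨M, hM, rfl⟩ := exists_mk m
  obtain ⟨V, hV, rfl⟩ := exists_mk v
  rw [← ofSub_ids, ← ofSub_cons, subst_mk, ret_mk, letin_mk]
  exact mk_eq_mk.2 (.ret_let hV hM)

@[simp] lemma letin_ret_var (m : Cl Γ (.cmp A 𝒯)) : letin m (ret (var .zero)) = m := by
  obtain ⟨M, hM, rfl⟩ := exists_mk m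
  rw [var, ret_mk, letin_mk]
  exact mk_eq_mk.2 (.let_ret hM)

lemma subst_up_shift_mk {L : Tm (A :: Γ) s} (hL : L.Wf) :
    (mk L hL).subst (up (shift Γ B)) =
      mk (L.rename (Ren.up fun _ x => .succ x)) (hL.rename _) := by
  rw [← ofSub_shift, ← ofSub_up, subst_mk]
  exact mk_congr (by rw [Tm.rename_eq_subst, Sub.up_var]) _

@[simp] lemma letin_letin (m : Cl Γ (.cmp A 𝒯)) (n : Cl (A :: Γ) (.cmp B 𝒯))
    (l : Cl (B :: Γ) (.cmp C 𝒯)) :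
    letin (letin m n) l = letin m (letin n (l.subst (up (shift Γ A)))) := by
  obtain ⟨M, hM, rfl⟩ := exists_mk m
  obtain ⟨N, hN, rfl⟩ := exists_mk n
  obtain ⟨L, hL, rfl⟩ := exists_mk l
  rw [subst_up_shift_mk]
  simp only [letin_mk]
  exact mk_eq_mk.2 (.let_let hM hN hL)

@[simp] lemma handle_ret (v : Cl Γ (.val A)) (h : CHdl Γ 𝒯.sig B 𝒯') (hr : h.Respects)
    (n : Cl (A :: Γ) (.cmp B 𝒯')) : handle (ret v) h hr n = n.subst ((ids Γ).cons v) := by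
  obtain ⟨V, hV, rfl⟩ := exists_mk v
  obtain ⟨N, hN, rfl⟩ := exists_mk n
  obtain ⟨H, hH, rfl⟩ := CHdl.exists_ofHdl h
  rw [← ofSub_ids, ← ofSub_cons, subst_mk, ret_mk, handle_mk]
  exact mk_eq_mk.2 (.handle_ret hV hH ((CHdl.respects_ofHdl hH).1 hr) hN)

@[simp] lemma handle_letin (l : Cl Γ (.cmp A 𝒯)) (m : Cl (A :: Γ) (.cmp C 𝒯))
    (h : CHdl Γ 𝒯.sig B 𝒯') (hr : h.Respects) (n : Cl (C :: Γ) (.cmp B 𝒯')) :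
    handle (letin l m) h hr n =
      handle l h hr (handle m (h.subst (shift Γ A)) (hr.subst _) (n.subst (up (shift Γ A)))) := by
  obtain ⟨L, hL, rfl⟩ := exists_mk l
  obtain ⟨M, hM, rfl⟩ := exists_mk m
  obtain ⟨N, hN, rfl⟩ := exists_mk n
  obtain ⟨H, hH, rfl⟩ := CHdl.exists_ofHdl h
  simp only [subst_up_shift_mk, CHdl.ofHdl_subst_shift, handle_mk, letin_mk]
  exact mk_eq_mk.2 (.handle_let hL hM hH ((CHdl.respects_ofHdl hH).1 hr) hN)

@[simp] lemma handle_op (o : 𝒯.sig.Idx) (v : Cl Γ (.val (𝒯.sig.argTy o)))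
    (h : CHdl Γ 𝒯.sig B 𝒯') (hr : h.Respects) (n : Cl (𝒯.sig.resTy o :: Γ) (.cmp B 𝒯')) :
    handle (op o v) h hr n = (h o).subst (((ids Γ).cons v).cons (lam n)) := by
  obtain ⟨V, hV, rfl⟩ := exists_mk v
  obtain ⟨N, hN, rfl⟩ := exists_mk n
  obtain ⟨H, hH, rfl⟩ := CHdl.exists_ofHdl h
  rw [lam_mk, ← ofSub_ids, ← ofSub_cons, ← ofSub_cons, op_mk, handle_mk]
  exact (mk_eq_mk.2 (.handle_op o hV hH ((CHdl.respects_ofHdl hH).1 hr) hN)).trans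
    (subst_mk (hH o) _).symm

lemma clInst_ax {e : EqAx 𝒯.sig} (he : e ∈ 𝒯.ax) (σ : CGSub e.ctx Γ) :
    e.lhs.clInst σ = e.rhs.clInst σ := by
  obtain ⟨σ, hσ, rfl⟩ := CGSub.exists_ofGSub σ
  rw [ETm.clInst_ofGSub, ETm.clInst_ofGSub]
  exact mk_eq_mk.2 (.inst_ax he hσ)

end Cl

end Classes

/-! ## The syntactic category -/

section SyntacticCategory

variable {Base Op : Type u} {Γ Δ : Ctx Base Op} {X Y Z W : Ty Base Op}

open CSub

/-- The substitution of a value for the only variable of a context. -/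
def CSub.single (v : Cl Γ (.val X)) : CSub [X] Γ := CSub.cons (fun _ x => nomatch x) v

@[simp] lemma CSub.single_zero (v : Cl Γ (.val X)) : single v .zero = v := rfl

lemma CSub.ext_single {σ τ : CSub [X] Γ} (h : σ .zero = τ .zero) : σ = τ :=
  CSub.ext_cons h fun _ x => nomatch x

@[simp] lemma CSub.comp_single (v : Cl Γ (.val X)) (σ : CSub Γ Δ) :
    comp (single v) σ = single (v.subst σ) :=
  ext_single rfl

@[simp] lemma CSub.single_var : single (.var .zero : Cl [X] (.val X)) = ids [X] :=
  ext_single rfl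

/-- The syntactic category: objects are types, and morphisms `X ⟶ Y` are values of type `Y` in one
variable of type `X`, up to derivable equality. -/
noncomputable instance : Category.{u} (Ty Base Op) where
  Hom X Y := Cl [X] (.val Y)
  id X := .var .zero
  comp f g := Cl.subst g (.single f)
  id_comp f := by simp
  comp_id f := by simp
  assoc f g h := by simp

/-- The action of a morphism on values in an arbitrary context. -/
noncomputable def act (f : X ⟶ Y) (v : Cl Γ (.val X)) : Cl Γ (.val Y) :=
  Cl.subst (Γ := [X]) (s := .val Y) f (.single v)

/-- A value in one variable, as a morphism. -/
def ofCl (f : Cl [X] (.val Y)) : X ⟶ Y := f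

@[simp] lemma act_ofCl (f : Cl [X] (.val Y)) (v : Cl Γ (.val X)) :
    act (ofCl f) v = f.subst (single v) := rfl

@[simp] lemma act_id (v : Cl Γ (.val X)) : act (𝟙 X) v = v := Cl.subst_var _ _

@[simp] lemma act_comp (f : X ⟶ Y) (g : Y ⟶ Z) (v : Cl Γ (.val X)) :
    act (f ≫ g) v = act g (act f v) := by
  refine (Cl.subst_subst (Γ := [Y]) (s := .val Z) g (.single f) (.single v)).trans ?_
  rw [comp_single]; rfl

@[simp] lemma subst_act (f : X ⟶ Y) (v : Cl Γ (.val X)) (σ : CSub Γ Δ) :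
    (act f v).subst σ = act f (v.subst σ) := by
  refine (Cl.subst_subst (Γ := [X]) (s := .val Y) f (.single v) σ).trans ?_
  rw [comp_single]; rfl

lemma hom_ext_act {f g : X ⟶ Y}
    (h : ∀ {Γ : Ctx Base Op} (v : Cl Γ (.val X)), act f v = act g v) : f = g := by
  have := h (Γ := [X]) (.var .zero)
  simp only [act, single_var, Cl.subst_ids] at this
  exact this

/-! ### Finite products -/

section Products

variable {n : ℕ} {A : Fin n → Ty Base Op}

/-- Projections from finite products. -/
noncomputable def projHom (A : Fin n → Ty Base Op) (i : Fin n) : .prod A ⟶ A i :=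
  ofCl (.proj i (.var .zero))

/-- Tupling into finite products. -/
noncomputable def tupleHom (f : ∀ i, Z ⟶ A i) : Z ⟶ .prod A :=
  ofCl (.tuple fun i => act (f i) (.var .zero))

@[simp] lemma act_projHom (i : Fin n) (v : Cl Γ (.val (.prod A))) :
    act (projHom A i) v = .proj i v := by
  simp [projHom]

@[simp] lemma act_tupleHom (f : ∀ i, Z ⟶ A i) (v : Cl Γ (.val Z)) :
    act (tupleHom f) v = .tuple fun i => act (f i) v := by
  simp [tupleHom]

lemma tupleHom_projHom (f : ∀ i, Z ⟶ A i) (i : Fin n) : tupleHom f ≫ projHom A i = f i :=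
  hom_ext_act fun v => by simp

lemma Cl.prod_ext {v w : Cl Γ (.val (.prod A))} (h : ∀ i, Cl.proj i v = Cl.proj i w) : v = w := by
  rw [← Cl.tuple_proj v, ← Cl.tuple_proj w, funext h]

lemma prodHom_ext {f g : Z ⟶ .prod A} (h : ∀ i, f ≫ projHom A i = g ≫ projHom A i) : f = g :=
  hom_ext_act fun v => Cl.prod_ext fun i => by simp only [← act_projHom, ← act_comp, h]

/-- The two factors of a binary product. -/
def pairFam (X Y : Ty Base Op) : Fin 2 → Ty Base Op
  | 0 => X
  | 1 => Y

/-- The two components of a morphism into a binary product. -/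
def pairHoms (f : Z ⟶ X) (g : Z ⟶ Y) : ∀ i, Z ⟶ pairFam X Y i
  | 0 => f
  | 1 => g

/-- The empty product as the terminal object. -/
noncomputable def unitCone : Limits.LimitCone (Functor.empty.{0} (Ty Base Op)) :=
  ⟨Limits.asEmptyCone (.prod (n := 0) (Fin.elim0 ·)),
    Limits.IsTerminal.ofUniqueHom (fun _ => tupleHom fun i => i.elim0)
      fun _ _ => prodHom_ext fun i => i.elim0⟩

/-- Products of two types as binary products. -/
noncomputable def pairCone (X Y : Ty Base Op) : Limits.LimitCone (Limits.pair X Y) :=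
  ⟨Limits.BinaryFan.mk (projHom (pairFam X Y) 0) (projHom (pairFam X Y) 1),
    Limits.BinaryFan.isLimitMk
      (fun s => tupleHom (A := pairFam X Y) (pairHoms (X := X) (Y := Y) s.fst s.snd))
      (fun s => tupleHom_projHom (pairHoms (X := X) (Y := Y) s.fst s.snd) 0)
      (fun s => tupleHom_projHom (pairHoms (X := X) (Y := Y) s.fst s.snd) 1)
      fun s _ h₀ h₁ => prodHom_ext fun
        | 0 => h₀.trans (tupleHom_projHom (pairHoms (X := X) (Y := Y) s.fst s.snd) 0).symm
        | 1 => h₁.trans (tupleHom_projHom (pairHoms (X := X) (Y := Y) s.fst s.snd) 1).symm⟩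

noncomputable instance : CartesianMonoidalCategory (Ty Base Op) :=
  .ofChosenFiniteProducts unitCone pairCone

end Products

namespace Cl

/-- The element of the unit type. -/
noncomputable def unit : Cl Γ (.val (𝟙_ (Ty Base Op))) := tuple (n := 0) (Fin.elim0 ·)

lemma eq_unit (v : Cl Γ (.val (𝟙_ (Ty Base Op)))) : v = unit :=
  prod_ext (n := 0) fun i => i.elim0

@[simp] lemma subst_unit (σ : CSub Γ Δ) : (unit (Base := Base) (Op := Op)).subst σ = unit :=
  eq_unit _

/-- The pair of two values. -/
noncomputable def pair (v : Cl Γ (.val X)) (w : Cl Γ (.val Y)) : Cl Γ (.val (X ⊗ Y)) :=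
  tuple (A := pairFam X Y) fun
    | 0 => v
    | 1 => w

/-- The first projection. -/
noncomputable def fst (p : Cl Γ (.val (X ⊗ Y))) : Cl Γ (.val X) := proj (A := pairFam X Y) 0 p

/-- The second projection. -/
noncomputable def snd (p : Cl Γ (.val (X ⊗ Y))) : Cl Γ (.val Y) := proj (A := pairFam X Y) 1 p

@[simp] lemma fst_pair (v : Cl Γ (.val X)) (w : Cl Γ (.val Y)) : fst (pair v w) = v :=
  proj_tuple 0 _

@[simp] lemma snd_pair (v : Cl Γ (.val X)) (w : Cl Γ (.val Y)) : snd (pair v w) = w :=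
  proj_tuple 1 _

lemma pair_ext {p q : Cl Γ (.val (X ⊗ Y))} (h₁ : p.fst = q.fst) (h₂ : p.snd = q.snd) : p = q :=
  prod_ext (A := pairFam X Y) fun
    | 0 => h₁
    | 1 => h₂

@[simp] lemma pair_fst_snd (p : Cl Γ (.val (X ⊗ Y))) : pair (fst p) (snd p) = p :=
  pair_ext (fst_pair _ _) (snd_pair _ _)

@[simp] lemma subst_fst (p : Cl Γ (.val (X ⊗ Y))) (σ : CSub Γ Δ) :
    (fst p).subst σ = fst (p.subst σ) :=
  subst_proj (A := pairFam X Y) 0 p σ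

@[simp] lemma subst_snd (p : Cl Γ (.val (X ⊗ Y))) (σ : CSub Γ Δ) :
    (snd p).subst σ = snd (p.subst σ) :=
  subst_proj (A := pairFam X Y) 1 p σ

@[simp] lemma subst_pair (v : Cl Γ (.val X)) (w : Cl Γ (.val Y)) (σ : CSub Γ Δ) :
    (pair v w).subst σ = pair (v.subst σ) (w.subst σ) :=
  pair_ext (by rw [← subst_fst, fst_pair, fst_pair]) (by rw [← subst_snd, snd_pair, snd_pair])

end Cl

@[simp] lemma act_fst (p : Cl Γ (.val (X ⊗ Y))) : act (fst X Y) p = p.fst :=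
  act_projHom (A := pairFam X Y) 0 p

@[simp] lemma act_snd (p : Cl Γ (.val (X ⊗ Y))) : act (snd X Y) p = p.snd :=
  act_projHom (A := pairFam X Y) 1 p

@[simp] lemma act_lift (f : Z ⟶ X) (g : Z ⟶ Y) (v : Cl Γ (.val Z)) :
    act (lift f g) v = .pair (act f v) (act g v) := by
  refine Cl.pair_ext ?_ ?_
  · rw [← act_fst, ← act_comp, lift_fst, Cl.fst_pair]
  · rw [← act_snd, ← act_comp, lift_snd, Cl.snd_pair]

@[simp] lemma act_whiskerLeft (Z : Ty Base Op) (f : X ⟶ Y) (p : Cl Γ (.val (Z ⊗ X))) :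
    act (Z ◁ f) p = .pair p.fst (act f p.snd) := by
  refine Cl.pair_ext ?_ ?_
  · rw [← act_fst, ← act_comp, whiskerLeft_fst, Cl.fst_pair, act_fst]
  · rw [← act_snd, ← act_comp, whiskerLeft_snd, Cl.snd_pair, act_comp, act_snd]

@[simp] lemma act_whiskerRight (f : X ⟶ Y) (Z : Ty Base Op) (p : Cl Γ (.val (X ⊗ Z))) :
    act (f ▷ Z) p = .pair (act f p.fst) p.snd := by
  refine Cl.pair_ext ?_ ?_
  · rw [← act_fst, ← act_comp, whiskerRight_fst, Cl.fst_pair, act_comp, act_fst]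
  · rw [← act_snd, ← act_comp, whiskerRight_snd, Cl.snd_pair, act_snd]

@[simp] lemma act_tensorHom (f : X ⟶ Y) (g : Z ⟶ W) (p : Cl Γ (.val (X ⊗ Z))) :
    act (f ⊗ₘ g) p = .pair (act f p.fst) (act g p.snd) := by
  refine Cl.pair_ext ?_ ?_
  · rw [← act_fst, ← act_comp, tensorHom_fst, Cl.fst_pair, act_comp, act_fst]
  · rw [← act_snd, ← act_comp, tensorHom_snd, Cl.snd_pair, act_comp, act_snd]

@[simp] lemma act_leftUnitor (p : Cl Γ (.val (𝟙_ (Ty Base Op) ⊗ X))) :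
    act (λ_ X).hom p = p.snd := by
  rw [leftUnitor_hom, act_snd]

@[simp] lemma act_associator (p : Cl Γ (.val ((X ⊗ Y) ⊗ Z))) :
    act (α_ X Y Z).hom p = .pair p.fst.fst (.pair p.fst.snd p.snd) := by
  refine Cl.pair_ext ?_ (Cl.pair_ext ?_ ?_)
  · rw [← act_fst, ← act_comp, associator_hom_fst]; simp
  · rw [← act_snd, ← act_fst, ← act_comp, ← act_comp, associator_hom_snd_fst]; simp
  · rw [← act_snd, ← act_snd, ← act_comp, ← act_comp, associator_hom_snd_snd]; simp

@[simp] lemma act_associator_inv (p : Cl Γ (.val (X ⊗ (Y ⊗ Z)))) :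
    act (α_ X Y Z).inv p = .pair (.pair p.fst p.snd.fst) p.snd.snd := by
  have h := act_associator (X := X) (Y := Y) (Z := Z) (.pair (.pair p.fst p.snd.fst) p.snd.snd)
  simp only [Cl.fst_pair, Cl.snd_pair, Cl.pair_fst_snd] at h
  rw [← h, ← act_comp, Iso.hom_inv_id, act_id, h]

end SyntacticCategory

/-! ## The type structure of the syntactic category -/

section SyntacticTypes

variable {Base Op : Type u} {Γ Δ : Ctx Base Op} {X Y Z W : Ty Base Op} {𝒯 : Theory Base Op}
  {n : ℕ} {A : Fin n → Ty Base Op}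

open CSub

/-- The type of thunks of computations, `𝟙 → X` with effects in `𝒯`. -/
noncomputable def thunkTy (𝒯 : Theory Base Op) (X : Ty Base Op) : Ty Base Op :=
  .fn (𝟙_ (Ty Base Op)) X 𝒯

namespace Cl

/-- The thunk of a computation. -/
noncomputable def thunk (m : Cl Γ (.cmp X 𝒯)) : Cl Γ (.val (thunkTy 𝒯 X)) :=
  lam (m.subst (shift Γ _))

/-- The computation obtained by forcing a thunk. -/
noncomputable def run (v : Cl Γ (.val (thunkTy 𝒯 X))) : Cl Γ (.cmp X 𝒯) := app v unit

@[simp] lemma run_thunk (m : Cl Γ (.cmp X 𝒯)) : run (thunk m) = m := by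
  refine (app_lam _ _).trans ?_
  simp

@[simp] lemma thunk_run (v : Cl Γ (.val (thunkTy 𝒯 X))) : thunk (run v) = v := by
  refine Eq.trans ?_ (lam_app v)
  refine congrArg lam ((subst_app _ _ _).trans ?_)
  rw [eq_unit (var .zero), subst_unit]

lemma run_injective {v w : Cl Γ (.val (thunkTy 𝒯 X))} (h : run v = run w) : v = w := by
  rw [← thunk_run v, h, thunk_run]

lemma thunk_injective {m n : Cl Γ (.cmp X 𝒯)} (h : thunk m = thunk n) : m = n := by
  rw [← run_thunk m, h, run_thunk]

@[simp] lemma subst_run (v : Cl Γ (.val (thunkTy 𝒯 X))) (σ : CSub Γ Δ) :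
    (run v).subst σ = run (v.subst σ) :=
  (subst_app _ _ _).trans (congrArg _ (subst_unit σ))

@[simp] lemma subst_thunk (m : Cl Γ (.cmp X 𝒯)) (σ : CSub Γ Δ) :
    (thunk m).subst σ = thunk (m.subst σ) :=
  (subst_lam _ _).trans (congrArg lam (by simp))

end Cl

/-- The action of the thunk monad on morphisms. -/
noncomputable def thunkMap (𝒯 : Theory Base Op) (f : X ⟶ Y) : thunkTy 𝒯 X ⟶ thunkTy 𝒯 Y :=
  ofCl (.thunk (.letin (.run (.var .zero)) (.ret (act f (.var .zero)))))

@[simp] lemma act_thunkMap (f : X ⟶ Y) (v : Cl Γ (.val (thunkTy 𝒯 X))) :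
    act (thunkMap 𝒯 f) v = .thunk (.letin v.run (.ret (act f (.var .zero)))) := by
  simp [thunkMap]

/-- The unit of the thunk monad. -/
noncomputable def thunkUnit (𝒯 : Theory Base Op) (X : Ty Base Op) : X ⟶ thunkTy 𝒯 X :=
  ofCl (.thunk (.ret (.var .zero)))

@[simp] lemma act_thunkUnit (v : Cl Γ (.val X)) :
    act (thunkUnit 𝒯 X) v = .thunk (.ret v) := by
  simp [thunkUnit]

/-- The multiplication of the thunk monad. -/
noncomputable def thunkMul (𝒯 : Theory Base Op) (X : Ty Base Op) :
    thunkTy 𝒯 (thunkTy 𝒯 X) ⟶ thunkTy 𝒯 X :=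
  ofCl (.thunk (.letin (.run (.var .zero)) (.run (.var .zero))))

@[simp] lemma act_thunkMul (v : Cl Γ (.val (thunkTy 𝒯 (thunkTy 𝒯 X)))) :
    act (thunkMul 𝒯 X) v = .thunk (.letin v.run (.run (.var .zero))) := by
  simp [thunkMul]

/-- The strength of the thunk monad. -/
noncomputable def thunkStr (𝒯 : Theory Base Op) (X Y : Ty Base Op) :
    X ⊗ thunkTy 𝒯 Y ⟶ thunkTy 𝒯 (X ⊗ Y) :=
  ofCl (.thunk (.letin (.run (.snd (.var .zero)))
    (.ret (.pair (.fst (.var (.succ .zero))) (.var .zero)))))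

@[simp] lemma act_thunkStr (p : Cl Γ (.val (X ⊗ thunkTy 𝒯 Y))) :
    act (thunkStr 𝒯 X Y) p =
      .thunk (.letin p.snd.run (.ret (.pair (p.fst.subst (shift Γ Y)) (.var .zero)))) := by
  simp [thunkStr]

/-- The thunk monad. -/
@[reducible] noncomputable def thunkMonad (𝒯 : Theory Base Op) : StrongMonad (Ty Base Op) where
  obj X := thunkTy 𝒯 X
  map f := thunkMap 𝒯 f
  map_id X := hom_ext_act fun v => by simp
  map_comp f g := hom_ext_act fun v => by simp
  η :=
    { app X := thunkUnit 𝒯 X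
      naturality X Y f := hom_ext_act fun v => by simp }
  μ :=
    { app X := thunkMul 𝒯 X
      naturality X Y f := hom_ext_act fun v => by simp }
  assoc X := hom_ext_act fun v => by simp
  left_unit X := hom_ext_act fun v => by simp
  right_unit X := hom_ext_act fun v => by simp
  str X Y := thunkStr 𝒯 X Y
  str_natural f g := hom_ext_act fun v => by simp
  str_leftUnitor Y := hom_ext_act fun v => by simp
  str_associator X Y Z := hom_ext_act fun v => by simp
  str_unit X Y := hom_ext_act fun v => by simp
  str_mul X Y := hom_ext_act fun v => by simp

/-- Currying for function types. -/
noncomputable def curryHom (f : X ⊗ Y ⟶ thunkTy 𝒯 Z) : X ⟶ .fn Y Z 𝒯 :=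
  ofCl (.lam (.run (act f (.pair (.var (.succ .zero)) (.var .zero)))))

@[simp] lemma act_curryHom (f : X ⊗ Y ⟶ thunkTy 𝒯 Z) (v : Cl Γ (.val X)) :
    act (curryHom f) v = .lam (.run (act f (.pair (v.subst (shift Γ Y)) (.var .zero)))) := by
  simp [curryHom]

/-- Uncurrying for function types. -/
noncomputable def uncurryHom (g : X ⟶ .fn Y Z 𝒯) : X ⊗ Y ⟶ thunkTy 𝒯 Z :=
  ofCl (.thunk (.app (act g (.fst (.var .zero))) (.snd (.var .zero))))

@[simp] lemma act_uncurryHom (g : X ⟶ .fn Y Z 𝒯) (p : Cl Γ (.val (X ⊗ Y))) :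
    act (uncurryHom g) p = .thunk (.app (act g p.fst) p.snd) := by
  simp [uncurryHom]

/-- Case distinction. -/
noncomputable def caseHom (f : ∀ i, Z ⊗ A i ⟶ thunkTy 𝒯 Y) : Z ⊗ .sum A ⟶ thunkTy 𝒯 Y :=
  ofCl (.thunk (.case (.snd (.var .zero))
    fun i => .run (act (f i) (.pair (.fst (.var (.succ .zero))) (.var .zero)))))

@[simp] lemma act_caseHom (f : ∀ i, Z ⊗ A i ⟶ thunkTy 𝒯 Y)
    (p : Cl Γ (.val (Z ⊗ .sum A))) :
    act (caseHom f) p = .thunk (.case p.snd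
      fun i => .run (act (f i) (.pair (p.fst.subst (shift Γ _)) (.var .zero)))) := by
  simp [caseHom]

/-- Injections into finite sums. -/
noncomputable def injHom (A : Fin n → Ty Base Op) (i : Fin n) : A i ⟶ .sum A :=
  ofCl (.inj i (.var .zero))

@[simp] lemma act_injHom (i : Fin n) (v : Cl Γ (.val (A i))) : act (injHom A i) v = .inj i v := by
  simp [injHom]

lemma injHom_caseHom (f : ∀ i, Z ⊗ A i ⟶ thunkTy 𝒯 Y) (i : Fin n) :
    Z ◁ injHom A i ≫ caseHom f = f i :=
  hom_ext_act fun v => by simp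

lemma caseHom_whiskerLeft_injHom (f : Z ⊗ .sum A ⟶ thunkTy 𝒯 Y) :
    caseHom (fun i => Z ◁ injHom A i ≫ f) = f :=
  hom_ext_act fun {Γ} p => by
    simpa using congrArg Cl.thunk
      (Cl.case_eta p.snd (.run (act f (.pair (p.fst.subst (shift Γ _)) (.var .zero)))))

lemma caseHom_ext {f g : Z ⊗ .sum A ⟶ thunkTy 𝒯 Y}
    (h : ∀ i, Z ◁ injHom A i ≫ f = Z ◁ injHom A i ≫ g) : f = g := by
  rw [← caseHom_whiskerLeft_injHom f, ← caseHom_whiskerLeft_injHom g, funext h]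

lemma uncurryHom_curryHom (f : X ⊗ Y ⟶ thunkTy 𝒯 Z) : uncurryHom (curryHom f) = f :=
  hom_ext_act fun v => by simp

lemma curryHom_uncurryHom (g : X ⟶ .fn Y Z 𝒯) : curryHom (uncurryHom g) = g :=
  hom_ext_act fun v => by
    rw [act_curryHom, act_uncurryHom, Cl.run_thunk, Cl.fst_pair, Cl.snd_pair, ← subst_act,
      Cl.lam_app]

lemma curryHom_comp (g : W ⟶ X) (f : X ⊗ Y ⟶ thunkTy 𝒯 Z) :
    curryHom (g ▷ Y ≫ f) = g ≫ curryHom f :=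
  hom_ext_act fun v => by simp

/-- The type structure of the term model: every type former is interpreted by itself, and `T 𝒯` by
thunks. -/
@[reducible] noncomputable def synTypes (Base Op : Type u) : TypeModel Base Op (Ty Base Op) where
  pr X := .prod X
  prProj X i := projHom X i
  prLift f := tupleHom f
  prLift_proj f i := tupleHom_projHom f i
  pr_ext h := prodHom_ext h
  base b := .base b
  T 𝒯 := thunkMonad 𝒯
  kexp 𝒯 Y Z := .fn Y Z 𝒯
  curry {𝒯 _ _ Z} :=
    { toFun := curryHom (𝒯 := 𝒯) (Z := Z)
      invFun := uncurryHom
      left_inv := uncurryHom_curryHom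
      right_inv := curryHom_uncurryHom }
  curry_natural g f := curryHom_comp g f
  sm A := .sum A
  smInj A i := injHom A i
  smCase f := caseHom (Y := _) f
  smInj_case f i := injHom_caseHom (Y := _) f i
  sm_ext h := caseHom_ext (Y := _) h

end SyntacticTypes

/-! ## Transport along equations between types -/

section Transport

variable {Base Op : Type u} {Γ Δ : Ctx Base Op} {X Y Z : Ty Base Op} {𝒯 𝒯' : Theory Base Op}

open CSub

namespace Cl

/-- Transport of values along an equation between types. -/
def cast (h : X = Y) (v : Cl Γ (.val X)) : Cl Γ (.val Y) := h ▸ v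

/-- Transport of computations along an equation between types. -/
def ccast (h : X = Y) (m : Cl Γ (.cmp X 𝒯)) : Cl Γ (.cmp Y 𝒯) := h ▸ m

@[simp] lemma cast_rfl (h : X = X) (v : Cl Γ (.val X)) : cast h v = v := rfl

@[simp] lemma ccast_rfl (h : X = X) (m : Cl Γ (.cmp X 𝒯)) : ccast h m = m := rfl

@[simp] lemma cast_cast (h : X = Y) (h' : Y = Z) (v : Cl Γ (.val X)) :
    cast h' (cast h v) = cast (h.trans h') v := by
  subst h h'; rfl

@[simp] lemma ccast_ccast (h : X = Y) (h' : Y = Z) (m : Cl Γ (.cmp X 𝒯)) :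
    ccast h' (ccast h m) = ccast (h.trans h') m := by
  subst h h'; rfl

@[simp] lemma subst_cast (h : X = Y) (v : Cl Γ (.val X)) (σ : CSub Γ Δ) :
    (cast h v).subst σ = cast h (v.subst σ) := by
  subst h; rfl

@[simp] lemma subst_ccast (h : X = Y) (m : Cl Γ (.cmp X 𝒯)) (σ : CSub Γ Δ) :
    (ccast h m).subst σ = ccast h (m.subst σ) := by
  subst h; rfl

lemma cast_lam {X' Y' : Ty Base Op} (hX : X = X') (hY : Y = Y')
    (h : Ty.fn X Y 𝒯 = Ty.fn X' Y' 𝒯) (m : Cl (X :: Γ) (.cmp Y 𝒯)) :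
    cast h (lam m) =
      lam (ccast hY (m.subst (cons (shift Γ X') (cast hX.symm (var .zero))))) := by
  subst hX hY; simp

lemma app_cast {X' Y' : Ty Base Op} (hX : X = X') (hY : Y = Y')
    (h : Ty.fn X Y 𝒯 = Ty.fn X' Y' 𝒯) (v : Cl Γ (.val (.fn X Y 𝒯))) (w : Cl Γ (.val X')) :
    app (cast h v) w = ccast hY (app v (cast hX.symm w)) := by
  subst hX hY; simp

lemma tuple_cast {n : ℕ} {A B : Fin n → Ty Base Op} (hA : ∀ i, A i = B i)
    (h : Ty.prod A = Ty.prod B) (v : ∀ i, Cl Γ (.val (A i))) :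
    tuple (fun i => cast (hA i) (v i)) = cast h (tuple v) := by
  obtain rfl : A = B := funext hA
  simp

lemma proj_cast {n : ℕ} {A B : Fin n → Ty Base Op} (hA : ∀ i, A i = B i)
    (h : Ty.prod A = Ty.prod B) (i : Fin n) (v : Cl Γ (.val (.prod A))) :
    proj i (cast h v) = cast (hA i) (proj i v) := by
  obtain rfl : A = B := funext hA
  simp

lemma inj_cast {n : ℕ} {A B : Fin n → Ty Base Op} (hA : ∀ i, A i = B i)
    (h : Ty.sum A = Ty.sum B) (i : Fin n) (v : Cl Γ (.val (A i))) :
    inj i (cast (hA i) v) = cast h (inj i v) := by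
  obtain rfl : A = B := funext hA
  simp

lemma case_cast {n : ℕ} {A B : Fin n → Ty Base Op} (hA : ∀ i, A i = B i)
    (h : Ty.sum A = Ty.sum B) (v : Cl Γ (.val (.sum A))) (m : ∀ i, Cl (B i :: Γ) (.cmp Y 𝒯)) :
    case (cast h v) m =
      case v fun i => (m i).subst (cons (shift Γ (A i)) (cast (hA i) (var .zero))) := by
  obtain rfl : A = B := funext hA
  simp

lemma ccast_case {n : ℕ} {A : Fin n → Ty Base Op} (h : X = Y) (v : Cl Γ (.val (.sum A)))
    (m : ∀ i, Cl (A i :: Γ) (.cmp X 𝒯)) : ccast h (case v m) = case v fun i => ccast h (m i) := by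
  subst h; simp

lemma ret_cast (h : X = Y) (v : Cl Γ (.val X)) : ret (𝒯 := 𝒯) (cast h v) = ccast h (ret v) := by
  subst h; simp

lemma letin_ccast (h : X = Y) (m : Cl Γ (.cmp X 𝒯)) (n : Cl (Y :: Γ) (.cmp Z 𝒯)) :
    letin (ccast h m) n = letin m (n.subst (cons (shift Γ X) (cast h (var .zero)))) := by
  subst h; simp

lemma ccast_letin (h : X = Y) (m : Cl Γ (.cmp Z 𝒯)) (n : Cl (Z :: Γ) (.cmp X 𝒯)) :
    ccast h (letin m n) = letin m (ccast h n) := by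
  subst h; simp

lemma handle_ccast (h : X = Y) (m : Cl Γ (.cmp X 𝒯)) (H : CHdl Γ 𝒯.sig Z 𝒯') (hr : H.Respects)
    (n : Cl (Y :: Γ) (.cmp Z 𝒯')) :
    handle (ccast h m) H hr n =
      handle m H hr (n.subst (cons (shift Γ X) (cast h (var .zero)))) := by
  subst h; simp

end Cl

/-- Transport of handlers along an equation between types. -/
def CHdl.cast {S : Sig Base Op} (h : X = Y) (H : CHdl Γ S X 𝒯') : CHdl Γ S Y 𝒯' := h ▸ H

lemma CHdl.cast_apply {S : Sig Base Op} (h : X = Y) (H : CHdl Γ S X 𝒯') (o : S.Idx) :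
    H.cast h o = .ccast h ((H o).subst (cons (cons (comp (shift Γ _) (shift _ _))
      (.var (.succ .zero))) (.cast (by rw [h]) (.var .zero)))) := by
  subst h; simp [CHdl.cast]

lemma CHdl.Respects.cast {H : CHdl Γ 𝒯.sig X 𝒯'} (hr : H.Respects) (h : X = Y) :
    (H.cast h).Respects := by
  subst h; exact hr

lemma Cl.ccast_handle (h : X = Y) (m : Cl Γ (.cmp Z 𝒯)) (H : CHdl Γ 𝒯.sig X 𝒯') (hr : H.Respects)
    (n : Cl (Z :: Γ) (.cmp X 𝒯')) :
    ccast h (handle m H hr n) = handle m (H.cast h) (hr.cast h) (ccast h n) := by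
  subst h; rfl

end Transport

/-! ## Effect theory terms in the syntactic category -/

section EffectTheoryTerms

variable {Base Op : Type u} {Γ Δ : Ctx Base Op} {X Y Z : Ty Base Op} {𝒯 : Theory Base Op}
  {G : List (GTy Base)}

open CSub

local notation "𝓢" => synTypes Base Op

lemma synTypes_ty (A : Ty Base Op) : (𝓢).ty A = A := by
  induction A with
  | base b => rfl
  | fn A B 𝒯 ihA ihB => exact congrArg₂ (Ty.fn · · 𝒯) ihA ihB
  | prod A ih => exact congrArg Ty.prod (funext ih)
  | sum A ih => exact congrArg Ty.sum (funext ih)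

lemma synTypes_gty (A : GTy Base) : (𝓢).gty A = A.toTy Op := synTypes_ty _

@[simp] lemma act_ev (p : Cl Γ (.val (.fn Y Z 𝒯 ⊗ Y))) :
    act ((𝓢).ev 𝒯 Y Z) p = .thunk (.app p.fst p.snd) := by
  refine (act_uncurryHom (𝟙 (Ty.fn Y Z 𝒯)) p).trans ?_
  rw [act_id]

lemma run_act_bind (f : Z ⟶ thunkTy 𝒯 X) (g : Z ⊗ X ⟶ thunkTy 𝒯 Y) (v : Cl Γ (.val Z)) :
    Cl.run (act ((𝓢).bind (𝒯 := 𝒯) f g) v) =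
      .letin (.run (act f v)) (.run (act g (.pair (v.subst (shift Γ X)) (.var .zero)))) := by
  change Cl.run (act (lift (𝟙 Z) f ≫ thunkStr 𝒯 Z X ≫ thunkMap 𝒯 g ≫ thunkMul 𝒯 Y) v) = _
  simp

lemma run_act_smCase {n : ℕ} {X : Fin n → Ty Base Op} (f : Z ⟶ .sum X)
    (g : ∀ i, Z ⊗ X i ⟶ thunkTy 𝒯 Y) (v : Cl Γ (.val Z)) :
    Cl.run (act (lift (𝟙 Z) f ≫ (𝓢).smCase (𝒯 := 𝒯) g) v) =
      .case (act f v) fun i => .run (act (g i) (.pair (v.subst (shift Γ (X i))) (.var .zero))) := by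
  change Cl.run (act (lift (𝟙 Z) f ≫ caseHom g) v) = _
  simp

/-- The components of an element of the interpretation of a ground context. -/
noncomputable def components (d : Cl Γ (.val ((𝓢).gctx G))) : CGSub G Γ :=
  fun A x => .cast (synTypes_gty A) (act (varHom (𝓢).gty x) d)

lemma components_comp (d : Cl Γ (.val ((𝓢).gctx G))) (σ : CSub Γ Δ) :
    (components d).comp σ = components (d.subst σ) := by
  funext A x
  simp [components, CGSub.comp_apply]

lemma components_pair {A : GTy Base} (d : Cl Γ (.val ((𝓢).gctx G)))
    (v : Cl Γ (.val ((𝓢).gty A))) :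
    components (G := A :: G) (.pair d v) = (components d).cons (.cast (synTypes_gty A) v) := by
  refine CGSub.ext_cons ?_ fun B x => ?_
  · refine congrArg (Cl.cast _) ((act_snd _).trans ?_)
    exact Cl.snd_pair _ _
  · refine congrArg (Cl.cast _) ((act_comp _ _ _).trans (congrArg _ ((act_fst _).trans ?_)))
    exact Cl.fst_pair _ _

lemma exists_components (σ : CGSub G Γ) :
    ∃ d : Cl Γ (.val ((𝓢).gctx G)), components d = σ := by
  induction G with
  | nil => exact ⟨.unit, funext fun _ => funext fun x => nomatch x⟩
  | cons A G ih =>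
    obtain ⟨d, hd⟩ := ih fun _ x => σ (.succ x)
    refine ⟨.pair d (.cast (synTypes_gty A).symm (σ .zero)), ?_⟩
    rw [components_pair, hd]
    exact CGSub.ext_cons (by simp [CGSub.cons]) fun _ _ => rfl

lemma act_gtm {A : GTy Base} (V : GTm G A)
    (d : Cl Γ (.val ((𝓢).gctx G))) :
    act ((𝓢).gtm V) d = .cast (synTypes_gty A).symm (V.clInst (components d)) := by
  induction V with
  | var x => simp [TypeModel.gtm, GTm.clInst, components]
  | @tuple n A V ih =>
    refine (act_tupleHom _ _).trans ((congrArg Cl.tuple (funext ih)).trans ?_)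
    exact Cl.tuple_cast (fun i => (synTypes_gty (A i)).symm) _ _
  | @proj n A i V ih =>
    refine (act_comp _ _ _).trans ((act_projHom _ _).trans
      ((congrArg (Cl.proj (A := fun i => (𝓢).gty (A i)) i) ih).trans ?_))
    exact Cl.proj_cast (fun i => (synTypes_gty (A i)).symm) _ _ _
  | @inj n A i V ih =>
    refine (act_comp _ _ _).trans ((act_injHom _ _).trans
      ((congrArg (Cl.inj (A := fun i => (𝓢).gty (A i)) i) ih).trans ?_))
    exact Cl.inj_cast (fun i => (synTypes_gty (A i)).symm) _ _ _

/-- The generic effects of the syntactic category. -/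
noncomputable def synOp (𝒯 : Theory Base Op) (o : 𝒯.sig.Idx) :
    (𝓢).gty (𝒯.sig.arg o) ⟶ thunkTy 𝒯 ((𝓢).gty (𝒯.sig.res o)) :=
  ofCl (.thunk (.ccast (synTypes_gty _).symm (.op o (.cast (synTypes_gty _) (.var .zero)))))

@[simp] lemma act_synOp (o : 𝒯.sig.Idx) (v : Cl Γ (.val ((𝓢).gty (𝒯.sig.arg o)))) :
    act (synOp 𝒯 o) v =
      .thunk (.ccast (synTypes_gty _).symm (.op o (.cast (synTypes_gty _) v))) := by
  simp [synOp]

lemma run_act_etm {A : GTy Base} (M : ETm 𝒯.sig G A)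
    (d : Cl Γ (.val ((𝓢).gctx G))) :
    Cl.run (act ((𝓢).etm (𝒯 := 𝒯) (synOp 𝒯) M) d) =
      .ccast (synTypes_gty A).symm (M.clInst (components d)) := by
  induction M generalizing Γ with
  | ret V =>
    refine (congrArg Cl.run ((act_comp _ _ _).trans (act_thunkUnit _))).trans ?_
    rw [act_gtm, Cl.run_thunk, Cl.ret_cast]; rfl
  | letop o V M ih =>
    have h : Cl.run (act ((𝓢).gtm V ≫ synOp 𝒯 o) d) =
        .ccast (synTypes_gty _).symm (.op o (V.clInst (components d))) := by
      simp [act_gtm]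
    refine (run_act_bind _ _ _).trans ((congrArg₂ Cl.letin h (ih _)).trans ?_)
    rw [Cl.letin_ccast, components_pair]
    simp [ETm.clInst, Cl.ccast_letin, ETm.clInst_subst, components_comp]
  | @case G A n B V M ih =>
    refine (run_act_smCase _ _ _).trans
      ((congr (congrArg Cl.case (act_gtm V d)) (funext fun i => ih i _)).trans ?_)
    refine (Cl.case_cast (fun i => (synTypes_gty (B i)).symm) _ _ _).trans ?_
    refine Eq.trans ?_ (Cl.ccast_case _ _ _).symm
    refine congrArg _ (funext fun i => ?_)
    simp [ETm.clInst_subst, components_comp, components_pair]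

end EffectTheoryTerms

/-! ## The syntactic model -/

section SyntacticModel

variable {Base Op : Type u} {Γ Δ : Ctx Base Op} {X Y Z W : Ty Base Op} {𝒯 𝒯' : Theory Base Op}
  {S : Sig Base Op}

open CSub

local notation "𝓢" => synTypes Base Op

lemma fn_gty (A : GTy Base) (X : Ty Base Op) (𝒯 : Theory Base Op) :
    Ty.fn ((𝓢).gty A) X 𝒯 = Ty.fn (A.toTy Op) X 𝒯 := by
  rw [synTypes_gty]

/-- The projections from the object of algebra structures. -/
noncomputable def algProj (S : Sig Base Op) (𝒯' : Theory Base Op) (X : Ty Base Op) (o : S.Idx) :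
    (𝓢).hb S 𝒯' X ⟶
      .fn ((𝓢).gty (S.arg o) ⊗ .fn ((𝓢).gty (S.res o)) X 𝒯') X 𝒯' :=
  (𝓢).hbProj S 𝒯' X o

/-- The handler classified by an element of the object of algebra structures: its clauses apply the
components of the element to the pair of parameter and continuation. -/
noncomputable def ofAlg (h : Cl Γ (.val ((𝓢).hb S 𝒯' X))) : CHdl Γ S X 𝒯' := fun o =>
  .app (act (algProj S 𝒯' X o) (h.subst (comp (shift Γ _) (shift _ _))))
    (.pair (.cast (synTypes_gty _).symm (.var (.succ .zero)))
      (.cast (fn_gty _ _ _).symm (.var .zero)))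

lemma ofAlg_subst (h : Cl Γ (.val ((𝓢).hb S 𝒯' X))) (σ : CSub Γ Δ) :
    (ofAlg h).subst σ = ofAlg (h.subst σ) := by
  funext o
  simp [ofAlg, CHdl.subst_apply]

lemma ofAlg_inst (h : Cl Γ (.val ((𝓢).hb S 𝒯' X))) (o : S.Idx) (v : Cl Γ (.val (S.argTy o)))
    (k : Cl Γ (.val (.fn (S.resTy o) X 𝒯'))) :
    (ofAlg h o).subst (cons (cons (ids Γ) v) k) =
      .app (act (algProj S 𝒯' X o) h)
        (.pair (.cast (synTypes_gty _).symm v) (.cast (fn_gty _ _ _).symm k)) := by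
  simp [ofAlg]

lemma act_shuffle {H D K A : Ty Base Op} (h : Cl Γ (.val H)) (d : Cl Γ (.val D))
    (k : Cl Γ (.val K)) (a : Cl Γ (.val A)) :
    act (TypeModel.shuffle H D K A) (.pair (.pair h (.pair d k)) a) =
      .pair h (.pair (.pair d a) k) := by
  simp [TypeModel.shuffle]

lemma run_act_algRet {H D A : Ty Base Op} (V : D ⟶ A) (h : Cl Γ (.val H)) (d : Cl Γ (.val D))
    (k : Cl Γ (.val (.fn A X 𝒯'))) :
    Cl.run (act (snd H _ ≫ lift (snd _ _) (fst _ _ ≫ V) ≫ (𝓢).ev 𝒯' A X)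
      (.pair h (.pair d k))) = .app k (act V d) := by
  simp

lemma run_act_algLetop {H D K P R : Ty Base Op} (p : H ⟶ .fn (P ⊗ .fn R X 𝒯') X 𝒯')
    (V : D ⟶ P) (g : H ⊗ ((D ⊗ R) ⊗ K) ⟶ thunkTy 𝒯' X) (h : Cl Γ (.val H)) (d : Cl Γ (.val D))
    (k : Cl Γ (.val K)) :
    Cl.run (act (lift (fst H _ ≫ p) (lift (snd _ _ ≫ fst _ _ ≫ V)
      ((𝓢).curry (𝒯 := 𝒯') (TypeModel.shuffle _ _ _ _ ≫ g))) ≫ (𝓢).ev 𝒯' _ X)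
        (.pair h (.pair d k))) =
      .app (act p h) (.pair (act V d) (.lam (.run (act g (.pair (h.subst (shift Γ _))
        (.pair (.pair (d.subst (shift Γ _)) (.var .zero)) (k.subst (shift Γ _)))))))) := by
  change Cl.run (act (lift (fst H _ ≫ p) (lift (snd _ _ ≫ fst _ _ ≫ V)
    (curryHom (TypeModel.shuffle _ _ _ _ ≫ g))) ≫ (𝓢).ev 𝒯' _ X) (.pair h (.pair d k))) = _
  simp [act_shuffle]

lemma run_act_algCase {H D K : Ty Base Op} {n : ℕ} {B : Fin n → Ty Base Op} (V : D ⟶ .sum B)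
    (g : ∀ i, H ⊗ ((D ⊗ B i) ⊗ K) ⟶ thunkTy 𝒯' X) (h : Cl Γ (.val H)) (d : Cl Γ (.val D))
    (k : Cl Γ (.val K)) :
    Cl.run (act (lift (𝟙 _) (snd H (D ⊗ K) ≫ fst _ _ ≫ V) ≫
      (𝓢).smCase (𝒯 := 𝒯') fun i => TypeModel.shuffle _ _ _ _ ≫ g i) (.pair h (.pair d k))) =
      .case (act V d) fun i => .run (act (g i) (.pair (h.subst (shift Γ _))
        (.pair (.pair (d.subst (shift Γ _)) (.var .zero)) (k.subst (shift Γ _))))) := by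
  refine (run_act_smCase _ _ _).trans ?_
  simp [act_shuffle]

variable {G : List (GTy Base)} {A : GTy Base}

lemma run_act_algUncurried (M : ETm S G A)
    (h : Cl Γ (.val ((𝓢).hb S 𝒯' X))) (d : Cl Γ (.val ((𝓢).gctx G)))
    (k : Cl Γ (.val (.fn ((𝓢).gty A) X 𝒯'))) :
    Cl.run (act (Y := thunkTy 𝒯' X) ((𝓢).algUncurried 𝒯' X M) (.pair h (.pair d k))) =
      M.clHandleWith (ofAlg h) (components d) (.cast (fn_gty _ _ _) k) := by
  induction M generalizing Γ with
  | ret V =>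
    rw [TypeModel.algUncurried]
    refine (run_act_algRet _ _ _ _).trans ?_
    rw [act_gtm, ETm.clHandleWith, Cl.app_cast (synTypes_gty _) rfl, Cl.ccast_rfl]
  | @letop G A o V M ih =>
    rw [TypeModel.algUncurried]
    refine (run_act_algLetop (algProj S 𝒯' X o) _ _ _ _ _).trans ?_
    refine (congrArg (fun m => Cl.app _ (Cl.pair _ (Cl.lam m))) (ih _ _ _)).trans ?_
    rw [ETm.clHandleWith, ofAlg_inst, act_gtm, components_pair,
      Cl.cast_lam (synTypes_gty _).symm rfl]
    simp [ETm.clHandleWith_subst, ofAlg_subst, components_comp]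
  | @case G A n B V M ih =>
    rw [TypeModel.algUncurried]
    refine (run_act_algCase _ _ _ _ _).trans ?_
    refine (congr (congrArg Cl.case (act_gtm V d)) (funext fun i => ih i _ _ _)).trans ?_
    refine (Cl.case_cast (fun i => (synTypes_gty (B i)).symm) _ _ _).trans ?_
    refine congrArg _ (funext fun i => ?_)
    simp [ETm.clHandleWith_subst, ofAlg_subst, components_comp, components_pair]

lemma app_act_alg (M : ETm S G A)
    (h : Z ⟶ (𝓢).hb S 𝒯' X) (v : Cl Γ (.val Z)) (d : Cl Γ (.val ((𝓢).gctx G)))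
    (k : Cl Γ (.val (.fn ((𝓢).gty A) X 𝒯'))) :
    Cl.app (A := (𝓢).gctx G ⊗ Ty.fn ((𝓢).gty A) X 𝒯') (B := X) (𝒯 := 𝒯')
      (act (h ≫ (𝓢).alg 𝒯' X M) v) (.pair d k) =
      M.clHandleWith (ofAlg (act h v)) (components d) (.cast (fn_gty _ _ _) k) := by
  rw [← run_act_algUncurried]
  set a : (𝓢).hb S 𝒯' X ⊗ ((𝓢).gctx G ⊗ Ty.fn ((𝓢).gty A) X 𝒯') ⟶ thunkTy 𝒯' X :=
    (𝓢).algUncurried 𝒯' X M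
  change Cl.app (act (h ≫ curryHom a) v) (.pair d k) = .run (act a (.pair (act h v) (.pair d k)))
  simp

lemma act_alg (M : ETm S G A) (h : Z ⟶ (𝓢).hb S 𝒯' X) (v : Cl Γ (.val Z)) :
    act (h ≫ (𝓢).alg 𝒯' X M) v =
      Cl.lam (A := (𝓢).gctx G ⊗ Ty.fn ((𝓢).gty A) X 𝒯') (B := X) (𝒯 := 𝒯')
        (M.clHandleWith (ofAlg (act h (v.subst (shift Γ _))))
          (components (.fst (.var .zero))) (.cast (fn_gty _ _ _) (.snd (.var .zero)))) := by
  rw [← app_act_alg, Cl.pair_fst_snd, ← subst_act]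
  exact (Cl.lam_app _).symm

lemma sat_iff_respects (h : Z ⟶ (𝓢).hb 𝒯.sig 𝒯' X) :
    (𝓢).Sat 𝒯 𝒯' X h ↔ ∀ {Γ : Ctx Base Op} (v : Cl Γ (.val Z)),
      CHdl.Respects (𝒯 := 𝒯) (ofAlg (act h v)) := by
  constructor
  · intro hh Γ v e he Δ τ σ k
    obtain ⟨d, rfl⟩ := exists_components σ
    have hl := app_act_alg e.lhs h (v.subst τ) d (.cast (fn_gty _ _ _).symm k)
    have hr := app_act_alg e.rhs h (v.subst τ) d (.cast (fn_gty _ _ _).symm k)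
    rw [hh e he] at hl
    simpa [ofAlg_subst] using hl.symm.trans hr
  · intro hh e he
    refine hom_ext_act fun {Γ} v => ?_
    have generic := hh v e he (shift Γ ((𝓢).gctx e.ctx ⊗ Ty.fn ((𝓢).gty e.ty) X 𝒯'))
      (components (.fst (.var .zero))) (.cast (fn_gty _ _ _) (.snd (.var .zero)))
    rw [ofAlg_subst, subst_act] at generic
    rw [act_alg, act_alg]
    exact congrArg Cl.lam generic

/-- Handling in the syntactic category: a satisfying morphism into the object of algebra structures
is turned into the handler it classifies, and the remaining computation is forced in the
continuation. -/
noncomputable def handleHom (𝒯 𝒯' : Theory Base Op) (X : Ty Base Op)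
    (h : Z ⟶ (𝓢).hb 𝒯.sig 𝒯' X) (hh : (𝓢).Sat 𝒯 𝒯' X h)
    (f : Z ⟶ thunkTy 𝒯 (thunkTy 𝒯' X)) : Z ⟶ thunkTy 𝒯' X :=
  ofCl (.thunk (.handle (.run (act f (.var .zero))) (ofAlg (act h (.var .zero)))
    ((sat_iff_respects h).1 hh _) (.run (.var .zero))))

lemma act_handleHom (h : Z ⟶ (𝓢).hb 𝒯.sig 𝒯' X) (hh : (𝓢).Sat 𝒯 𝒯' X h)
    (f : Z ⟶ thunkTy 𝒯 (thunkTy 𝒯' X)) (v : Cl Γ (.val Z)) :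
    act (handleHom 𝒯 𝒯' X h hh f) v =
      .thunk (.handle (.run (act f v)) (ofAlg (act h v)) ((sat_iff_respects h).1 hh _)
        (.run (.var .zero))) := by
  simp [handleHom, ofAlg_subst]

lemma handleHom_natural (h : Z ⟶ (𝓢).hb 𝒯.sig 𝒯' X) (hh : (𝓢).Sat 𝒯 𝒯' X h)
    (f : Z ⟶ thunkTy 𝒯 (thunkTy 𝒯' X)) (g : W ⟶ Z) :
    g ≫ handleHom 𝒯 𝒯' X h hh f = handleHom 𝒯 𝒯' X (g ≫ h) (hh.comp g) (g ≫ f) :=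
  hom_ext_act fun v => by simp [act_handleHom]

lemma handleHom_unit (h : Z ⟶ (𝓢).hb 𝒯.sig 𝒯' X) (hh : (𝓢).Sat 𝒯 𝒯' X h)
    (f : Z ⟶ thunkTy 𝒯' X) : handleHom 𝒯 𝒯' X h hh (f ≫ thunkUnit 𝒯 _) = f :=
  hom_ext_act fun v => by simp [act_handleHom]

lemma handleHom_mul (h : Z ⟶ (𝓢).hb 𝒯.sig 𝒯' X) (hh : (𝓢).Sat 𝒯 𝒯' X h)
    (f : Z ⟶ thunkTy 𝒯 (thunkTy 𝒯 (thunkTy 𝒯' X))) :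
    handleHom 𝒯 𝒯' X h hh (f ≫ thunkMul 𝒯 _) =
      handleHom 𝒯 𝒯' X h hh (lift (𝟙 Z) f ≫ thunkStr 𝒯 _ _ ≫
        thunkMap 𝒯 (handleHom 𝒯 𝒯' X (fst Z _ ≫ h) (hh.comp (fst Z _)) (snd _ _))) :=
  hom_ext_act fun v => by simp [act_handleHom, ofAlg_subst]

lemma handleHom_op (h : Z ⟶ (𝓢).hb 𝒯.sig 𝒯' X) (hh : (𝓢).Sat 𝒯 𝒯' X h) (o : 𝒯.sig.Idx)
    (f : Z ⟶ (𝓢).gty (𝒯.sig.arg o) ⊗ .fn ((𝓢).gty (𝒯.sig.res o)) X 𝒯') :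
    handleHom 𝒯 𝒯' X h hh (f ≫ synOp 𝒯 o ▷ _ ≫ lift (snd _ _) (fst _ _) ≫
      thunkStr 𝒯 _ _ ≫ thunkMap 𝒯 ((𝓢).ev 𝒯' _ X)) =
      lift (h ≫ algProj 𝒯.sig 𝒯' X o) f ≫ (𝓢).ev 𝒯' _ X :=
  hom_ext_act fun {Γ} v => by
    have eta : Cl.lam (.app (Cl.subst (.snd (act f v)) (shift Γ _))
        (.cast (synTypes_gty (𝒯.sig.res o)).symm (.var .zero))) =
        .cast (fn_gty _ _ _) (Cl.snd (act f v)) := by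
      rw [← Cl.lam_app (.cast _ _), Cl.subst_cast, Cl.app_cast (synTypes_gty _) rfl, Cl.ccast_rfl]
    simp only [Cl.subst_snd, subst_act] at eta
    simp [act_handleHom, Cl.letin_ccast, ofAlg_inst, eta]

/-- The term model: types as objects and classes of values in one variable as morphisms. -/
@[reducible] noncomputable def synModel (Base Op : Type u) : Model Base Op (Ty Base Op) where
  toTypeModel := synTypes Base Op
  op 𝒯 o := synOp 𝒯 o
  op_sat 𝒯 e he := hom_ext_act fun v => Cl.run_injective (by
    rw [run_act_etm, run_act_etm, Cl.clInst_ax he])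
  handle 𝒯 𝒯' X _ h hh f := handleHom 𝒯 𝒯' X h hh f
  handle_natural 𝒯 𝒯' X _ _ h hh f g := handleHom_natural h hh f g
  handle_unit 𝒯 𝒯' X _ h hh f := handleHom_unit h hh f
  handle_mul 𝒯 𝒯' X _ h hh f := handleHom_mul h hh f
  handle_op 𝒯 𝒯' X _ h hh o f := handleHom_op h hh o f

end SyntacticModel

/-! ## The interpretation of terms in the term model -/

lemma partPi_some {ι : Type u} {β : ι → Type v} (b : ∀ i, β i) :
    partPi (fun i => Part.some (b i)) = Part.some b :=
  Part.ext' ⟨fun _ => trivial, fun _ _ => trivial⟩ fun _ _ => rfl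

lemma TypeModel.hbLift_hbProj {Base Op : Type u} {C : Type w} [Category.{v} C]
    [CartesianMonoidalCategory C] (𝓜 : TypeModel Base Op C) (S : Sig Base Op)
    (𝒯' : Theory Base Op) (X : C) {Z : C}
    (f : ∀ o : S.Idx,
      Z ⟶ 𝓜.kexp 𝒯' (𝓜.gty (S.arg o) ⊗ 𝓜.kexp 𝒯' (𝓜.gty (S.res o)) X) X) (o : S.Idx) :
    𝓜.hbLift S 𝒯' X f ≫ 𝓜.hbProj S 𝒯' X o = f o := by
  have comp_eqToHom : ∀ (o' : S.Idx) (h : o' = o), f o' ≫ eqToHom (by rw [h]) = f o := by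
    rintro _ rfl
    simp
  rw [TypeModel.hbLift, TypeModel.hbProj, ← Category.assoc, 𝓜.prLift_proj]
  exact comp_eqToHom _ (Equiv.symm_apply_apply _ _)

lemma Model.clauses_eq_some {Base Op : Type u} {C : Type w} [Category.{v} C]
    [CartesianMonoidalCategory C] (𝓜 : Model Base Op C) {Z : C} {S : Sig Base Op} {B : Ty Base Op}
    {𝒯' : Theory Base Op} {p : ∀ o : S.Idx, Part
      ((Z ⊗ 𝓜.ty (S.argTy o)) ⊗ 𝓜.ty (.fn (S.resTy o) B 𝒯') ⟶ (𝓜.T 𝒯').obj (𝓜.ty B))}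
    {m : ∀ o : S.Idx,
      (Z ⊗ 𝓜.ty (S.argTy o)) ⊗ 𝓜.ty (.fn (S.resTy o) B 𝒯') ⟶ (𝓜.T 𝒯').obj (𝓜.ty B)}
    (h : ∀ o, p o = Part.some (m o)) :
    𝓜.clauses p =
      Part.some (𝓜.hbLift S 𝒯' (𝓜.ty B) fun o => 𝓜.curry ((α_ _ _ _).inv ≫ m o)) := by
  rw [clauses, funext h, partPi_some]
  exact Part.map_some _ _

section Interpretation

variable {Base Op : Type u} {Γ Δ Ξ : Ctx Base Op} {s : Kind Base Op} {A B : Ty Base Op}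
  {𝒯 𝒯' : Theory Base Op} {S : Sig Base Op} {n : ℕ} {As : Fin n → Ty Base Op}

open CSub

local notation "𝓢" => synTypes Base Op

/-- The substitution given by the components of an element of the interpretation of a context. -/
noncomputable def values (d : Cl Δ (.val ((𝓢).ctx Γ))) : CSub Γ Δ :=
  fun A x => .cast (synTypes_ty A) (act (varHom (𝓢).ty x) d)

lemma values_comp (d : Cl Δ (.val ((𝓢).ctx Γ))) (σ : CSub Δ Ξ) :
    comp (values d) σ = values (d.subst σ) := by
  funext A x
  simp [values, comp_apply]

lemma values_pair (d : Cl Δ (.val ((𝓢).ctx Γ))) (v : Cl Δ (.val ((𝓢).ty A))) :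
    values (Γ := A :: Γ) (.pair d v) = cons (values d) (.cast (synTypes_ty A) v) := by
  refine CSub.ext_cons ?_ fun B x => ?_
  · refine congrArg (Cl.cast _) ((act_snd _).trans ?_)
    exact Cl.snd_pair _ _
  · refine congrArg (Cl.cast _) ((act_comp _ _ _).trans (congrArg _ ((act_fst _).trans ?_)))
    exact Cl.fst_pair _ _

lemma exists_values (σ : CSub Γ Δ) : ∃ d : Cl Δ (.val ((𝓢).ctx Γ)), values d = σ := by
  induction Γ with
  | nil => exact ⟨.unit, funext fun _ => funext fun x => nomatch x⟩
  | cons A Γ ih =>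
    obtain ⟨d, hd⟩ := ih fun _ x => σ (.succ x)
    refine ⟨.pair d (.cast (synTypes_ty A).symm (σ .zero)), ?_⟩
    rw [values_pair, hd]
    exact CSub.ext_cons (by simp) fun _ _ => rfl

/-- A class of terms as an element of the interpretation of its kind; computations are thunked. -/
noncomputable def reify : ∀ {s : Kind Base Op}, Cl Γ s → Cl Γ (.val ((𝓢).kind s))
  | .val A, v => .cast (synTypes_ty A).symm v
  | .cmp A _, m => .thunk (.ccast (synTypes_ty A).symm m)

lemma reify_injective {m n : Cl Γ s} (h : reify m = reify n) : m = n := by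
  cases s with
  | val A => simpa [reify] using congrArg (Cl.cast (synTypes_ty A)) h
  | cmp A 𝒯 => simpa using congrArg (Cl.ccast (synTypes_ty A)) (Cl.thunk_injective h)

/-- A morphism out of the interpretation of `Γ` represents a class of terms in context `Γ` if it
acts on elements as substitution in the class. -/
def Represents (m : (𝓢).ctx Γ ⟶ (𝓢).kind s) (c : Cl Γ s) : Prop :=
  ∀ ⦃Δ : Ctx Base Op⦄ (d : Cl Δ (.val ((𝓢).ctx Γ))), act m d = reify (c.subst (values d))

/-- A morphism into the object of algebra structures represents a handler if it classifies the
substitution instances of the handler. -/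
def RepresentsHdl (h : (𝓢).ctx Γ ⟶ (𝓢).hb S 𝒯' ((𝓢).ty B)) (H : CHdl Γ S B 𝒯') : Prop :=
  ∀ ⦃Δ : Ctx Base Op⦄ (d : Cl Δ (.val ((𝓢).ctx Γ))),
    ofAlg (act h d) = (H.subst (values d)).cast (synTypes_ty B).symm

lemma Represents.unique {m : (𝓢).ctx Γ ⟶ (𝓢).kind s} {c c' : Cl Γ s} (h : Represents m c)
    (h' : Represents m c') : c = c' := by
  obtain ⟨d, hd⟩ := exists_values (ids Γ)
  have e := (h d).symm.trans (h' d)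
  rw [hd, Cl.subst_ids, Cl.subst_ids] at e
  exact reify_injective e

lemma CHdl.cast_injective (h : A = B) {H H' : CHdl Γ S A 𝒯'} (e : H.cast h = H'.cast h) :
    H = H' := by
  subst h; exact e

lemma RepresentsHdl.unique {h : (𝓢).ctx Γ ⟶ (𝓢).hb S 𝒯' ((𝓢).ty B)} {H H' : CHdl Γ S B 𝒯'}
    (hH : RepresentsHdl h H) (hH' : RepresentsHdl h H') : H = H' := by
  obtain ⟨d, hd⟩ := exists_values (ids Γ)
  have e := (hH d).symm.trans (hH' d)
  rw [hd, CHdl.subst_ids, CHdl.subst_ids] at e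
  exact CHdl.cast_injective _ e

namespace Represents

lemma var (x : Var Γ A) : Represents (varHom (𝓢).ty x) (.var x) := fun _ d => by
  rw [Cl.subst_var, reify, values, Cl.cast_cast, Cl.cast_rfl]

lemma lam {m : (𝓢).ctx (A :: Γ) ⟶ (𝓢).kind (.cmp B 𝒯)} {c : Cl (A :: Γ) (.cmp B 𝒯)}
    (h : Represents m c) :
    Represents (s := .val (.fn A B 𝒯)) ((𝓢).curry (𝒯 := 𝒯) m) (.lam c) := fun _ d => by
  refine (act_curryHom _ _).trans ((congrArg (fun v => Cl.lam (Cl.run v)) (h _)).trans ?_)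
  rw [Cl.subst_lam, reify]
  refine Eq.trans ?_ (Cl.cast_lam (synTypes_ty _).symm (synTypes_ty _).symm _ _).symm
  rw [reify, Cl.run_thunk, values_pair]
  simp [values_comp]

lemma tuple {m : ∀ i, (𝓢).ctx Γ ⟶ (𝓢).ty (As i)} {c : ∀ i, Cl Γ (.val (As i))}
    (h : ∀ i, Represents (s := .val (As i)) (m i) (c i)) :
    Represents (s := .val (.prod As)) ((𝓢).prLift m) (.tuple c) := fun _ d => by
  refine (act_tupleHom _ _).trans ((congrArg Cl.tuple (funext fun i => h i d)).trans ?_)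
  rw [Cl.subst_tuple, reify]
  exact Cl.tuple_cast (fun i => (synTypes_ty _).symm) _ _

lemma proj (i : Fin n) {m : (𝓢).ctx Γ ⟶ (𝓢).kind (.val (.prod As))}
    {c : Cl Γ (.val (.prod As))} (h : Represents m c) :
    Represents (s := .val (As i)) (m ≫ (𝓢).prProj (fun i => (𝓢).ty (As i)) i) (.proj i c) :=
  fun _ d => by
    refine (act_comp _ _ _).trans ((act_projHom _ _).trans
      ((congrArg (Cl.proj (A := fun i => (𝓢).ty (As i)) i) (h d)).trans ?_))
    rw [Cl.subst_proj, reify, reify]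
    exact Cl.proj_cast (fun i => (synTypes_ty _).symm) _ _ _

lemma inj (i : Fin n) {m : (𝓢).ctx Γ ⟶ (𝓢).kind (.val (As i))} {c : Cl Γ (.val (As i))}
    (h : Represents m c) :
    Represents (s := .val (.sum As)) (m ≫ (𝓢).smInj (fun i => (𝓢).ty (As i)) i) (.inj i c) :=
  fun _ d => by
    refine (act_comp _ _ _).trans ((act_injHom _ _).trans
      ((congrArg (Cl.inj (A := fun i => (𝓢).ty (As i)) i) (h d)).trans ?_))
    rw [Cl.subst_inj, reify, reify]
    exact Cl.inj_cast (fun i => (synTypes_ty (As i)).symm) _ _ _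

lemma app {v : (𝓢).ctx Γ ⟶ (𝓢).kind (.val (.fn A B 𝒯))} {w : (𝓢).ctx Γ ⟶ (𝓢).kind (.val A)}
    {c : Cl Γ (.val (.fn A B 𝒯))} {c' : Cl Γ (.val A)} (h : Represents v c)
    (h' : Represents w c') :
    Represents (s := .cmp B 𝒯) (lift v w ≫ (𝓢).ev 𝒯 ((𝓢).ty A) ((𝓢).ty B)) (.app c c') :=
  fun _ d => by
    refine (act_comp _ _ _).trans ((congrArg _ (act_lift _ _ _)).trans ((act_ev _).trans ?_))
    rw [Cl.subst_app, reify]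
    refine congrArg Cl.thunk ((congrArg₂ Cl.app ((Cl.fst_pair _ _).trans (h d))
      ((Cl.snd_pair _ _).trans (h' d))).trans ?_)
    refine (Cl.app_cast (synTypes_ty _).symm (synTypes_ty _).symm _ _ _).trans ?_
    rw [reify, Cl.cast_cast, Cl.cast_rfl]

lemma ret {v : (𝓢).ctx Γ ⟶ (𝓢).kind (.val A)} {c : Cl Γ (.val A)} (h : Represents v c) :
    Represents (s := .cmp A 𝒯) (v ≫ ((𝓢).T 𝒯).η.app _) (.ret c) := fun _ d => by
  refine (act_comp _ _ _).trans ((act_thunkUnit _).trans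
    ((congrArg (fun v => Cl.thunk (Cl.ret v)) (h d)).trans ?_))
  rw [Cl.subst_ret, reify, reify, Cl.ret_cast]

lemma letin {m : (𝓢).ctx Γ ⟶ (𝓢).kind (.cmp A 𝒯)} {m' : (𝓢).ctx (A :: Γ) ⟶ (𝓢).kind (.cmp B 𝒯)}
    {c : Cl Γ (.cmp A 𝒯)} {c' : Cl (A :: Γ) (.cmp B 𝒯)} (h : Represents m c)
    (h' : Represents m' c') : Represents (s := .cmp B 𝒯) ((𝓢).bind m m') (.letin c c') :=
  fun _ d => by
    refine Cl.run_injective ((run_act_bind _ _ _).trans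
      ((congrArg₂ (fun v w => Cl.letin (Cl.run v) (Cl.run w)) (h d) (h' _)).trans ?_))
    rw [Cl.subst_letin, reify, reify, reify, values_pair]
    simp [Cl.letin_ccast, Cl.ccast_letin, values_comp]

lemma op (o : 𝒯.sig.Idx) {v : (𝓢).ctx Γ ⟶ (𝓢).kind (.val (𝒯.sig.argTy o))}
    {c : Cl Γ (.val (𝒯.sig.argTy o))} (h : Represents v c) :
    Represents (s := .cmp (𝒯.sig.resTy o) 𝒯) (v ≫ synOp 𝒯 o) (.op o c) := fun _ d => by
  refine (act_comp _ _ _).trans ((act_synOp _ _).trans ?_)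
  rw [h, Cl.subst_op, reify, reify, Cl.cast_cast, Cl.cast_rfl]

lemma case {v : (𝓢).ctx Γ ⟶ (𝓢).kind (.val (.sum As))}
    {m : ∀ i, (𝓢).ctx (As i :: Γ) ⟶ (𝓢).kind (.cmp B 𝒯)} {c : Cl Γ (.val (.sum As))}
    {c' : ∀ i, Cl (As i :: Γ) (.cmp B 𝒯)} (h : Represents v c)
    (h' : ∀ i, Represents (m i) (c' i)) :
    Represents (s := .cmp B 𝒯) (lift (𝟙 _) v ≫ (𝓢).smCase (X := fun i => (𝓢).ty (As i)) m)
      (.case c c') := fun _ d => by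
  refine Cl.run_injective ((run_act_smCase _ _ _).trans
    ((congr (congrArg Cl.case (h d)) (funext fun i => congrArg Cl.run (h' i _))).trans ?_))
  rw [Cl.subst_case, reify, reify]
  refine (Cl.case_cast (fun i => (synTypes_ty (As i)).symm) _ _ _).trans ?_
  rw [Cl.run_thunk, Cl.ccast_case]
  refine congrArg _ (funext fun i => ?_)
  rw [reify, Cl.run_thunk, values_pair]
  simp [values_comp]

end Represents

lemma app_act_curryHom_assoc {X Y Z W : Ty Base Op} (g : (Z ⊗ X) ⊗ Y ⟶ thunkTy 𝒯 W)
    (v : Cl Γ (.val Z)) (x : Cl Γ (.val X)) (y : Cl Γ (.val Y)) :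
    Cl.app (act (curryHom ((α_ Z X Y).inv ≫ g)) v) (.pair x y) =
      .run (act g (.pair (.pair v x) y)) := by
  simp

lemma RepresentsHdl.mk {H : CHdl Γ S B 𝒯'}
    {m : ∀ o : S.Idx, (𝓢).ctx (.fn (S.resTy o) B 𝒯' :: S.argTy o :: Γ) ⟶ (𝓢).kind (.cmp B 𝒯')}
    (h : ∀ o, Represents (m o) (H o)) :
    RepresentsHdl ((𝓢).hbLift S 𝒯' ((𝓢).ty B) fun o =>
      (𝓢).curry (𝒯 := 𝒯') ((α_ _ _ _).inv ≫ m o)) H := fun Δ d => by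
  funext o
  have act_algProj : ∀ {Ξ : Ctx Base Op} (d : Cl Ξ (.val ((𝓢).ctx Γ))),
      act (algProj S 𝒯' ((𝓢).ty B) o) (act ((𝓢).hbLift S 𝒯' ((𝓢).ty B) fun o =>
        (𝓢).curry (𝒯 := 𝒯') ((α_ _ _ _).inv ≫ m o)) d) =
      act (curryHom ((α_ _ _ _).inv ≫ m o)) d := fun d => by
    rw [← act_comp]
    exact congrArg (act · d) (TypeModel.hbLift_hbProj _ _ _ _ _ _)
  rw [CHdl.cast_apply, ofAlg, subst_act, act_algProj]
  refine (app_act_curryHom_assoc _ _ _ _).trans ?_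
  refine (congrArg Cl.run (h o _)).trans ((Cl.run_thunk _).trans (congrArg _ ?_))
  refine (congrArg _ ((values_pair _ _).trans (congrArg (cons · _) (values_pair _ _)))).trans ?_
  simp only [Cl.cast_cast, Cl.cast_rfl, CHdl.subst_apply, up, values_comp, comp_cons,
    Cl.subst_subst, Cl.subst_var, shift_apply, cons_shift_shift, comp_assoc, shift_comp,
    cons_succ, cons_zero]
  exact congrArg (fun v => Cl.subst _ (cons _ v)) (Cl.cast_cast _ _ _)

lemma Cl.handle_congr {m m' : Cl Γ (.cmp A 𝒯)} {h h' : CHdl Γ 𝒯.sig B 𝒯'}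
    {n n' : Cl (A :: Γ) (.cmp B 𝒯')} (em : m = m') (eh : h = h') (en : n = n')
    (hr : h.Respects) : handle m h hr n = handle m' h' (eh ▸ hr) n' := by
  subst em eh en; rfl

lemma act_handleHom_lift {X Y Z : Ty Base Op} (h : Z ⟶ (𝓢).hb 𝒯.sig 𝒯' X)
    (hh : (𝓢).Sat 𝒯 𝒯' X h) (f : Z ⟶ thunkTy 𝒯 Y) (g : Z ⊗ Y ⟶ thunkTy 𝒯' X)
    (v : Cl Γ (.val Z)) :
    act (handleHom 𝒯 𝒯' X h hh (lift (𝟙 _) f ≫ thunkStr 𝒯 _ _ ≫ thunkMap 𝒯 g)) v =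
      .thunk (.handle (.run (act f v)) (ofAlg (act h v)) ((sat_iff_respects h).1 hh _)
        (.run (act g (.pair (v.subst (shift Γ _)) (.var .zero))))) := by
  simp [act_handleHom]

lemma RepresentsHdl.sat {h : (𝓢).ctx Γ ⟶ (𝓢).hb 𝒯.sig 𝒯' ((𝓢).ty B)}
    {H : CHdl Γ 𝒯.sig B 𝒯'} (hH : RepresentsHdl h H) (hr : H.Respects) :
    (𝓢).Sat 𝒯 𝒯' ((𝓢).ty B) h :=
  (sat_iff_respects h).2 fun v => by
    rw [hH]
    exact (hr.subst _).cast _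

lemma Represents.handle {m : (𝓢).ctx Γ ⟶ (𝓢).kind (.cmp A 𝒯)}
    {h : (𝓢).ctx Γ ⟶ (𝓢).hb 𝒯.sig 𝒯' ((𝓢).ty B)}
    {k : (𝓢).ctx (A :: Γ) ⟶ (𝓢).kind (.cmp B 𝒯')} {c : Cl Γ (.cmp A 𝒯)} {H : CHdl Γ 𝒯.sig B 𝒯'}
    {c' : Cl (A :: Γ) (.cmp B 𝒯')} (hm : Represents m c) (hH : RepresentsHdl h H)
    (hr : H.Respects) (hk : Represents k c') :
    Represents (s := .cmp B 𝒯') (handleHom 𝒯 𝒯' ((𝓢).ty B) h (hH.sat hr)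
      (lift (𝟙 _) m ≫ thunkStr 𝒯 _ _ ≫ thunkMap 𝒯 k)) (.handle c H hr c') := fun _ d => by
  refine (act_handleHom_lift _ _ _ _ _).trans ?_
  rw [Cl.subst_handle, reify, Cl.ccast_handle]
  refine congrArg Cl.thunk ((Cl.handle_congr ((congrArg Cl.run (hm d)).trans (Cl.run_thunk _))
    (hH d) ((congrArg Cl.run (hk _)).trans (Cl.run_thunk _)) _).trans ?_)
  refine (Cl.handle_ccast _ _ _ _ _).trans (Cl.handle_congr rfl rfl ?_ _)
  rw [values_pair]
  simp [values_comp]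

lemma exists_representsHdl_of_clauses {H : Hdl Γ S B 𝒯'} (hH : H.Wf)
    (h : ∀ o, ∃ m, (synModel Base Op).interp (H o) = Part.some m ∧
      Represents m (.mk (H o) (hH o))) :
    ∃ m, (synModel Base Op).interpHdl H = Part.some m ∧ RepresentsHdl m (.ofHdl H hH) := by
  choose m hm e using h
  exact ⟨_, (synModel Base Op).clauses_eq_some hm, .mk e⟩

lemma exists_represents {Γ : Ctx Base Op} {s : Kind Base Op} {M : Tm Γ s} (hM : M.Wf) :
    ∃ m, (synModel Base Op).interp M = Part.some m ∧ Represents m (.mk M hM) := by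
  match hM with
  | .var x => exact ⟨_, rfl, .var x⟩
  | .lam h =>
    obtain ⟨m, hm, e⟩ := exists_represents h
    exact ⟨_, by rw [Model.interp, hm]; exact Part.map_some _ _, Cl.lam_mk h ▸ e.lam⟩
  | .tuple h =>
    choose m hm e using fun i => exists_represents (h i)
    exact ⟨_, by rw [Model.interp, funext hm, partPi_some]; exact Part.map_some _ _,
      Cl.tuple_mk h ▸ Represents.tuple e⟩
  | .proj i h =>
    obtain ⟨m, hm, e⟩ := exists_represents h
    exact ⟨_, by rw [Model.interp, hm]; exact Part.map_some _ _, Cl.proj_mk i h ▸ e.proj i⟩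
  | .inj i h =>
    obtain ⟨m, hm, e⟩ := exists_represents h
    exact ⟨_, by rw [Model.interp, hm]; exact Part.map_some _ _, Cl.inj_mk i h ▸ e.inj i⟩
  | .app h h' =>
    obtain ⟨v, hv, e⟩ := exists_represents h
    obtain ⟨w, hw, e'⟩ := exists_represents h'
    exact ⟨_, by rw [Model.interp, hv, hw]; exact (Part.bind_some _ _).trans (Part.map_some _ _),
      Cl.app_mk h h' ▸ e.app e'⟩
  | .ret h =>
    obtain ⟨v, hv, e⟩ := exists_represents h
    exact ⟨_, by rw [Model.interp, hv]; exact Part.map_some _ _, Cl.ret_mk h ▸ e.ret⟩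
  | .letin h h' =>
    obtain ⟨m, hm, e⟩ := exists_represents h
    obtain ⟨k, hk, e'⟩ := exists_represents h'
    exact ⟨_, by rw [Model.interp, hm, hk]; exact (Part.bind_some _ _).trans (Part.map_some _ _),
      Cl.letin_mk h h' ▸ e.letin e'⟩
  | .op o h =>
    obtain ⟨v, hv, e⟩ := exists_represents h
    exact ⟨_, by rw [Model.interp, hv]; exact Part.map_some _ _, Cl.op_mk o h ▸ e.op o⟩
  | .case h h' =>
    obtain ⟨v, hv, e⟩ := exists_represents h
    choose m hm e' using fun i => exists_represents (h' i)
    exact ⟨_, by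
      rw [Model.interp, hv, funext hm, partPi_some]
      exact (Part.bind_some _ _).trans (Part.map_some _ _), Cl.case_mk h h' ▸ e.case e'⟩
  | .handle (H := H) h hH hr h' =>
    obtain ⟨m, hm, e⟩ := exists_represents h
    obtain ⟨k, hk, e'⟩ := exists_represents h'
    obtain ⟨c, hc, eH⟩ := exists_representsHdl_of_clauses hH fun o => exists_represents (hH o)
    have hr' : (CHdl.ofHdl H hH).Respects := (CHdl.respects_ofHdl hH).2 hr
    refine ⟨_, ?_, Cl.handle_mk h hH hr' h' ▸ e.handle eH hr' e'⟩
    rw [Model.interpHdl] at hc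
    rw [Model.interp, hm, hk, hc, Part.bind_some, Part.bind_some, Part.bind_some,
      Part.assert_pos (eH.sat hr')]

lemma exists_representsHdl {H : Hdl Γ S B 𝒯'} (hH : H.Wf) :
    ∃ m, (synModel Base Op).interpHdl H = Part.some m ∧ RepresentsHdl m (.ofHdl H hH) :=
  exists_representsHdl_of_clauses hH fun o => exists_represents (hH o)

end Interpretation

end EffCalc

theorem mainTheorem3_general (Base Op : Type u) :
    (∀ (Γ : EffCalc.Ctx Base Op) (s : EffCalc.Kind Base Op) (M N : EffCalc.Tm Γ s),
      M.Wf → N.Wf →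
      (EffCalc.synModel Base Op).interp M = (EffCalc.synModel Base Op).interp N → M.Equ N) ∧
    (∀ (Γ : EffCalc.Ctx Base Op) (S : EffCalc.Sig Base Op) (A : EffCalc.Ty Base Op)
      (𝒯 : EffCalc.Theory Base Op) (H H' : EffCalc.Hdl Γ S A 𝒯), H.Wf → H'.Wf →
      (EffCalc.synModel Base Op).interpHdl H = (EffCalc.synModel Base Op).interpHdl H' →
      H.Equ H') := by
  refine ⟨fun Γ s M N hM hN h => ?_, fun Γ S A 𝒯 H H' hH hH' h => ?_⟩
  · obtain ⟨m, hm, hmM⟩ := EffCalc.exists_represents hM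
    obtain ⟨n, hn, hnN⟩ := EffCalc.exists_represents hN
    obtain rfl : m = n := Part.some_injective (hm.symm.trans (h.trans hn))
    exact EffCalc.Cl.mk_eq_mk.1 (hmM.unique hnN)
  · obtain ⟨m, hm, hmH⟩ := EffCalc.exists_representsHdl hH
    obtain ⟨n, hn, hnH⟩ := EffCalc.exists_representsHdl hH'
    obtain rfl : m = n := Part.some_injective (hm.symm.trans (h.trans hn))
    exact fun o => EffCalc.Cl.mk_eq_mk.1 (congrFun (hmH.unique hnH) o)

theorem mainTheorem3 (Base Op : Type u) (Γ : EffCalc.Ctx Base Op) :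
    (∀ (A : EffCalc.Ty Base Op) (V W : EffCalc.Val Γ A), V.Wf → W.Wf →
      (∀ (C : Type u) [Category.{u} C] [CartesianMonoidalCategory C]
        (𝓜 : EffCalc.Model Base Op C), 𝓜.interp V = 𝓜.interp W) →
      EffCalc.Tm.Equ V W) ∧
    (∀ (A : EffCalc.Ty Base Op) (𝒯 : EffCalc.Theory Base Op) (M N : EffCalc.Cmp Γ A 𝒯),
      M.Wf → N.Wf →
      (∀ (C : Type u) [Category.{u} C] [CartesianMonoidalCategory C]
        (𝓜 : EffCalc.Model Base Op C), 𝓜.interp M = 𝓜.interp N) →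
      EffCalc.Tm.Equ M N) ∧
    (∀ (S : EffCalc.Sig Base Op) (A : EffCalc.Ty Base Op) (𝒯 : EffCalc.Theory Base Op)
      (H H' : EffCalc.Hdl Γ S A 𝒯), H.Wf → H'.Wf →
      (∀ (C : Type u) [Category.{u} C] [CartesianMonoidalCategory C]
        (𝓜 : EffCalc.Model Base Op C), 𝓜.interpHdl H = 𝓜.interpHdl H') →
      H.Equ H') := by
  obtain ⟨complete, completeHdl⟩ := mainTheorem3_general Base Op
  exact ⟨fun _ _ _ hV hW h => complete _ _ _ _ hV hW (h _ (EffCalc.synModel Base Op)),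
    fun _ _ _ _ hM hN h => complete _ _ _ _ hM hN (h _ (EffCalc.synModel Base Op)),
    fun _ _ _ _ _ hH hH' h => completeHdl _ _ _ _ _ _ hH hH' (h _ (EffCalc.synModel Base Op))⟩
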